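/- Let $\Bbbk$ be a commutative ring containing $\mathbb{Q}$. A \emph{complete left-unital dg pre-Lie algebra} $\mathfrak{a}=(A,\mathrm{F},d,\star,1)$ consists of $\Bbbk$-modules $A_i$, $i\in\mathbb{Z}$, each with a decreasing filtration by submodules $A_i=\mathrm{F}_0A_i\supset \mathrm{F}_1A_i\supset\cdots$ such that the canonical map $A_i\to\lim_k A_i/\mathrm{F}_kA_i$ is bijective; a filtration-preserving square-zero differential $d$ of degree $-1$; a bilinear product $\star$ of degree $0$ with $\mathrm{F}_pA\star \mathrm{F}_qA\subset \mathrm{F}_{p+q}A$ and $$(a\star b)\star c-a\star(b\star c)=(-1)^{|b||c|}\big((a\star c)\star b-a\star(c\star b)\big),\qquad d(a\star b)=d(a)\star b+(-1)^{|a|}a\star d(b);$$ and an element $1\in A_0$ with $d(1)=0$ and $1\star a=a$ for all $a$. The following series are considered in $A_0$, with the topology in which the sets $\mathrm{F}_kA_0$ form a neighbourhood basis of $0$. For $x\in \mathrm{F}_1A_0$ let $x^{\star 0}=1$, $x^{\star(n+1)}=x^{\star n}\star x$, and let the \emph{pre-Lie exponential} be $e^x=\sum_{n\ge0}\frac1{n!}x^{\star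 n}$. The \emph{pre-Lie logarithm} is the Magnus expansion $\ln(1+x)=\Omega(x)=\sum_{n\ge1}\Omega_n(x)$, with $$\Omega_{n+1}(x)=\sum_{j\ge 0}\frac{B_j}{j!}\sum_{\substack{n_1+\cdots+n_j=n\\ n_i\ge1}}(\cdots((x\star\Omega_{n_1}(x))\star\Omega_{n_2}(x))\cdots)\star\Omega_{n_j}(x)\quad(n\ge 0),$$ where $B_j$ are the Bernoulli numbers, $B_1=-\frac12$; thus $\Omega(x)=x-\frac12x\star x+\frac14x\star(x\star x)+\frac1{12}(x\star x)\star x+\cdots$. The \emph{symmetric braces} are given by $\{a;\}=a$ and $$\{a;b_1,\dots,b_n\}=\{a;b_1,\dots,b_{n-1}\}\star b_n-\sum_{i=1}^{n-1}\{a;b_1,\dots,b_{i-1},b_i\star b_n,b_{i+1},\dots,b_{n-1}\},$$ and the \emph{circle product} is $a\circledcirc(1+b)=\sum_{n\ge0}\frac1{n!}\{a;b,\dots,b\}$ (with $n$ arguments $b$ in the $n$-th term), for $a\in A_0$ and $b\in \mathrm{F}_1A_0$. Finally $\mathrm{BCH}(x,y)$, for $x,y\in \mathrm{F}_1A_0$,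 is the Baker--Campbell--Hausdorff series of the Lie bracket $[a,b]=a\star b-b\star a$ on $A_0$, in Dynkin's form $$\mathrm{BCH}(x,y)=\sum_{n\ge1}\ \sum_{m=1}^{n}\ \sum_{\substack{(r_i,s_i)\ne(0,0)\\ \sum_{i=1}^m(r_i+s_i)=n}}\frac{(-1)^{m-1}}{m\,n\,\prod_{i=1}^m r_i!\,s_i!}\,[x^{r_1}y^{s_1}\cdots x^{r_m}y^{s_m}],$$ where $[\cdot]$ denotes the right-nested bracket $[a_1,[a_2,[\cdots,a_n]]]$ of a word. A \emph{filtered group} is a group $G$ with a decreasing sequence of subgroups $G=\mathrm{F}_1G\supset \mathrm{F}_2G\supset\cdots$ such that $xyx^{-1}y^{-1}\in \mathrm{F}_{i+j}G$ for $x\in \mathrm{F}_iG$, $y\in \mathrm{F}_jG$; it is \emph{complete} if the topology in which the $\mathrm{F}_kG$ form a neighbourhood basis of the unit is Hausdorff and complete. \textbf{Theorem.} Let $\mathfrak{a}$ be a complete left-unital dg pre-Lie algebra and let $G=1+\mathrm{F}_1A_0$. All the above series converge. The data $\mathfrak{G}=(G,\{1+\mathrm{F}_kA_0\}_{k\ge1},\circledcirc,1)$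 is a complete group, the gauge group $\Gamma=(\mathrm{F}_1A_0,\{\mathrm{F}_kA_0\}_{k\ge1},\mathrm{BCH},0)$ is a complete group, and the pre-Lie exponential $\Gamma\to\mathfrak{G}$, $x\mapsto e^x$, and the pre-Lie logarithm $\mathfrak{G}\to\Gamma$, $g\mapsto\ln g$, are mutually inverse group isomorphisms which carry $\mathrm{F}_kA_0$ onto $1+\mathrm{F}_kA_0$, and conversely, for every $k\ge1$; in particular they are homeomorphisms. -/

import Mathlib

open Filter

/-- The uniform structure on `X` whose entourages are generated by a sequence of equivalence
relations. For a filtered module the `n`-th relation is congruence modulo the `n`-th submodule, for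
a filtered group it is the equality of left cosets of the `n`-th subgroup. -/
abbrev uniformSpaceOfSetoids {X : Type*} (r : ℕ → Setoid X) : UniformSpace X :=
  UniformSpace.ofCore
    { uniformity := ⨅ n, 𝓟 {p : X × X | (r n) p.1 p.2}
      refl := by
        refine le_iInf fun n => principal_mono.2 ?_
        rintro ⟨x, y⟩ hxy
        obtain rfl : x = y := by simpa using hxy
        exact (r n).refl x
      symm := by
        refine tendsto_iInf.2 fun n => ?_
        refine tendsto_principal.2 ?_
        exact mem_iInf_of_mem n (mem_principal.2 fun p hp => (r n).symm hp)
      comp := by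
        refine le_iInf fun n => ?_
        refine lift'_le (mem_iInf_of_mem n (mem_principal_self _)) (principal_mono.2 ?_)
        rintro ⟨x, y⟩ ⟨z, hxz, hzy⟩
        exact (r n).trans hxz hzy }

/-! ### Filtered and complete modules -/

section Module

variable {k : Type*} [CommRing k] {M : Type*} [AddCommGroup M] [Module k M]

/-- The limit of the tower `M / F 0 ← M / F 1 ← M / F 2 ← ⋯` of a decreasing filtration. -/
def FiltrationLimit (F : ℕ → Submodule k M) (hF : Antitone F) : Type _ :=
  {x : ∀ n, M ⧸ F n // ∀ n, Submodule.factor (hF n.le_succ) (x (n + 1)) = x n}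

/-- The canonical map from `M` to the limit of its quotients. -/
def toFiltrationLimit (F : ℕ → Submodule k M) (hF : Antitone F) (m : M) : FiltrationLimit F hF :=
  ⟨fun n => (F n).mkQ m, fun _ => rfl⟩

/-- The uniform structure of a filtered module. -/
abbrev filteredModuleUniformSpace (F : ℕ → Submodule k M) : UniformSpace M :=
  uniformSpaceOfSetoids fun n => (F n).quotientRel

/-- `s` is the sum of the series `∑ u n` for the topology defined by the filtration. -/
def IsSeriesSum (F : ℕ → Submodule k M) (u : ℕ → M) (s : M) : Prop :=
  Tendsto (fun N => ∑ n ∈ Finset.range N, u n) atTop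
    (@nhds M (filteredModuleUniformSpace F).toTopologicalSpace s)

open Classical in
/-- The sum of the series `∑ u n` for the topology defined by the filtration (zero if the series
diverges). -/
noncomputable def seriesSum (F : ℕ → Submodule k M) (u : ℕ → M) : M :=
  if h : ∃ s, IsSeriesSum F u s then h.choose else 0

end Module

/-! ### Filtered and complete groups -/

section Group

variable {G : Type*} [Group G]

/-- The uniform structure of a filtered group; its topology has the cosets `g (F n)` as a basis. -/
abbrev filteredGroupUniformSpace (F : ℕ → Subgroup G) : UniformSpace G :=
  uniformSpaceOfSetoids fun n => QuotientGroup.leftRel (F n)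

/-- A filtered group `G = F 1 ⊇ F 2 ⊇ ⋯`. The filtration is indexed by the positive integers; the
term `F 0`, which is forced to be `G` as well, is there only for convenience. -/
structure IsFilteredGroup (F : ℕ → Subgroup G) : Prop where
  one_eq_top : F 1 = ⊤
  antitone : Antitone F
  commutator_mem : ∀ i j : ℕ, ∀ x ∈ F i, ∀ y ∈ F j, x * y * x⁻¹ * y⁻¹ ∈ F (i + j)

/-- A complete group: a filtered group whose topology is Hausdorff and complete. The subgroups of
the filtration are normal, so that the left and the right uniform structures agree. -/
structure IsCompleteGroup (F : ℕ → Subgroup G) : Prop extends IsFilteredGroup F where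
  t2 : @T2Space G (filteredGroupUniformSpace F).toTopologicalSpace
  complete : @CompleteSpace G (filteredGroupUniformSpace F)

end Group

/-! ### The Baker–Campbell–Hausdorff series -/

/-- The right-nested bracket `[a₁, [a₂, [⋯, aₙ]]]` of a nonempty list. -/
def nestedBracket {L : Type*} [Zero L] (br : L → L → L) : List L → L
  | [] => 0
  | [a] => a
  | a :: b :: l => br a (nestedBracket br (b :: l))

/-- The component of degree `n` of the Baker–Campbell–Hausdorff series in Dynkin's form:
the sum over `m ≥ 1` and over the `m`-tuples of pairs `(rᵢ, sᵢ) ≠ (0, 0)` with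
`∑ (rᵢ + sᵢ) = n` of `(-1) ^ (m - 1) / (m * n * ∏ rᵢ! sᵢ!)` times the right-nested bracket of
the word `x ^ r₁ y ^ s₁ ⋯ x ^ rₘ y ^ sₘ`. -/
noncomputable def bchTerm (k : Type*) [CommRing k] [Algebra ℚ k] {L : Type*} [AddCommGroup L]
    [Module k L] (br : L → L → L) (x y : L) (n : ℕ) : L :=
  ∑ m ∈ Finset.Icc 1 n,
    ∑ c ∈ Fintype.piFinset
        (fun _ : Fin m => Finset.range (n + 1) ×ˢ Finset.range (n + 1)) with
        (∀ i, c i ≠ (0, 0)) ∧ ∑ i, ((c i).1 + (c i).2) = n,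
      algebraMap ℚ k ((-1 : ℚ) ^ (m - 1) /
          ((m : ℚ) * (n : ℚ) *
            ∏ i, (((c i).1.factorial : ℚ) * ((c i).2.factorial : ℚ)))) •
        nestedBracket br
          (List.ofFn fun i =>
            List.replicate (c i).1 x ++ List.replicate (c i).2 y).flatten

/-! ### Complete left-unital dg pre-Lie algebras -/

/-- A complete left-unital differential graded pre-Lie algebra over `k`, with homogeneous
components `A i`, `i : ℤ`, and homological grading. The product of `A i` and `A j` lands in
`A l` whenever `i + j = l`. -/
structure CompletePreLieAlgebra (k : Type*) [CommRing k] (A : ℤ → Type*)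
    [∀ i, AddCommGroup (A i)] [∀ i, Module k (A i)] where
  /-- The filtration of each component. -/
  F : ∀ i, ℕ → Submodule k (A i)
  F_zero : ∀ i, F i 0 = ⊤
  F_antitone : ∀ i, Antitone (F i)
  complete : ∀ i, Function.Bijective (toFiltrationLimit (F i) (F_antitone i))
  /-- The differential. -/
  d : ∀ i, A i →ₗ[k] A (i - 1)
  d_mem : ∀ i p, ∀ a ∈ F i p, d i a ∈ F (i - 1) p
  d_d : ∀ i (a : A i), d (i - 1) (d i a) = 0
  /-- The pre-Lie product. -/
  mul : ∀ {i j l : ℤ}, i + j = l → (A i →ₗ[k] A j →ₗ[k] A l)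
  mul_mem : ∀ {i j l : ℤ} (h : i + j = l) (p q : ℕ), ∀ a ∈ F i p, ∀ b ∈ F j q,
    mul h a b ∈ F l (p + q)
  right_symm : ∀ {i j l ij jl il t : ℤ} (hij : i + j = ij) (hjl : j + l = jl) (hlj : l + j = jl)
    (hil : i + l = il) (h₁ : ij + l = t) (h₂ : i + jl = t) (h₃ : il + j = t)
    (a : A i) (b : A j) (c : A l),
    mul h₁ (mul hij a b) c - mul h₂ a (mul hjl b c) =
      (j * l).negOnePow • (mul h₃ (mul hil a c) b - mul h₂ a (mul hlj c b))
  d_mul : ∀ {i j l : ℤ} (h : i + j = l) (h₁ : i - 1 + j = l - 1) (h₂ : i + (j - 1) = l - 1)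
    (a : A i) (b : A j),
    d l (mul h a b) = mul h₁ (d i a) b + i.negOnePow • mul h₂ a (d j b)
  /-- The left unit. -/
  one : A 0
  d_one : d 0 one = 0
  one_mul : ∀ {i : ℤ} (h : 0 + i = i) (a : A i), mul h one a = a

namespace CompletePreLieAlgebra

variable {k : Type*} [CommRing k] {A : ℤ → Type*} [∀ i, AddCommGroup (A i)]
  [∀ i, Module k (A i)] (𝔞 : CompletePreLieAlgebra k A)

/-- The pre-Lie product on the component of degree zero. -/
def star (a b : A 0) : A 0 := 𝔞.mul (add_zero 0) a b

/-- The Lie bracket on the component of degree zero. -/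
def bracket (a b : A 0) : A 0 := 𝔞.star a b - 𝔞.star b a

/-- The underlying set `F₁ A₀` of the gauge group. -/
def GaugeElement : Type _ := {x : A 0 // x ∈ 𝔞.F 0 1}

/-- The set `1 + F₁ A₀` of group-like elements. -/
def GroupLike : Type _ := {g : A 0 // g - 𝔞.one ∈ 𝔞.F 0 1}

/-- The symmetric braces `{a; b₁, …, bₙ}` on the component of degree zero. -/
def brace : (n : ℕ) → A 0 → (Fin n → A 0) → A 0
  | 0, a, _ => a
  | n + 1, a, b =>
    𝔞.star (brace n a (Fin.init b)) (b (Fin.last n)) -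
      ∑ i : Fin n, brace n a
        (Function.update (Fin.init b) i (𝔞.star (b i.castSucc) (b (Fin.last n))))

/-- The right-iterated product `(⋯((x ⋆ x) ⋆ x)⋯) ⋆ x` with `n` factors, being the left unit
for `n = 0`. -/
def rightPow (x : A 0) : ℕ → A 0
  | 0 => 𝔞.one
  | n + 1 => 𝔞.star (rightPow x n) x

/-- The component of degree `n` in `x` of the pre-Lie Magnus expansion
`Ω(x) = ∑ⱼ (Bⱼ / j!) (⋯(x ⋆ Ω(x)) ⋆ ⋯) ⋆ Ω(x)` (`j` factors `Ω(x)` in the `j`-th term, and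
`B₁ = -1/2`): the component of degree `n + 1` is the sum over the compositions
`n = n₁ + ⋯ + nⱼ` of `(Bⱼ / j!) (⋯(x ⋆ Ω_{n₁}(x)) ⋆ ⋯) ⋆ Ω_{nⱼ}(x)`. -/
noncomputable def magnusTerm [Algebra ℚ k] (x : A 0) : ℕ → A 0
  | 0 => 0
  | n + 1 => ∑ c : Composition n,
      algebraMap ℚ k (bernoulli c.length / (c.length.factorial : ℚ)) •
        c.blocks.attach.foldl (fun y i => 𝔞.star y (magnusTerm x i.1)) x
  termination_by n => n
  decreasing_by exact Nat.lt_succ_of_le (c.blocks_le i.2)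

variable [Algebra ℚ k]

/-- The terms of the pre-Lie exponential. -/
noncomputable def expTerm (x : A 0) (n : ℕ) : A 0 :=
  algebraMap ℚ k (1 / (n.factorial : ℚ)) • 𝔞.rightPow x n

/-- The pre-Lie exponential `1 + x + x ⋆ x / 2! + (x ⋆ x) ⋆ x / 3! + ⋯`. -/
noncomputable def exp (x : A 0) : A 0 := seriesSum (𝔞.F 0) (𝔞.expTerm x)

/-- The pre-Lie logarithm of `g = 1 + x`, that is the Magnus expansion `Ω(x)`. -/
noncomputable def log (g : A 0) : A 0 := seriesSum (𝔞.F 0) (𝔞.magnusTerm (g - 𝔞.one))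

/-- The terms `{a; b, …, b} / n!` of the circle product of `a` with `1 + b`. -/
noncomputable def circTerm (a b : A 0) (n : ℕ) : A 0 :=
  algebraMap ℚ k (1 / (n.factorial : ℚ)) • 𝔞.brace n a fun _ => b

/-- The circle product of `a` with `g = 1 + b`. -/
noncomputable def circ (a g : A 0) : A 0 := seriesSum (𝔞.F 0) (𝔞.circTerm a (g - 𝔞.one))

/-- The Baker–Campbell–Hausdorff product. -/
noncomputable def bch (x y : A 0) : A 0 := seriesSum (𝔞.F 0) (bchTerm k 𝔞.bracket x y)

end CompletePreLieAlgebra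

/-! Everything is controlled by the right multiplications `R_x : a ↦ a ⋆ x`. For `x` in `F₁` they
are nilpotent modulo each `F_N`, so their exponentials make sense there, and an identity in `A₀`
follows from its reductions modulo all `F_N`. By definition `e^x = exp(R_x)(1)`.

The first pillar is `a ⊚ e^x = exp(R_x)(a)` (`sum_listBrace_expPath`, `circ_exp_sub_mem`). Along the
path `1 + b(t) = e^{tx}` one has `t b' = tx + b ⋆ tx`. The Leibniz rule for braces, their symmetry
(which is where the pre-Lie identity enters) and their recursion show that `c(t) = a ⊚ e^{tx}`
satisfies `t c' = c ⋆ tx`, whose solution is `exp(R_{tx})(a)`.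

The second pillar is that `z ↦ -R_z` is a Lie homomorphism, which is the pre-Lie identity again
(`negRightMulQuot_bracket`). With the BCH formula for operators this gives `exp(R_y) exp(R_x) =
exp(R_{BCH(x,y)})`, hence `(a ⊚ e^x) ⊚ e^y = a ⊚ e^{BCH(x,y)}`. For `a = 1` this says that `e`
carries BCH to `⊚`. Once every element of `1 + F₁` is known to be an exponential, the same formula
gives associativity of `⊚`, and the group laws of BCH follow by injectivity of `e`.

The third pillar is the Magnus expansion. Since `R_z(1) = z`, one has `e^z - 1 = ((exp R_z - 1) /
R_z)(z)`, so `e^z = 1 + x` amounts to the fixed point equation `z = ∑ B_j/j! R_z^j(x)`, which the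
Magnus recursion solves degree by degree (`magnus_fixedPoint`, `exp_log`). Injectivity of `e` then
makes the logarithm a two-sided inverse.

Dynkin's form of BCH is itself proved here (`IsNilFiltration.exp_mul_exp`). If `e^x e^y = e^z` and
`D` is an element with `[D,x] = x` and `[D,y] = y`, then conjugating `D` by both sides expresses
`[D,z]` as `log(1+W)/W`, with `W = e^{ad x} e^{ad y} - 1`, applied to `x + e^{ad x} y`. Expanding in
words gives `n` times Dynkin's term in each degree `n`. The element `D` is supplied by passing to
polynomials in `t`, replacing `X` by `tX` and taking `D = t d/dt`; evaluation at `t = 1` returns to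
the original operators.

The filtration statements come from degree estimates: a term of degree `n` in elements of `F_p` lies
in `F_{pn}`. Commutators are handled by the estimate `a ⊚ g - a ∈ F_{q+p}` for `a ∈ F_q` and `g ∈ 1
+ F_p`, and left cosets turn out to be congruence classes modulo `F_n`, so completeness is inherited
from `A₀`. -/

/-! ### Power series evaluated at nilpotent elements -/

section NilEval

open PowerSeries

variable {E : Type*} [Ring E] [Algebra ℚ E]

/-- The value of the power series `f` at `z`, truncated at order `K`. -/
noncomputable def nilEval (K : ℕ) (z : E) (f : ℚ⟦X⟧) : E := Polynomial.aeval z (f.trunc K)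

theorem nilEval_eq_sum (K : ℕ) (z : E) (f : ℚ⟦X⟧) :
    nilEval K z f = ∑ n ∈ Finset.range K, coeff n f • z ^ n := by
  rw [nilEval, Polynomial.aeval_def, eval₂_trunc_eq_sum_range]
  simp [Algebra.smul_def]

theorem nilEval_add (K : ℕ) (z : E) (f g : ℚ⟦X⟧) :
    nilEval K z (f + g) = nilEval K z f + nilEval K z g := by
  simp [nilEval]

theorem nilEval_sub (K : ℕ) (z : E) (f g : ℚ⟦X⟧) :
    nilEval K z (f - g) = nilEval K z f - nilEval K z g := by
  simp [nilEval, trunc_sub]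

theorem nilEval_coe {K : ℕ} {z : E} (hz : z ^ K = 0) (p : Polynomial ℚ) :
    nilEval K z (p : ℚ⟦X⟧) = Polynomial.aeval z p := by
  rw [nilEval_eq_sum, Polynomial.aeval_eq_sum_range' (n := max K (p.natDegree + 1)) (by omega)]
  simp only [Polynomial.coeff_coe]
  refine Finset.sum_subset (Finset.range_mono (le_max_left _ _)) fun n _ hn => ?_
  rw [pow_eq_zero_of_le (by simpa using hn) hz, smul_zero]

/-- Truncating both factors changes the product only in degrees at least `K`, where powers of `z`
vanish. -/
theorem nilEval_mul {K : ℕ} {z : E} (hz : z ^ K = 0) (f g : ℚ⟦X⟧) :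
    nilEval K z (f * g) = nilEval K z f * nilEval K z g := by
  rw [nilEval, ← trunc_trunc_mul_trunc, ← Polynomial.coe_mul, ← nilEval, nilEval_coe hz, map_mul]
  rfl

theorem nilEval_one {K : ℕ} {z : E} (hz : z ^ K = 0) : nilEval K z (1 : ℚ⟦X⟧) = 1 := by
  simpa using nilEval_coe hz (1 : Polynomial ℚ)

theorem nilEval_X {K : ℕ} {z : E} (hz : z ^ K = 0) : nilEval K z (X : ℚ⟦X⟧) = z := by
  simpa using nilEval_coe hz (Polynomial.X : Polynomial ℚ)

theorem nilEval_pow {K : ℕ} {z : E} (hz : z ^ K = 0) (f : ℚ⟦X⟧) (n : ℕ) :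
    nilEval K z (f ^ n) = nilEval K z f ^ n := by
  induction n with
  | zero => simp [nilEval_one hz]
  | succ n ih => rw [pow_succ, pow_succ, nilEval_mul hz, ih]

theorem nilEval_exp {K : ℕ} {z : E} (hz : z ^ K = 0) :
    nilEval K z (exp ℚ) = IsNilpotent.exp z := by
  rw [IsNilpotent.exp_eq_sum hz, nilEval_eq_sum]
  simp [coeff_exp]

theorem nilEval_subst {K : ℕ} {z : E} (hz : z ^ K = 0) (f g : ℚ⟦X⟧) (hg : constantCoeff g = 0) :
    nilEval K z (f.subst g) = nilEval K (nilEval K z g) f := by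
  have hs : HasSubst g := HasSubst.of_constantCoeff_zero' hg
  -- Writing `g = X h` makes `g(z)^K = z^K h(z)^K` vanish, so only the truncation of `f` at order
  -- `K` contributes.
  obtain ⟨h, rfl⟩ := X_dvd_iff.2 hg
  conv_lhs => rw [eq_X_pow_mul_shift_add_trunc K f]
  rw [subst_add hs, subst_mul hs, subst_pow hs, subst_X hs, subst_coe hs, nilEval_add,
    nilEval_mul hz, nilEval_pow hz, nilEval_mul hz, nilEval_X hz]
  have hc : Commute z (nilEval K z h) := by
    conv_lhs => rw [← nilEval_X hz]
    rw [Commute, SemiconjBy, ← nilEval_mul hz, ← nilEval_mul hz, mul_comm]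
  rw [hc.mul_pow, hz, zero_mul, zero_mul, zero_add, nilEval_eq_sum K (z * _),
    Polynomial.aeval_def, eval₂_trunc_eq_sum_range]
  simp only [← Algebra.smul_def]
  rw [nilEval, map_sum, map_sum]
  refine Finset.sum_congr rfl fun n _ => ?_
  rw [map_smul, map_smul, ← nilEval, nilEval_pow hz, nilEval_mul hz, nilEval_X hz]

theorem one_add_X_mul_derivative_log : (1 + X) * d⁄dX ℚ (PowerSeries.log ℚ) = 1 := by
  rw [deriv_log]
  ext n
  rcases n with _ | n
  · simp [add_mul]
  · simp [add_mul, coeff_succ_X_mul, coeff_one, pow_succ]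

/-- By the chain rule and `(1 + X) log' = 1`, the left side has derivative `1`, and its constant
term is `0`. -/
theorem log_subst_exp_sub_one : (PowerSeries.log ℚ).subst (exp ℚ - 1) = (X : ℚ⟦X⟧) := by
  have hs : HasSubst (exp ℚ - 1) := HasSubst.exp_sub_one
  apply derivative.ext
  · rw [derivative_subst hs, map_sub, derivative_exp, Derivation.map_one_eq_zero, sub_zero,
      derivative_X]
    have h := congrArg (substAlgHom hs) one_add_X_mul_derivative_log
    rw [map_mul, map_add, map_one, coe_substAlgHom, subst_X hs] at h
    rw [add_sub_cancel] at h
    rw [mul_comm, h]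
  · rw [constantCoeff_X]
    exact constantCoeff_subst_eq_zero (by simp [← PowerSeries.constantCoeff_eq]) _ constantCoeff_log

/-- The composite `G` solves `(1 + X) G' = G`, that is `(n+1) c_{n+1} = (1-n) c_n`; with `c₀ = 1`
the recursion stops after degree one. -/
theorem exp_subst_log : (exp ℚ).subst (PowerSeries.log ℚ) = (1 + X : ℚ⟦X⟧) := by
  have hs : HasSubst (PowerSeries.log ℚ) := HasSubst.log
  set G : ℚ⟦X⟧ := (exp ℚ).subst (PowerSeries.log ℚ) with hG
  have hd : d⁄dX ℚ G * (1 + X) = G := by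
    rw [hG, derivative_subst hs, derivative_exp, mul_assoc, mul_comm (d⁄dX ℚ _),
      one_add_X_mul_derivative_log, mul_one]
  have h0 : coeff 0 G = 1 := by
    have h1 : exp ℚ = (exp ℚ - 1) + 1 := by ring
    rw [hG, h1, subst_add hs, ← coe_substAlgHom hs, map_one, map_add, coe_substAlgHom,
      coeff_zero_eq_constantCoeff_apply,
      show constantCoeff ((exp ℚ - 1).subst (PowerSeries.log ℚ)) = 0 from
        constantCoeff_subst_eq_zero (by simp [← PowerSeries.constantCoeff_eq]) _ (by simp)]
    simp
  have hrec : ∀ n : ℕ, (n + 1 : ℚ) * coeff (n + 1) G = (1 - n) * coeff n G := by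
    intro n
    have h := congrArg (coeff n) hd
    rcases n with _ | n
    · rw [mul_add, mul_one, map_add, coeff_zero_mul_X, add_zero, coeff_derivative] at h
      simpa using h
    · rw [mul_add, mul_one, map_add, coeff_succ_mul_X, coeff_derivative, coeff_derivative] at h
      push_cast at h ⊢
      linarith
  have h1 : coeff 1 G = 1 := by simpa [h0] using hrec 0
  have h2 : ∀ n, coeff (n + 2) G = 0 := by
    intro n
    induction n with
    | zero => simpa [h1] using hrec 1
    | succ n ih =>
      have h := hrec (n + 2)
      rw [ih, mul_zero] at h
      refine (mul_eq_zero.1 h).resolve_left ?_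
      positivity
  ext n
  rcases n with _ | _ | n
  · simpa using h0
  · simpa [coeff_one] using h1
  · simpa [coeff_one, coeff_X] using h2 n

/-- The power series `log (1 + X) / X`. -/
noncomputable def logDivX : ℚ⟦X⟧ := mk fun n => (-1 : ℚ) ^ n / (n + 1)

/-- The power series `(exp X - 1) / X`. -/
noncomputable def expSubOneDivX : ℚ⟦X⟧ := mk fun n => ((n + 1).factorial : ℚ)⁻¹

theorem X_mul_logDivX : X * logDivX = PowerSeries.log ℚ := by
  ext n
  rcases n with _ | n
  · simp
  · simp [coeff_succ_X_mul, logDivX, pow_succ]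

theorem X_mul_expSubOneDivX : X * expSubOneDivX = exp ℚ - 1 := by
  ext n
  rcases n with _ | n
  · simp
  · simp [coeff_succ_X_mul, expSubOneDivX, coeff_exp, coeff_one]

/-- Evaluated at `ad z`, this inverts `(e^{ad z} - 1)/ad z`, which is how `[D, z]` is isolated in
Dynkin's formula. -/
theorem logDivX_subst_mul_expSubOneDivX :
    logDivX.subst (exp ℚ - 1) * expSubOneDivX = (1 : ℚ⟦X⟧) := by
  have hs : HasSubst (exp ℚ - 1) := HasSubst.exp_sub_one
  have h : X * (logDivX.subst (exp ℚ - 1) * expSubOneDivX) = X * (1 : ℚ⟦X⟧) := by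
    rw [mul_one]
    conv_rhs => rw [← log_subst_exp_sub_one, ← X_mul_logDivX, subst_mul hs, subst_X hs]
    rw [mul_left_comm, X_mul_expSubOneDivX, mul_comm]
  exact mul_left_cancel₀ X_ne_zero h

/-- This is why Bernoulli numbers occur in the Magnus expansion: their series inverts the operator
taking `z` to `e^z - 1`. -/
theorem expSubOneDivX_mul_bernoulliPowerSeries :
    expSubOneDivX * bernoulliPowerSeries ℚ = 1 := by
  have h : X * (expSubOneDivX * bernoulliPowerSeries ℚ) = X * (1 : ℚ⟦X⟧) := by
    rw [mul_one, ← mul_assoc, X_mul_expSubOneDivX, mul_comm, bernoulliPowerSeries_mul_exp_sub_one]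
  exact mul_left_cancel₀ X_ne_zero h

/-- A unipotent element is the exponential of its logarithm. -/
theorem exp_nilEval_log {K : ℕ} {u : E} (hu : u ^ K = 0)
    (hlog : nilEval K u (PowerSeries.log ℚ) ^ K = 0) :
    IsNilpotent.exp (nilEval K u (PowerSeries.log ℚ)) = 1 + u := by
  rw [← nilEval_exp hlog, ← nilEval_subst hu _ _ constantCoeff_log, exp_subst_log, nilEval_add,
    nilEval_one hu, nilEval_X hu]

theorem nilEval_logDivX_mul_nilEval_expSubOneDivX {K : ℕ} {z : E} (hz : z ^ K = 0) :
    nilEval K (IsNilpotent.exp z - 1) logDivX * nilEval K z expSubOneDivX = 1 := by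
  have h : IsNilpotent.exp z - 1 = nilEval K z (exp ℚ - 1) := by
    rw [nilEval_sub, nilEval_exp hz, nilEval_one hz]
  rw [h, ← nilEval_subst hz _ _ (by simp), ← nilEval_mul hz, logDivX_subst_mul_expSubOneDivX,
    nilEval_one hz]

theorem exp_eq_one_add_nilEval_mul {K : ℕ} {z : E} (hz : z ^ K = 0) :
    IsNilpotent.exp z = 1 + nilEval K z expSubOneDivX * z := by
  have h : exp ℚ = 1 + expSubOneDivX * X := by
    rw [mul_comm, X_mul_expSubOneDivX]
    ring
  rw [← nilEval_exp hz, h, nilEval_add, nilEval_one hz, nilEval_mul hz, nilEval_X hz]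

end NilEval

/-! ### Dynkin's formula in a nilpotently filtered ring -/

theorem Fin.sum_piFinset_const_succ {α M : Type*} [AddCommMonoid M] [DecidableEq α] {m : ℕ}
    (P : Finset α) (f : (Fin (m + 1) → α) → M) :
    ∑ c ∈ Fintype.piFinset (fun _ : Fin (m + 1) => P), f c =
      ∑ p ∈ P, ∑ c ∈ Fintype.piFinset (fun _ : Fin m => P), f (Fin.cons p c) := by
  rw [← Finset.sum_product']
  refine Finset.sum_bij' (fun c _ => (c 0, Fin.tail c)) (fun q _ => Fin.cons q.1 q.2) ?_ ?_ ?_ ?_ ?_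
  · intro c hc
    simp only [Fintype.mem_piFinset, Finset.mem_product] at hc ⊢
    exact ⟨hc 0, fun i => hc i.succ⟩
  · intro q hq
    simp only [Fintype.mem_piFinset, Finset.mem_product] at hq ⊢
    exact Fin.cases hq.1 hq.2
  · intro c _
    simp
  · intro q _
    simp
  · intro c _
    simp

section Dynkin

variable {E : Type*} [Ring E] [Algebra ℚ E]

/-- The inner derivation `w ↦ a * w - w * a`. -/
noncomputable def commutatorMap (a : E) : Module.End ℚ E :=
  LinearMap.mulLeft ℚ a - LinearMap.mulRight ℚ a

theorem commutatorMap_apply (a w : E) : commutatorMap a w = a * w - w * a := by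
  simp [commutatorMap]

theorem isNilpotent_mulLeft {a : E} (ha : IsNilpotent a) :
    IsNilpotent (LinearMap.mulLeft ℚ a) := by
  obtain ⟨n, hn⟩ := ha
  exact ⟨n, by simp [LinearMap.pow_mulLeft, hn]⟩

theorem isNilpotent_mulRight {a : E} (ha : IsNilpotent a) :
    IsNilpotent (LinearMap.mulRight ℚ a) := by
  obtain ⟨n, hn⟩ := ha
  exact ⟨n, by simp [LinearMap.pow_mulRight, hn]⟩

theorem isNilpotent_commutatorMap {a : E} (ha : IsNilpotent a) :
    IsNilpotent (commutatorMap a) :=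
  (LinearMap.commute_mulLeft_right (R := ℚ) a a).isNilpotent_sub (isNilpotent_mulLeft ha)
    (isNilpotent_mulRight ha)

/-- Left and right multiplication commute, so the exponential of their difference factors. -/
theorem exp_commutatorMap_apply {a : E} (ha : IsNilpotent a) (w : E) :
    IsNilpotent.exp (commutatorMap a) w = IsNilpotent.exp a * w * IsNilpotent.exp (-a) := by
  have h : commutatorMap a = LinearMap.mulLeft ℚ a + LinearMap.mulRight ℚ (-a) := by
    ext w
    simp [commutatorMap_apply, sub_eq_add_neg]
  rw [h, IsNilpotent.exp_add_of_commute (LinearMap.commute_mulLeft_right (R := ℚ) a (-a))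
    (isNilpotent_mulLeft ha) (isNilpotent_mulRight ha.neg)]
  obtain ⟨n, hn⟩ := ha
  have hn' : (-a) ^ n = 0 := by rw [neg_pow, hn, mul_zero]
  rw [IsNilpotent.exp_eq_sum hn, IsNilpotent.exp_eq_sum hn',
    IsNilpotent.exp_eq_sum (a := LinearMap.mulLeft ℚ a) (k := n)
      (by simp [LinearMap.pow_mulLeft, hn]),
    IsNilpotent.exp_eq_sum (a := LinearMap.mulRight ℚ (-a)) (k := n)
      (by simp [LinearMap.pow_mulRight, hn'])]
  simp [LinearMap.pow_mulLeft, LinearMap.pow_mulRight, Finset.sum_mul, Finset.mul_sum, mul_assoc]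

/-- A decreasing multiplicative filtration (of a nonunital subring) which vanishes from the
`N`-th term on. -/
structure IsNilFiltration (J : ℕ → Submodule ℚ E) (N : ℕ) : Prop where
  antitone : Antitone J
  mul_mem : ∀ {p q : ℕ} {a b : E}, a ∈ J p → b ∈ J q → a * b ∈ J (p + q)
  eq_bot : J N = ⊥

namespace IsNilFiltration

variable {J : ℕ → Submodule ℚ E} {N : ℕ} (hJ : IsNilFiltration J N)
include hJ

theorem eq_zero {p : ℕ} (hp : N ≤ p) {a : E} (ha : a ∈ J p) : a = 0 := by
  have := hJ.antitone hp ha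
  rwa [hJ.eq_bot, Submodule.mem_bot] at this

theorem pow_mem {a : E} (ha : a ∈ J 1) (n : ℕ) : a ^ (n + 1) ∈ J (n + 1) := by
  induction n with
  | zero => simpa using ha
  | succ n ih =>
    rw [pow_succ]
    exact hJ.mul_mem ih ha

theorem pow_mem_one {a : E} (ha : a ∈ J 1) {n : ℕ} (hn : n ≠ 0) : a ^ n ∈ J 1 := by
  obtain ⟨n, rfl⟩ := Nat.exists_eq_succ_of_ne_zero hn
  exact hJ.antitone (by omega) (hJ.pow_mem ha n)

/-- The strict inequality takes care of `N = 0`, since `a ^ 0 = 1` need not vanish. -/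
theorem pow_eq_zero {a : E} (ha : a ∈ J 1) {n : ℕ} (hn : N < n) : a ^ n = 0 := by
  obtain ⟨n, rfl⟩ := Nat.exists_eq_succ_of_ne_zero (by omega : n ≠ 0)
  exact hJ.eq_zero hn.le (hJ.pow_mem ha n)

theorem isNilpotent {a : E} (ha : a ∈ J 1) : IsNilpotent a :=
  ⟨N + 1, hJ.pow_eq_zero ha N.lt_succ_self⟩

theorem exp_sub_one_mem {a : E} (ha : a ∈ J 1) : IsNilpotent.exp a - 1 ∈ J 1 := by
  rw [IsNilpotent.exp_eq_sum (hJ.pow_eq_zero ha N.lt_succ_self), Finset.sum_range_succ']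
  simp only [Nat.factorial_zero, Nat.cast_one, inv_one, pow_zero, one_smul, add_sub_cancel_right]
  exact Submodule.sum_mem _ fun n _ => Submodule.smul_mem _ _ (hJ.pow_mem_one ha n.succ_ne_zero)

/-- Unipotent elements have logarithms. -/
theorem exists_exp_eq {u : E} (hu : u ∈ J 1) : ∃ z ∈ J 1, IsNilpotent.exp z = 1 + u := by
  have hmem : nilEval (N + 1) u (PowerSeries.log ℚ) ∈ J 1 := by
    rw [nilEval_eq_sum]
    refine Submodule.sum_mem _ fun n _ => ?_
    rcases n with _ | n
    · simp
    · exact Submodule.smul_mem _ _ (hJ.pow_mem_one hu n.succ_ne_zero)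
  exact ⟨_, hmem, exp_nilEval_log (hJ.pow_eq_zero hu N.lt_succ_self)
    (hJ.pow_eq_zero hmem N.lt_succ_self)⟩

theorem nestedBracket_mem {l : List E} (hl : l ≠ []) (h : ∀ a ∈ l, a ∈ J 1) :
    nestedBracket (fun a b => a * b - b * a) l ∈ J l.length := by
  induction l with
  | nil => exact absurd rfl hl
  | cons a l ih =>
    cases l with
    | nil => simpa [nestedBracket] using h
    | cons b l =>
      have h1 := ih (by simp) fun c hc => h c (List.mem_cons_of_mem _ hc)
      have h2 := h a (by simp)
      have h3 := hJ.mul_mem h2 h1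
      rw [add_comm] at h3
      exact Submodule.sub_mem _ h3 (hJ.mul_mem h1 h2)

end IsNilFiltration

theorem nestedBracket_cons (a : E) {l : List E} (hl : l ≠ []) :
    nestedBracket (fun a b => a * b - b * a) (a :: l) =
      commutatorMap a (nestedBracket (fun a b => a * b - b * a) l) := by
  cases l with
  | nil => exact absurd rfl hl
  | cons b l => rw [commutatorMap_apply, nestedBracket]

theorem nestedBracket_replicate_append (a : E) (r : ℕ) {l : List E} (hl : l ≠ []) :
    nestedBracket (fun a b => a * b - b * a) (List.replicate r a ++ l) =
      (commutatorMap a ^ r) (nestedBracket (fun a b => a * b - b * a) l) := by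
  induction r with
  | zero => simp
  | succ r ih =>
    rw [List.replicate_succ, List.cons_append, nestedBracket_cons _ (by simp [hl]), ih, pow_succ']
    rfl

theorem nestedBracket_replicate_two (a : E) (r : ℕ) :
    nestedBracket (fun a b => a * b - b * a) (List.replicate (r + 2) a) = 0 := by
  rw [List.replicate_add, nestedBracket_replicate_append _ _ (by simp)]
  simp [List.replicate, nestedBracket]

/-- The word `x ^ r y ^ s`. -/
def pairWord {α : Type*} (x y : α) (c : ℕ × ℕ) : List α := List.replicate c.1 x ++ List.replicate c.2 y

/-- The coefficient `1 / (r! s!)`. -/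
noncomputable def pairCoeff (c : ℕ × ℕ) : ℚ := ((c.1.factorial : ℚ) * (c.2.factorial : ℚ))⁻¹

theorem pairWord_ne_nil {α : Type*} (x y : α) {c : ℕ × ℕ} (hc : c ≠ (0, 0)) : pairWord x y c ≠ [] := by
  rcases c with ⟨r, s⟩
  simp only [pairWord, ne_eq, List.append_eq_nil_iff, List.replicate_eq_nil_iff]
  simpa using hc

theorem exp_mul_exp_apply_eq_sum {X Y : Module.End ℚ E} {R : ℕ} (hX : X ^ R = 0) (hY : Y ^ R = 0)
    (v : E) :
    (IsNilpotent.exp X * IsNilpotent.exp Y) v =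
      ∑ c ∈ Finset.range R ×ˢ Finset.range R, pairCoeff c • (X ^ c.1) ((Y ^ c.2) v) := by
  rw [IsNilpotent.exp_eq_sum hX, IsNilpotent.exp_eq_sum hY, Finset.sum_product, Finset.sum_mul_sum]
  simp only [pairCoeff, smul_mul_smul_comm, LinearMap.sum_apply, LinearMap.smul_apply,
    Module.End.mul_apply, mul_inv]

/-- The pairs of exponents below `R` other than `(0, 0)`. -/
def nonzeroPairs (R : ℕ) : Finset (ℕ × ℕ) := (Finset.range R ×ˢ Finset.range R).erase (0, 0)

theorem exp_mul_exp_sub_one_apply {X Y : Module.End ℚ E} {R : ℕ} (hX : X ^ R = 0) (hY : Y ^ R = 0)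
    (hR : 0 < R) (v : E) :
    (IsNilpotent.exp X * IsNilpotent.exp Y - 1) v =
      ∑ c ∈ nonzeroPairs R, pairCoeff c • (X ^ c.1) ((Y ^ c.2) v) := by
  rw [LinearMap.sub_apply, exp_mul_exp_apply_eq_sum hX hY, nonzeroPairs,
    ← Finset.add_sum_erase _ _ (a := (0, 0)) (by simp [hR])]
  simp [pairCoeff]

/-- A right-nested bracket vanishes when its last two letters agree. So the last syllable of a word
contributes only `x` and the words `x^r y`, and the latter add up to `e^{ad x} y`. -/
theorem sum_nestedBracket_pairWord (x y : E) {R : ℕ} (hR : 2 ≤ R)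
    (hx : commutatorMap x ^ R = 0) :
    ∑ c ∈ nonzeroPairs R, pairCoeff c • nestedBracket (fun a b => a * b - b * a)
      (pairWord x y c) = x + IsNilpotent.exp (commutatorMap x) y := by
  obtain ⟨R, rfl⟩ := Nat.exists_eq_add_of_le' hR
  have h1 : ∀ r s, nestedBracket (fun a b => a * b - b * a) (pairWord x y (r, s + 1 + 1)) = 0 := by
    intro r s
    rw [pairWord, nestedBracket_replicate_append _ _ (by simp), nestedBracket_replicate_two, map_zero]
  have h2 : ∀ r, nestedBracket (fun a b => a * b - b * a) (pairWord x y (r, 1)) =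
      (commutatorMap x ^ r) y := by
    intro r
    rw [pairWord, nestedBracket_replicate_append _ _ (by simp)]
    rfl
  have h3 : ∀ r, nestedBracket (fun a b => a * b - b * a) (pairWord x y (r + 1 + 1, 0)) = 0 := by
    intro r
    simp only [pairWord, List.replicate_zero, List.append_nil]
    exact nestedBracket_replicate_two x r
  have h4 : ∀ r, ∑ s ∈ Finset.range (R + 2), pairCoeff (r, s) • nestedBracket
      (fun a b => a * b - b * a) (pairWord x y (r, s)) =
      (r.factorial : ℚ)⁻¹ • (commutatorMap x ^ r) y + pairCoeff (r, 0) • nestedBracket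
      (fun a b => a * b - b * a) (pairWord x y (r, 0)) := by
    intro r
    rw [Finset.sum_range_succ', Finset.sum_range_succ']
    simp [h1, h2, pairCoeff]
  rw [nonzeroPairs, Finset.sum_erase _ (by simp [pairWord, nestedBracket]), Finset.sum_product]
  simp only [h4]
  rw [Finset.sum_add_distrib, IsNilpotent.exp_eq_sum hx, LinearMap.sum_apply, add_comm]
  congr 1
  rw [Finset.sum_range_succ', Finset.sum_range_succ']
  simp only [h3]
  simp [pairWord, pairCoeff, nestedBracket]

/-- Each factor `e^{ad x} e^{ad y} - 1` prepends one syllable `x^r y^s`; subtracting `1` removes the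
empty syllable. -/
theorem exp_mul_exp_sub_one_pow_apply (x y : E) {R : ℕ} (hR : 2 ≤ R)
    (hx : commutatorMap x ^ R = 0) (hy : commutatorMap y ^ R = 0) (m : ℕ) :
    ((IsNilpotent.exp (commutatorMap x) * IsNilpotent.exp (commutatorMap y) - 1) ^ m)
        (x + IsNilpotent.exp (commutatorMap x) y) =
      ∑ c ∈ Fintype.piFinset (fun _ : Fin (m + 1) => nonzeroPairs R),
        (∏ i, pairCoeff (c i)) • nestedBracket (fun a b => a * b - b * a)
          (List.ofFn fun i => pairWord x y (c i)).flatten := by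
  induction m with
  | zero =>
    rw [Fin.sum_piFinset_const_succ, pow_zero, Module.End.one_apply,
      ← sum_nestedBracket_pairWord x y hR hx]
    simp
  | succ m ih =>
    rw [Fin.sum_piFinset_const_succ, pow_succ', Module.End.mul_apply, ih,
      exp_mul_exp_sub_one_apply hx hy (by omega)]
    refine Finset.sum_congr rfl fun p hp => ?_
    simp only [map_sum, map_smul, Finset.smul_sum]
    refine Finset.sum_congr rfl fun c hc => ?_
    have hne : (List.ofFn fun i => pairWord x y (c i)).flatten ≠ [] := by
      rw [List.ofFn_succ, List.flatten_cons, Ne, List.append_eq_nil_iff, not_and_or]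
      left
      refine pairWord_ne_nil x y ?_
      have := Fintype.mem_piFinset.1 hc 0
      exact (Finset.mem_erase.1 this).1
    conv_rhs => rw [Fin.prod_univ_succ, List.ofFn_succ, List.flatten_cons]
    simp only [Fin.cons_zero, Fin.cons_succ]
    rw [smul_smul, pairWord, List.append_assoc, nestedBracket_replicate_append _ _
      (fun h => hne (List.append_eq_nil_iff.1 h).2), nestedBracket_replicate_append _ _ hne]

theorem length_flatten_pairWord {α : Type*} (x y : α) {m : ℕ} (c : Fin m → ℕ × ℕ) :
    (List.ofFn fun i => pairWord x y (c i)).flatten.length = ∑ i, ((c i).1 + (c i).2) := by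
  simp [List.length_flatten, pairWord, List.sum_ofFn, Function.comp_def]

/-- The degree-weighted terms of the Baker–Campbell–Hausdorff series, with summation ranges that do
not depend on the degree. -/
theorem nsmul_bchTerm (x y : E) {n K R : ℕ} (hK : n ≤ K) (hR : n < R) :
    (n : ℚ) • bchTerm ℚ (fun a b => a * b - b * a) x y n =
      ∑ m ∈ Finset.range K, ((-1 : ℚ) ^ m / (m + 1)) •
        ∑ c ∈ Fintype.piFinset (fun _ : Fin (m + 1) => nonzeroPairs R) with
            ∑ i, ((c i).1 + (c i).2) = n,
          (∏ i, pairCoeff (c i)) • nestedBracket (fun a b => a * b - b * a)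
            (List.ofFn fun i => pairWord x y (c i)).flatten := by
  -- No exponent exceeds the total degree `n`, so any bound `R > n` selects the same tuples.
  have hfilter : ∀ m, (Fintype.piFinset fun _ : Fin m =>
        Finset.range (n + 1) ×ˢ Finset.range (n + 1)).filter
          (fun c => (∀ i, c i ≠ (0, 0)) ∧ ∑ i, ((c i).1 + (c i).2) = n) =
      (Fintype.piFinset fun _ : Fin m => nonzeroPairs R).filter
        (fun c => ∑ i, ((c i).1 + (c i).2) = n) := by
    intro m
    ext c
    simp only [Finset.mem_filter, Fintype.mem_piFinset, nonzeroPairs, Finset.mem_erase,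
      Finset.mem_product, Finset.mem_range]
    constructor
    · rintro ⟨h1, h2, h3⟩
      exact ⟨fun i => ⟨h2 i, by have := h1 i; omega, by have := h1 i; omega⟩, h3⟩
    · rintro ⟨h1, h3⟩
      refine ⟨fun i => ?_, fun i => (h1 i).1, h3⟩
      have := Finset.single_le_sum (f := fun i => (c i).1 + (c i).2) (fun _ _ => Nat.zero_le _)
        (Finset.mem_univ i)
      simp only [h3] at this
      omega
  -- Each of the `m` nonempty syllables has length at least one, so more than `n` of them cannot
  -- have total length `n`.
  have hempty : ∀ m, n < m → (Fintype.piFinset fun _ : Fin m => nonzeroPairs R).filter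
        (fun c => ∑ i, ((c i).1 + (c i).2) = n) = ∅ := by
    intro m hm
    refine Finset.filter_false_of_mem fun c hc h => ?_
    have h1 : ∑ _i : Fin m, 1 ≤ ∑ i, ((c i).1 + (c i).2) := by
      refine Finset.sum_le_sum fun i _ => ?_
      have := Fintype.mem_piFinset.1 hc i
      rw [nonzeroPairs, Finset.mem_erase] at this
      by_contra h0
      exact this.1 (Prod.ext (by simp; omega) (by simp; omega))
    simp at h1
    omega
  let G : ℕ → E := fun m => ((-1 : ℚ) ^ (m - 1) / m) •
    ∑ c ∈ Fintype.piFinset (fun _ : Fin m => nonzeroPairs R) with ∑ i, ((c i).1 + (c i).2) = n,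
      (∏ i, pairCoeff (c i)) • nestedBracket (fun a b => a * b - b * a)
        (List.ofFn fun i => pairWord x y (c i)).flatten
  have hG : ∑ m ∈ Finset.range K, G (m + 1) = ∑ m ∈ Finset.Icc 1 n, G m := by
    rw [Finset.range_eq_Ico, Finset.sum_Ico_add' G 0 K 1]
    refine (Finset.sum_subset (fun m hm => ?_) fun m _ hm => ?_).symm
    · simp only [Finset.mem_Icc, Finset.mem_Ico] at hm ⊢
      omega
    · have hm' : m = 0 ∨ n < m := by
        simp only [Finset.mem_Icc, not_and_or] at hm
        omega
      rcases hm' with rfl | hm'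
      · simp [G]
      · simp only [G, hempty m hm', Finset.sum_empty, smul_zero]
  have hterm : ∀ m ∈ Finset.range K, G (m + 1) = ((-1 : ℚ) ^ m / (m + 1)) •
        ∑ c ∈ Fintype.piFinset (fun _ : Fin (m + 1) => nonzeroPairs R) with
            ∑ i, ((c i).1 + (c i).2) = n,
          (∏ i, pairCoeff (c i)) • nestedBracket (fun a b => a * b - b * a)
            (List.ofFn fun i => pairWord x y (c i)).flatten := fun m _ => by
    simp [G]
  rw [← Finset.sum_congr rfl hterm, hG, bchTerm, Finset.smul_sum]
  refine Finset.sum_congr rfl fun m hm => ?_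
  simp only [G]
  rw [hfilter, Finset.smul_sum, Finset.smul_sum]
  refine Finset.sum_congr rfl fun c _ => ?_
  rw [smul_smul, smul_smul]
  congr 1
  have hn : (n : ℚ) ≠ 0 := by
    have := Finset.mem_Icc.1 hm
    exact_mod_cast (by omega : n ≠ 0)
  rw [Algebra.algebraMap_self_apply]
  simp only [pairCoeff, Finset.prod_inv_distrib]
  field_simp

/-- The map `ad D` is a derivation of the bracket under which each letter has weight one. -/
theorem commutator_nestedBracket {D x y : E} (hx : D * x - x * D = x) (hy : D * y - y * D = y)
    (l : List E) (hl : ∀ a ∈ l, a = x ∨ a = y) :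
    commutatorMap D (nestedBracket (fun a b => a * b - b * a) l) =
      (l.length : ℚ) • nestedBracket (fun a b => a * b - b * a) l := by
  induction l with
  | nil => simp [nestedBracket]
  | cons a l ih =>
    have ha : D * a - a * D = a := by
      rcases hl a (by simp) with rfl | rfl <;> assumption
    cases l with
    | nil => simpa [nestedBracket, commutatorMap_apply] using ha
    | cons b l =>
      have h := ih fun c hc => hl c (List.mem_cons_of_mem _ hc)
      rw [nestedBracket_cons _ (by simp)]
      generalize nestedBracket (fun a b => a * b - b * a) (b :: l) = w at h ⊢
      have hw : D * w - w * D = ((b :: l).length : ℚ) • w := by rw [← h, commutatorMap_apply]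
      rw [commutatorMap_apply, commutatorMap_apply, List.length_cons, Nat.cast_succ, add_smul,
        one_smul]
      calc D * (a * w - w * a) - (a * w - w * a) * D
          = (a * (D * w - w * D) - (D * w - w * D) * a) +
            ((D * a - a * D) * w - w * (D * a - a * D)) := by noncomm_ring
        _ = _ := by rw [ha, hw, mul_smul_comm, smul_mul_assoc, smul_sub]

theorem commutator_bchTerm {D x y : E} (hx : D * x - x * D = x) (hy : D * y - y * D = y) (n : ℕ) :
    commutatorMap D (bchTerm ℚ (fun a b => a * b - b * a) x y n) =
      (n : ℚ) • bchTerm ℚ (fun a b => a * b - b * a) x y n := by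
  simp only [bchTerm, map_sum, map_smul, Finset.smul_sum]
  refine Finset.sum_congr rfl fun m _ => Finset.sum_congr rfl fun c hc => ?_
  rw [commutator_nestedBracket hx hy, smul_comm]
  · congr 2
    rw [← (Finset.mem_filter.1 hc).2.2]
    exact length_flatten_pairWord x y c
  · intro a ha
    simp only [List.mem_flatten, List.mem_ofFn] at ha
    obtain ⟨l, ⟨i, rfl⟩, ha⟩ := ha
    simp only [List.mem_append, List.mem_replicate] at ha
    tauto

theorem IsNilFiltration.bchTerm_mem {J : ℕ → Submodule ℚ E} {N : ℕ} (hJ : IsNilFiltration J N)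
    {x y : E} (hx : x ∈ J 1) (hy : y ∈ J 1) (n : ℕ) :
    bchTerm ℚ (fun a b => a * b - b * a) x y n ∈ J n := by
  refine Submodule.sum_mem _ fun m hm => Submodule.sum_mem _ fun c hc =>
    Submodule.smul_mem _ _ ?_
  have h : (List.ofFn fun i => pairWord x y (c i)).flatten.length = n := by
    rw [length_flatten_pairWord, (Finset.mem_filter.1 hc).2.2]
  conv => arg 1; rw [← h]
  refine hJ.nestedBracket_mem ?_ ?_
  · rw [← List.length_pos_iff, h]
    have := Finset.mem_Icc.1 hm
    omega
  · intro a ha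
    simp only [List.mem_flatten, List.mem_ofFn] at ha
    obtain ⟨l, ⟨i, rfl⟩, ha⟩ := ha
    simp only [pairWord, List.mem_append, List.mem_replicate] at ha
    rcases ha with ⟨_, rfl⟩ | ⟨_, rfl⟩ <;> assumption

/-- Dynkin's formula, in presence of a derivation `D` for which `x` and `y` have degree `1`. -/
theorem IsNilFiltration.exp_mul_exp {J : ℕ → Submodule ℚ E} {N : ℕ} (hJ : IsNilFiltration J N)
    {D x y : E} (hD : ∀ w ∈ J 1, D * w - w * D = 0 → w = 0)
    (hx : x ∈ J 1) (hy : y ∈ J 1) (hDx : D * x - x * D = x) (hDy : D * y - y * D = y) :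
    IsNilpotent.exp x * IsNilpotent.exp y =
      IsNilpotent.exp (∑ n ∈ Finset.range N, bchTerm ℚ (fun a b => a * b - b * a) x y n) := by
  have nx := hJ.isNilpotent hx
  have ny := hJ.isNilpotent hy
  -- With `u = e^x - 1` and `v = e^y - 1` this element is `uv + u + v`.
  have hu : IsNilpotent.exp x * IsNilpotent.exp y - 1 ∈ J 1 := by
    have h1 := hJ.exp_sub_one_mem hx
    have h2 := hJ.exp_sub_one_mem hy
    have h3 := Submodule.add_mem _ (Submodule.add_mem _ (hJ.antitone one_le_two
      (hJ.mul_mem h1 h2)) h1) h2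
    convert h3 using 1
    noncomm_ring
  obtain ⟨z, hz, hexp⟩ := hJ.exists_exp_eq hu
  rw [add_sub_cancel] at hexp
  have nz := hJ.isNilpotent hz
  have hneg : IsNilpotent.exp (-z) = IsNilpotent.exp (-y) * IsNilpotent.exp (-x) := by
    have h1 : IsNilpotent.exp (-z) * IsNilpotent.exp z = 1 := IsNilpotent.exp_neg_mul_exp_self nz
    calc IsNilpotent.exp (-z)
        = IsNilpotent.exp (-z) * (IsNilpotent.exp x * (IsNilpotent.exp y * IsNilpotent.exp (-y)) *
          IsNilpotent.exp (-x)) := by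
          rw [IsNilpotent.exp_mul_exp_neg_self ny, mul_one, IsNilpotent.exp_mul_exp_neg_self nx,
            mul_one]
      _ = (IsNilpotent.exp (-z) * (IsNilpotent.exp x * IsNilpotent.exp y)) *
            (IsNilpotent.exp (-y) * IsNilpotent.exp (-x)) := by simp only [mul_assoc]
      _ = _ := by rw [← hexp, h1, one_mul]
  -- Both sides are conjugation by `e^x e^y = e^z`.
  have hW : IsNilpotent.exp (commutatorMap x) * IsNilpotent.exp (commutatorMap y) =
      IsNilpotent.exp (commutatorMap z) := by
    ext w
    rw [Module.End.mul_apply, exp_commutatorMap_apply nx, exp_commutatorMap_apply ny,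
      exp_commutatorMap_apply nz, hneg, hexp]
    simp only [mul_assoc]
  obtain ⟨R₁, hR₁⟩ := isNilpotent_commutatorMap nx
  obtain ⟨R₂, hR₂⟩ := isNilpotent_commutatorMap ny
  obtain ⟨R₃, hR₃⟩ := isNilpotent_commutatorMap nz
  obtain ⟨R₄, hR₄⟩ := IsNilpotent.isNilpotent_exp_sub_one (isNilpotent_commutatorMap nz)
  -- One truncation order for all the series below; the final `2` leaves room to split off the terms
  -- of degree `0` and `1`.
  set K := R₁ + R₂ + R₃ + R₄ + N + 2 with hK
  have kx : commutatorMap x ^ K = 0 := pow_eq_zero_of_le (by omega) hR₁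
  have ky : commutatorMap y ^ K = 0 := pow_eq_zero_of_le (by omega) hR₂
  have kz : commutatorMap z ^ K = 0 := pow_eq_zero_of_le (by omega) hR₃
  have hDx' : commutatorMap x D = -x := by rw [commutatorMap_apply, ← neg_sub, hDx]
  have hDy' : commutatorMap y D = -y := by rw [commutatorMap_apply, ← neg_sub, hDy]
  have hself : ∀ a : E, commutatorMap a a = 0 := fun a => by simp [commutatorMap_apply]
  -- As `(ad a)(D) = -a` is killed by a further `ad a`, the exponential series stops after its
  -- linear term.
  have hexpD : ∀ {a : E}, commutatorMap a ^ K = 0 → commutatorMap a D = -a →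
      IsNilpotent.exp (commutatorMap a) D = D - a := by
    intro a ka ha
    obtain ⟨K', hK'⟩ : ∃ K', K = K' + 2 := ⟨_, hK⟩
    rw [IsNilpotent.exp_eq_sum ka, hK', Finset.sum_range_succ', Finset.sum_range_succ',
      LinearMap.add_apply, LinearMap.add_apply, LinearMap.sum_apply, Finset.sum_eq_zero]
    · simp [ha, sub_eq_neg_add]
    · intro n _
      rw [LinearMap.smul_apply, add_assoc, pow_add, pow_two, Module.End.mul_apply,
        Module.End.mul_apply, ha, map_neg, hself, neg_zero, map_zero, smul_zero]
  have hzD : IsNilpotent.exp (commutatorMap z) D =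
      D - (x + IsNilpotent.exp (commutatorMap x) y) := by
    rw [← hW, Module.End.mul_apply, hexpD ky hDy', map_sub, hexpD kx hDx', sub_sub]
  -- Comparison of two values of `e^{ad z} D - D`: one comes from `e^{ad x} e^{ad y}`, the other
  -- from the series in `ad z`, where `(ad z)(D) = -[D, z]`.
  have hpsi : nilEval K (commutatorMap z) expSubOneDivX (commutatorMap D z) =
      x + IsNilpotent.exp (commutatorMap x) y := by
    have h1 : commutatorMap D z = - commutatorMap z D := by
      rw [commutatorMap_apply, commutatorMap_apply, neg_sub]
    rw [exp_eq_one_add_nilEval_mul kz, LinearMap.add_apply, Module.End.one_apply,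
      Module.End.mul_apply, sub_eq_add_neg, add_right_inj] at hzD
    rw [h1, map_neg, hzD, neg_neg]
  have hphi : commutatorMap D z = nilEval K (IsNilpotent.exp (commutatorMap z) - 1) logDivX
      (x + IsNilpotent.exp (commutatorMap x) y) := by
    rw [← hpsi, ← Module.End.mul_apply, nilEval_logDivX_mul_nilEval_expSubOneDivX kz,
      Module.End.one_apply]
  have hsum : commutatorMap D z = ∑ n ∈ Finset.range N,
      (n : ℚ) • bchTerm ℚ (fun a b => a * b - b * a) x y n := by
    rw [hphi, ← hW, nilEval_eq_sum, LinearMap.sum_apply]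
    have h1 : ∀ n ∈ Finset.range N, _ := fun n hn => nsmul_bchTerm x y (n := n) (K := K) (R := K)
      (by have := Finset.mem_range.1 hn; omega) (by have := Finset.mem_range.1 hn; omega)
    rw [Finset.sum_congr rfl h1, Finset.sum_comm]
    refine Finset.sum_congr rfl fun m _ => ?_
    rw [LinearMap.smul_apply, exp_mul_exp_sub_one_pow_apply x y (by omega) kx ky, ← Finset.smul_sum]
    congr 1
    · simp [logDivX]
    -- Grouping by degrees `n < N` loses nothing: longer words have brackets in `J N = ⊥`.
    rw [Finset.sum_fiberwise_eq_sum_filter, Finset.sum_filter_of_ne]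
    intro c hc hne
    by_contra hlt
    apply hne
    rw [Finset.mem_range, not_lt] at hlt
    rw [hJ.eq_zero (p := (List.ofFn fun i => pairWord x y (c i)).flatten.length)
      (a := nestedBracket _ _), smul_zero]
    · rwa [length_flatten_pairWord]
    · refine hJ.nestedBracket_mem ?_ ?_
      · rw [List.ofFn_succ, List.flatten_cons, Ne, List.append_eq_nil_iff, not_and_or]
        exact Or.inl (pairWord_ne_nil x y (Finset.mem_erase.1 (Fintype.mem_piFinset.1 hc 0)).1)
      · intro a ha
        simp only [List.mem_flatten, List.mem_ofFn] at ha
        obtain ⟨l, ⟨i, rfl⟩, ha⟩ := ha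
        simp only [pairWord, List.mem_append, List.mem_replicate] at ha
        rcases ha with ⟨_, rfl⟩ | ⟨_, rfl⟩ <;> assumption
  rw [← hexp]
  congr 1
  rw [← sub_eq_zero]
  -- Both candidates for the logarithm have the same commutator with `D`, and `ad D` is injective on
  -- `J 1`.
  refine hD _ (Submodule.sub_mem _ hz (Submodule.sum_mem _ fun n _ => ?_)) ?_
  · rcases n with _ | n
    · simp [bchTerm]
    · exact hJ.antitone (by omega) (hJ.bchTerm_mem hx hy (n + 1))
  · rw [← commutatorMap_apply, map_sub, hsum, map_sum, sub_eq_zero]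
    exact Finset.sum_congr rfl fun n _ => (commutator_bchTerm hDx hDy n).symm

end Dynkin

/-! ### Dynkin's formula for operators on a nilpotently filtered vector space -/

theorem map_nestedBracket {L L' : Type*} [AddCommGroup L] [AddCommGroup L'] [Module ℚ L]
    [Module ℚ L'] (f : L →ₗ[ℚ] L') {br : L → L → L} {br' : L' → L' → L'}
    (hf : ∀ a b, f (br a b) = br' (f a) (f b)) (l : List L) :
    f (nestedBracket br l) = nestedBracket br' (l.map f) := by
  induction l with
  | nil => simp [nestedBracket]
  | cons a l ih =>
    cases l with
    | nil => simp [nestedBracket]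
    | cons b l => simp only [nestedBracket, List.map_cons, hf] at ih ⊢; rw [ih]

theorem map_bchTerm {L L' : Type*} [AddCommGroup L] [AddCommGroup L'] [Module ℚ L]
    [Module ℚ L'] (f : L →ₗ[ℚ] L') {br : L → L → L} {br' : L' → L' → L'}
    (hf : ∀ a b, f (br a b) = br' (f a) (f b)) (x y : L) (n : ℕ) :
    f (bchTerm ℚ br x y n) = bchTerm ℚ br' (f x) (f y) n := by
  simp [bchTerm, map_nestedBracket f hf, List.map_flatten, List.map_ofFn, Function.comp_def]

theorem bchTerm_eq_rat {k L : Type*} [CommRing k] [Algebra ℚ k] [AddCommGroup L] [Module k L]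
    [Module ℚ L] [IsScalarTower ℚ k L] (br : L → L → L) (x y : L) (n : ℕ) :
    bchTerm k br x y n = bchTerm ℚ br x y n := by
  simp only [bchTerm, algebraMap_smul, Algebra.algebraMap_self_apply]

section FilteredEnd

variable {M : Type*} [AddCommGroup M] [Module ℚ M]

/-- The operator `X t` on the space of polynomials in `t` with coefficients in `M`. -/
noncomputable def shiftEnd (X : Module.End ℚ M) : Module.End ℚ (ℕ →₀ M) :=
  Finsupp.lmapDomain M ℚ Nat.succ ∘ₗ Finsupp.mapRange.linearMap X

theorem shiftEnd_apply_succ (X : Module.End ℚ M) (f : ℕ →₀ M) (n : ℕ) :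
    shiftEnd X f (n + 1) = X (f n) := by
  simp only [shiftEnd, LinearMap.comp_apply, Finsupp.lmapDomain_apply]
  rw [← Nat.succ_eq_add_one, Finsupp.mapDomain_apply Nat.succ_injective]
  simp

theorem shiftEnd_apply_zero (X : Module.End ℚ M) (f : ℕ →₀ M) : shiftEnd X f 0 = 0 := by
  simp only [shiftEnd, LinearMap.comp_apply, Finsupp.lmapDomain_apply]
  exact Finsupp.mapDomain_of_notMem_range _ _ (by simp)

/-- The Euler operator `t d/dt` on the space of polynomials in `t` with coefficients in `M`. -/
noncomputable def eulerEnd : Module.End ℚ (ℕ →₀ M) where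
  toFun f := Finsupp.onFinset f.support (fun n => (n : ℚ) • f n) fun n hn => by
    rw [Finsupp.mem_support_iff]
    rintro h
    simp [h] at hn
  map_add' f g := by ext n; simp
  map_smul' c f := by ext n; simp [smul_comm c]

theorem eulerEnd_apply (f : ℕ →₀ M) (n : ℕ) : eulerEnd f n = (n : ℚ) • f n := rfl

/-- Evaluation at `t = 1`. -/
noncomputable def evalOne : (ℕ →₀ M) →ₗ[ℚ] M := Finsupp.lsum ℚ fun _ => LinearMap.id

theorem evalOne_single (n : ℕ) (m : M) : evalOne (Finsupp.single n m) = m := by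
  simp [evalOne]

theorem shiftEnd_single (X : Module.End ℚ M) (n : ℕ) (m : M) :
    shiftEnd X (Finsupp.single n m) = Finsupp.single (n + 1) (X m) := by
  simp [shiftEnd, Finsupp.mapDomain_single]

theorem evalOne_comp_shiftEnd (X : Module.End ℚ M) : evalOne ∘ₗ shiftEnd X = X ∘ₗ evalOne := by
  ext n m
  simp [shiftEnd_single, evalOne_single]

theorem eulerEnd_commutator_shiftEnd (X : Module.End ℚ M) :
    eulerEnd * shiftEnd X - shiftEnd X * eulerEnd = shiftEnd X := by
  refine LinearMap.ext fun f => Finsupp.ext fun n => ?_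
  simp only [LinearMap.sub_apply, Module.End.mul_apply, Finsupp.sub_apply, eulerEnd_apply]
  rcases n with _ | n
  · simp [shiftEnd_apply_zero]
  · simp only [shiftEnd_apply_succ, eulerEnd_apply, map_smul]
    rw [← sub_smul]
    simp

variable (F : ℕ → Submodule ℚ M)

/-- Operators on `M[t]` which raise by `p` both the filtration of the coefficients and the order
in `t`. -/
def raisingEnd (p : ℕ) : Submodule ℚ (Module.End ℚ (ℕ →₀ M)) where
  carrier := {T | (∀ q f, (∀ n, f n ∈ F q) → ∀ n, T f n ∈ F (q + p)) ∧
    ∀ q f, (∀ n < q, f n = 0) → ∀ n < q + p, T f n = 0}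
  zero_mem' := by simp
  add_mem' {S T} hS hT := ⟨fun q f hf n => Submodule.add_mem _ (hS.1 q f hf n) (hT.1 q f hf n),
    fun q f hf n hn => by simp [hS.2 q f hf n hn, hT.2 q f hf n hn]⟩
  smul_mem' c T hT := ⟨fun q f hf n => Submodule.smul_mem _ c (hT.1 q f hf n),
    fun q f hf n hn => by simp [hT.2 q f hf n hn]⟩

variable {F}

/-- Vanishing at `N` comes from the filtration of the coefficients alone; the condition on the order
in `t` serves to make `ad (t d/dt)` injective. -/
theorem isNilFiltration_raisingEnd (hF : Antitone F) (h0 : F 0 = ⊤) {N : ℕ} (hN : F N = ⊥) :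
    IsNilFiltration (raisingEnd F) N where
  antitone p q hpq T hT :=
    ⟨fun r f hf n => hF (by omega) (hT.1 r f hf n), fun r f hf n hn => hT.2 r f hf n (by omega)⟩
  mul_mem {p q S T} hS hT := by
    refine ⟨fun r f hf n => ?_, fun r f hf n hn => ?_⟩
    · have := hS.1 (r + q) (T f) (hT.1 r f hf) n
      rwa [add_assoc, add_comm q p] at this
    · exact hS.2 (r + q) (T f) (hT.2 r f hf) n (by omega)
  eq_bot := by
    rw [eq_bot_iff]
    intro T hT
    rw [Submodule.mem_bot]
    refine LinearMap.ext fun f => Finsupp.ext fun n => ?_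
    have := hT.1 0 f (by simp [h0]) n
    rwa [zero_add, hN, Submodule.mem_bot] at this

theorem shiftEnd_mem_raisingEnd {X : Module.End ℚ M} (hX : ∀ q, ∀ m ∈ F q, X m ∈ F (q + 1)) :
    shiftEnd X ∈ raisingEnd F 1 := by
  refine ⟨fun q f hf n => ?_, fun q f hf n hn => ?_⟩
  · rcases n with _ | n
    · simp [shiftEnd_apply_zero]
    · rw [shiftEnd_apply_succ]
      exact hX q _ (hf n)
  · rcases n with _ | n
    · simp [shiftEnd_apply_zero]
    · rw [shiftEnd_apply_succ, hf n (by omega), map_zero]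

/-- An operator commuting with `t d/dt` preserves the degree in `t`, whereas `w` strictly raises the
order. -/
theorem eq_zero_of_eulerEnd_commutator {w : Module.End ℚ (ℕ →₀ M)} (hw : w ∈ raisingEnd F 1)
    (h : eulerEnd * w - w * eulerEnd = 0) : w = 0 := by
  refine Finsupp.lhom_ext fun n m => Finsupp.ext fun j => ?_
  have h1 := congrArg (fun T : Module.End ℚ (ℕ →₀ M) => T (Finsupp.single n m) j) h
  have h2 : eulerEnd (Finsupp.single n m) = (n : ℚ) • Finsupp.single n m := by
    ext i
    rw [eulerEnd_apply, Finsupp.smul_apply]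
    by_cases hi : n = i
    · rw [hi]
    · simp [Finsupp.single_eq_of_ne' hi]
  simp only [LinearMap.sub_apply, Module.End.mul_apply, Finsupp.sub_apply, eulerEnd_apply, h2,
    map_smul, Finsupp.smul_apply, LinearMap.zero_apply, Finsupp.zero_apply] at h1 ⊢
  by_cases hj : j < n + 1
  · exact hw.2 n _ (fun i hi => Finsupp.single_eq_of_ne (by omega)) j hj
  · rw [← sub_smul] at h1
    refine (smul_eq_zero.1 h1).resolve_left (sub_ne_zero.2 ?_)
    exact_mod_cast (by omega : j ≠ n)

theorem isNilpotent_of_raising (h0 : F 0 = ⊤) {N : ℕ} (hN : F N = ⊥) {X : Module.End ℚ M}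
    (hX : ∀ q, ∀ m ∈ F q, X m ∈ F (q + 1)) : X ^ N = 0 := by
  have h : ∀ n m, (X ^ n) m ∈ F n := by
    intro n
    induction n with
    | zero => simp [h0]
    | succ n ih => intro m; rw [pow_succ', Module.End.mul_apply]; exact hX n _ (ih m)
  ext m
  have := h N m
  rwa [hN, Submodule.mem_bot] at this

/-- Dynkin's formula for operators which raise a finite filtration. -/
theorem exp_mul_exp_of_raising (hF : Antitone F) (h0 : F 0 = ⊤) {N : ℕ} (hN : F N = ⊥)
    {X Y : Module.End ℚ M} (hX : ∀ q, ∀ m ∈ F q, X m ∈ F (q + 1))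
    (hY : ∀ q, ∀ m ∈ F q, Y m ∈ F (q + 1)) :
    IsNilpotent.exp X * IsNilpotent.exp Y =
      IsNilpotent.exp (∑ n ∈ Finset.range N, bchTerm ℚ (fun a b => a * b - b * a) X Y n) := by
  have hJ := isNilFiltration_raisingEnd hF h0 hN
  have sX := shiftEnd_mem_raisingEnd hX
  have sY := shiftEnd_mem_raisingEnd hY
  have key := hJ.exp_mul_exp (D := eulerEnd) (fun w hw h => eq_zero_of_eulerEnd_commutator hw h)
    sX sY (eulerEnd_commutator_shiftEnd X) (eulerEnd_commutator_shiftEnd Y)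
  -- Pairs of operators intertwined by evaluation at `t = 1`. As they form an algebra, the BCH terms
  -- of `(tX, X)` and `(tY, Y)` are again intertwined.
  let S : Subalgebra ℚ (Module.End ℚ (ℕ →₀ M) × Module.End ℚ M) :=
    { carrier := {p | evalOne ∘ₗ p.1 = p.2 ∘ₗ evalOne}
      mul_mem' := by
        intro a b ha hb
        refine LinearMap.ext fun f => ?_
        have h1 := fun f => LinearMap.congr_fun ha f
        have h2 := fun f => LinearMap.congr_fun hb f
        simp only [LinearMap.comp_apply] at h1 h2
        simp [h1, h2]
      add_mem' := by
        intro a b ha hb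
        simp only [Set.mem_ofPred_eq, Prod.fst_add, Prod.snd_add, LinearMap.comp_add,
          LinearMap.add_comp] at *
        rw [ha, hb]
      algebraMap_mem' := by
        intro r
        refine LinearMap.ext fun f => ?_
        simp }
  let x : S := ⟨(shiftEnd X, X), evalOne_comp_shiftEnd X⟩
  let y : S := ⟨(shiftEnd Y, Y), evalOne_comp_shiftEnd Y⟩
  let p₁ : S →ₐ[ℚ] Module.End ℚ (ℕ →₀ M) := (AlgHom.fst ℚ _ _).comp S.val
  let p₂ : S →ₐ[ℚ] Module.End ℚ M := (AlgHom.snd ℚ _ _).comp S.val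
  let b : S := ∑ n ∈ Finset.range N, bchTerm ℚ (fun a b => a * b - b * a) x y n
  have hb₁ : p₁ b = ∑ n ∈ Finset.range N,
      bchTerm ℚ (fun a b => a * b - b * a) (shiftEnd X) (shiftEnd Y) n := by
    rw [map_sum]
    exact Finset.sum_congr rfl fun n _ => map_bchTerm p₁.toLinearMap
      (fun _ _ => rfl) x y n
  have hb₂ : p₂ b = ∑ n ∈ Finset.range N, bchTerm ℚ (fun a b => a * b - b * a) X Y n := by
    rw [map_sum]
    exact Finset.sum_congr rfl fun n _ => map_bchTerm p₂.toLinearMap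
      (fun _ _ => rfl) x y n
  have hpair : evalOne ∘ₗ p₁ b = p₂ b ∘ₗ evalOne := b.2
  have hmem : p₁ b ∈ raisingEnd F 1 := by
    rw [hb₁]
    refine Submodule.sum_mem _ fun n _ => ?_
    rcases n with _ | n
    · simp [bchTerm]
    · exact hJ.antitone (by omega) (hJ.bchTerm_mem sX sY (n + 1))
  have nilX : IsNilpotent X := ⟨N, isNilpotent_of_raising h0 hN hX⟩
  have nilY : IsNilpotent Y := ⟨N, isNilpotent_of_raising h0 hN hY⟩
  have nilb : IsNilpotent (p₂ b) := by
    obtain ⟨n, hn⟩ := hJ.isNilpotent hmem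
    refine ⟨n, LinearMap.ext fun m => ?_⟩
    have h := LinearMap.congr_fun (Module.End.commute_pow_left_of_commute hpair.symm n)
      (Finsupp.single 0 m)
    simpa [hn, evalOne_single] using h
  have iX := Module.End.commute_exp_left_of_commute (hJ.isNilpotent sX) nilX
    (evalOne_comp_shiftEnd X).symm
  have iY := Module.End.commute_exp_left_of_commute (hJ.isNilpotent sY) nilY
    (evalOne_comp_shiftEnd Y).symm
  have ib := Module.End.commute_exp_left_of_commute (hJ.isNilpotent hmem) nilb hpair.symm
  rw [← hb₂]
  rw [← hb₁] at key
  refine LinearMap.ext fun m => ?_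
  have e1 := LinearMap.congr_fun iY (Finsupp.single 0 m)
  have e2 := LinearMap.congr_fun iX (IsNilpotent.exp (shiftEnd Y) (Finsupp.single 0 m))
  have e3 := LinearMap.congr_fun ib (Finsupp.single 0 m)
  simp only [LinearMap.comp_apply, evalOne_single] at e1 e2 e3
  rw [Module.End.mul_apply, e1, e2, e3, ← key, Module.End.mul_apply]

end FilteredEnd

/-! ### Symmetric braces of lists -/

section ListDer

variable {L : Type*} [AddCommGroup L]

/-- The sum of the values of `φ` on the lists obtained from a given list by applying `f` to one
of its members. -/
def listDer (f : L → L) : (List L → L) → List L → L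
  | _, [] => 0
  | φ, x :: l => φ (f x :: l) + listDer f (fun l => φ (x :: l)) l

theorem listDer_congr (f : L → L) {φ ψ : List L → L} {l : List L}
    (h : ∀ l' : List L, l'.length = l.length → φ l' = ψ l') : listDer f φ l = listDer f ψ l := by
  induction l generalizing φ ψ with
  | nil => rfl
  | cons x l ih =>
    rw [listDer, listDer, h _ (by simp), ih fun l' hl' => h (x :: l') (by simp [hl'])]

theorem listDer_add (f : L → L) (φ ψ : List L → L) (l : List L) :
    listDer f (fun l => φ l + ψ l) l = listDer f φ l + listDer f ψ l := by
  induction l generalizing φ ψ with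
  | nil => simp [listDer]
  | cons x l ih =>
    simp only [listDer, ih]
    abel

theorem listDer_comp (f : L → L) (h : L →+ L) (φ : List L → L) (l : List L) :
    listDer f (fun l => h (φ l)) l = h (listDer f φ l) := by
  induction l generalizing φ with
  | nil => simp [listDer]
  | cons x l ih => simp only [listDer, ih, map_add]

theorem listDer_sub (f : L → L) (φ ψ : List L → L) (l : List L) :
    listDer f (fun l => φ l - ψ l) l = listDer f φ l - listDer f ψ l := by
  have h := listDer_add f (fun l => φ l - ψ l) ψ l
  simp only [sub_add_cancel] at h
  rw [h, add_sub_cancel_right]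

/-- Applications at two different positions commute. At one position the iterated sums give `g ∘ f`
and `f ∘ g` respectively, and the added terms balance them. -/
theorem listDer_listDer (f g : L → L) (φ : List L → L) (l : List L) :
    listDer f (listDer g φ) l + listDer (f ∘ g) φ l =
      listDer g (listDer f φ) l + listDer (g ∘ f) φ l := by
  induction l generalizing φ with
  | nil => simp [listDer]
  | cons x l ih =>
    have h := ih fun l => φ (x :: l)
    simp only [listDer, listDer_add, Function.comp_apply]
    linear_combination (norm := abel) h

/-- Invariance under permutations on lists of length `n`. -/
def PermInvariant {L : Type*} (n : ℕ) (φ : List L → L) : Prop :=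
  ∀ l l' : List L, l.Perm l' → l.length = n → φ l = φ l'

/-- Additivity in each entry on lists of length `n`. -/
def MultiAdditive (n : ℕ) (φ : List L → L) : Prop :=
  ∀ (l₁ : List L) (x y : L) (l₂ : List L), l₁.length + 1 + l₂.length = n →
    φ (l₁ ++ (x + y) :: l₂) = φ (l₁ ++ x :: l₂) + φ (l₁ ++ y :: l₂)

theorem MultiAdditive.head {n : ℕ} {φ : List L → L} (h : MultiAdditive (n + 1) φ) (x y : L)
    {l : List L} (hl : l.length = n) : φ ((x + y) :: l) = φ (x :: l) + φ (y :: l) :=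
  h [] x y l (by simp [hl, add_comm])

theorem MultiAdditive.tail {n : ℕ} {φ : List L → L} (h : MultiAdditive (n + 1) φ) (x : L) :
    MultiAdditive n fun l => φ (x :: l) :=
  fun l₁ y z l₂ hn => h (x :: l₁) y z l₂ (by simp; omega)

theorem PermInvariant.tail {L : Type*} {n : ℕ} {φ : List L → L} (h : PermInvariant (n + 1) φ) (x : L) :
    PermInvariant n fun l => φ (x :: l) :=
  fun l l' hl hn => h (x :: l) (x :: l') (hl.cons x) (by simp [hn])

theorem PermInvariant.listDer {n : ℕ} {φ : List L → L} (h : PermInvariant n φ) (f : L → L) :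
    PermInvariant n (listDer f φ) := by
  intro l l' hl
  induction hl generalizing n φ with
  | nil => exact fun _ => rfl
  | @cons x l l' hl ih =>
    rintro rfl
    rw [_root_.listDer, _root_.listDer, h _ _ (hl.cons (f x)) (by simp), ih (h.tail x) rfl]
  | swap x y l =>
    rintro rfl
    simp only [_root_.listDer]
    rw [h (f y :: x :: l) (x :: f y :: l) (List.Perm.swap _ _ _) (by simp),
      h (y :: f x :: l) (f x :: y :: l) (List.Perm.swap _ _ _) (by simp),
      listDer_congr f fun l' hl' => h (y :: x :: l') (x :: y :: l') (List.Perm.swap _ _ _)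
        (by simp [hl'])]
    abel
  | @trans l₁ l₂ l₃ h₁ h₂ ih₁ ih₂ =>
    intro hn
    rw [ih₁ h hn, ih₂ h (by rw [← h₁.length_eq, hn])]

theorem MultiAdditive.listDer {n : ℕ} {φ : List L → L} (h : MultiAdditive n φ) (f : L →+ L) :
    MultiAdditive n (listDer f φ) := by
  intro l₁ x y l₂ hn
  induction l₁ generalizing n φ with
  | nil =>
    obtain rfl : n = l₂.length + 1 := by simp at hn; omega
    simp only [List.nil_append, _root_.listDer]
    rw [listDer_congr f fun l' hl' => h.head x y hl', listDer_add, map_add, h.head _ _ rfl]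
    abel
  | cons z l₁ ih =>
    obtain ⟨n, rfl⟩ : ∃ n', n = n' + 1 := ⟨n - 1, by simp at hn; omega⟩
    simp only [List.cons_append, _root_.listDer]
    rw [ih (h.tail z) (by simp at hn; omega), ← List.cons_append, h (f z :: l₁) x y l₂ hn]
    simp only [List.cons_append]
    abel

theorem MultiAdditive.listDer_add_map {n : ℕ} {φ : List L → L} (h : MultiAdditive n φ)
    (f g : L → L) {l : List L} (hl : l.length = n) :
    _root_.listDer (fun v => f v + g v) φ l = _root_.listDer f φ l + _root_.listDer g φ l := by
  induction l generalizing n φ with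
  | nil => simp [_root_.listDer]
  | cons x l ih =>
    obtain rfl : n = l.length + 1 := by simp at hl; omega
    simp only [_root_.listDer]
    rw [h.head _ _ rfl, ih (h.tail x) rfl]
    abel

/-- By symmetry the modified entry can always be moved to the front. -/
theorem PermInvariant.listDer_replicate {n : ℕ} {φ : List L → L} (h : PermInvariant (n + 1) φ)
    (f : L → L) (b : L) :
    _root_.listDer f φ (List.replicate (n + 1) b) = (n + 1) • φ (f b :: List.replicate n b) := by
  induction n generalizing φ with
  | zero => simp [_root_.listDer]
  | succ n ih =>
    rw [List.replicate_succ, _root_.listDer, ih (h.tail b),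
      h (b :: f b :: List.replicate n b) (f b :: List.replicate (n + 1) b)
        (by rw [List.replicate_succ]; exact List.Perm.swap _ _ _) (by simp)]
    simp only [List.replicate_succ, succ_nsmul']

end ListDer

/-! ### Braces on lists: estimates, additivity, symmetry and the Leibniz rule. -/

section ListBrace

variable {L : Type*} [AddCommGroup L] [Module ℚ L] (m : L →ₗ[ℚ] L →ₗ[ℚ] L)

/-- Right multiplication. -/
def mulRightHom (c : L) : L →+ L := (m.flip c).toAddMonoidHom

theorem mulRightHom_apply (c v : L) : mulRightHom m c v = m v c := rfl

/-- The symmetric braces on lists of length `n`. -/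
def listBraceAux (a : L) : ℕ → List L → L
  | 0, _ => a
  | _ + 1, [] => a
  | n + 1, c :: l => m (listBraceAux a n l) c - listDer (mulRightHom m c) (listBraceAux a n) l

/-- The symmetric brace `{a; bₙ, …, b₁}` of a list `[b₁, …, bₙ]`. -/
def listBrace (a : L) (l : List L) : L := listBraceAux m a l.length l

theorem listBrace_nil (a : L) : listBrace m a [] = a := rfl

theorem listBrace_cons (a c : L) (l : List L) :
    listBrace m a (c :: l) = m (listBrace m a l) c - listDer (mulRightHom m c) (listBrace m a) l := by
  rw [listBrace, List.length_cons, listBraceAux, listBrace]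
  congr 1
  refine listDer_congr _ fun l' hl' => ?_
  rw [listBrace, hl']

/-- Braces respect additive relations which are compatible with the products. -/
theorem listBrace_rel {L' : Type*} [AddCommGroup L'] [Module ℚ L'] (m' : L' →ₗ[ℚ] L' →ₗ[ℚ] L')
    (R : L → L' → Prop) (h0 : R 0 0) (hadd : ∀ {x x' y y'}, R x x' → R y y' → R (x + y) (x' + y'))
    (hsub : ∀ {x x' y y'}, R x x' → R y y' → R (x - y) (x' - y'))
    (hm : ∀ {x x' y y'}, R x x' → R y y' → R (m x y) (m' x' y')) {a : L} {a' : L'} (ha : R a a')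
    {l : List L} {l' : List L'} (hl : List.Forall₂ R l l') :
    R (listBrace m a l) (listBrace m' a' l') := by
  have hder : ∀ {f : L → L} {f' : L' → L'}, (∀ {x x'}, R x x' → R (f x) (f' x')) →
      ∀ {l : List L} {l' : List L'} {φ : List L → L} {φ' : List L' → L'},
      (∀ {k : List L} {k' : List L'}, k.length = l.length → List.Forall₂ R k k' → R (φ k) (φ' k')) →
      List.Forall₂ R l l' → R (listDer f φ l) (listDer f' φ' l') := by
    intro f f' hf l l' φ φ' hφ hl
    induction hl generalizing φ φ' with
    | nil => exact h0
    | cons hx hl ih =>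
      refine hadd (hφ (by simp) (List.Forall₂.cons (hf hx) hl)) (ih fun hk hkk => ?_)
      exact hφ (by simp [hk]) (List.Forall₂.cons hx hkk)
  induction hn : l.length generalizing l l' with
  | zero =>
    obtain rfl := List.length_eq_zero_iff.1 hn
    cases hl
    exact ha
  | succ n ih =>
    cases hl with
    | nil => simp at hn
    | @cons c c' l l' hc hl =>
      simp only [List.length_cons, Nat.add_right_cancel_iff] at hn
      rw [listBrace_cons, listBrace_cons]
      refine hsub (hm (ih hl hn) hc) (hder (fun hx => hm hx hc) (fun hk hkk => ih hkk ?_) hl)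
      omega

/-- The family `G` is arbitrary so as to cover the given filtration, its extension to polynomials,
and the order in `t`. -/
theorem listBrace_mem (G : ℕ → Submodule ℚ L)
    (hm : ∀ {p q a b}, a ∈ G p → b ∈ G q → m a b ∈ G (p + q)) {p : ℕ} {a : L} (ha : a ∈ G p)
    {l : List L} {w : List ℕ} (hl : List.Forall₂ (fun b q => b ∈ G q) l w) :
    listBrace m a l ∈ G (p + w.sum) := by
  have hder : ∀ {f : L → L} {s : ℕ}, (∀ {q x}, x ∈ G q → f x ∈ G (q + s)) →
      ∀ {l : List L} {w : List ℕ} {φ : List L → L} {r : ℕ},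
      (∀ {k : List L} {v : List ℕ}, k.length = l.length →
        List.Forall₂ (fun b q => b ∈ G q) k v → φ k ∈ G (r + v.sum)) →
      List.Forall₂ (fun b q => b ∈ G q) l w → listDer f φ l ∈ G (r + (s + w.sum)) := by
    intro f s hf l w φ r hφ hl
    induction hl generalizing φ r with
    | nil => exact Submodule.zero_mem _
    | @cons x q l w hx hl ih =>
      refine Submodule.add_mem _ ?_ ?_
      · have := hφ (by simp) (List.Forall₂.cons (hf hx) hl)
        rw [List.sum_cons] at this ⊢
        convert this using 2
        ring
      · have := ih (φ := fun l => φ (x :: l)) (r := r + q) fun hk hkk => by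
          have := hφ (by simp [hk]) (List.Forall₂.cons hx hkk)
          rwa [List.sum_cons, ← add_assoc] at this
        rw [List.sum_cons]
        convert this using 2
        ring
  induction hn : l.length generalizing l w with
  | zero =>
    obtain rfl := List.length_eq_zero_iff.1 hn
    cases hl
    exact ha
  | succ n ih =>
    cases hl with
    | nil => simp at hn
    | @cons c q l w hc hl =>
      simp only [List.length_cons, Nat.add_right_cancel_iff] at hn
      rw [listBrace_cons, List.sum_cons]
      refine Submodule.sub_mem _ ?_ (hder (fun hx => hm hx hc) (fun hk hkk => ih hkk ?_) hl)
      · have := hm (ih hl hn) hc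
        convert this using 2
        ring
      · omega

theorem multiAdditive_listBrace (a : L) (n : ℕ) : MultiAdditive n (listBrace m a) := by
  induction n with
  | zero => intro l₁ x y l₂ h; omega
  | succ n ih =>
    intro l₁ x y l₂ hn
    rcases l₁ with _ | ⟨c, l₁⟩
    · have hl : l₂.length = n := by simp at hn; omega
      simp only [List.nil_append, listBrace_cons]
      have h : (mulRightHom m (x + y) : L → L) = fun v => mulRightHom m x v + mulRightHom m y v := by
        ext v
        simp [mulRightHom_apply]
      rw [h, ih.listDer_add_map _ _ hl, map_add]
      abel
    · have hl : l₁.length + 1 + l₂.length = n := by simp at hn; omega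
      simp only [List.cons_append, listBrace_cons]
      rw [ih _ _ _ _ hl, ih.listDer _ _ _ _ _ hl, map_add, LinearMap.add_apply]
      abel

variable {m}
variable (hpl : ∀ a b c : L, m (m a b) c - m a (m b c) = m (m a c) b - m a (m c b))
include hpl

/-- By induction only the exchange of the two outermost arguments matters. The pre-Lie identity is
used once for the brace itself and once, through `R_{b⋆c} + R_b R_c = R_{c⋆b} + R_c R_b`, for the
operators acting on the remaining arguments. -/
theorem permInvariant_listBrace (a : L) (n : ℕ) : PermInvariant n (listBrace m a) := by
  induction n with
  | zero =>
    intro l l' hl hn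
    obtain rfl := List.length_eq_zero_iff.1 hn
    rw [List.nil_perm.1 hl]
  | succ n ih =>
    intro l l' hl
    induction hl with
    | nil => exact fun _ => rfl
    | @cons x l l' hl =>
      intro hn
      simp only [List.length_cons, Nat.add_right_cancel_iff] at hn
      rw [listBrace_cons, listBrace_cons, ih _ _ hl hn, ih.listDer _ _ _ hl hn]
    | swap b c l =>
      intro hn
      have hA := multiAdditive_listBrace m a l.length
      have expand : ∀ b c : L, listBrace m a (c :: b :: l) =
          m (m (listBrace m a l) b) c - m (listBrace m a l) (m b c)
          - (m (listDer (mulRightHom m b) (listBrace m a) l) c +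
            m (listDer (mulRightHom m c) (listBrace m a) l) b)
          + (listDer (mulRightHom m (m b c)) (listBrace m a) l +
            listDer (mulRightHom m c) (listDer (mulRightHom m b) (listBrace m a)) l) := by
        intro b c
        have h1 : listDer (mulRightHom m c) (fun l => m (listBrace m a l) b) l =
            m (listDer (mulRightHom m c) (listBrace m a) l) b :=
          listDer_comp _ (mulRightHom m b) _ l
        rw [listBrace_cons, listBrace_cons, listDer]
        simp only [listBrace_cons, listDer_sub, h1, mulRightHom_apply, map_sub,
          LinearMap.sub_apply]
        abel
      -- The terms modifying inner arguments: different positions commute, and equal positions are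
      -- compared by the pre-Lie identity.
      have key : listDer (mulRightHom m (m b c)) (listBrace m a) l +
            listDer (mulRightHom m c) (listDer (mulRightHom m b) (listBrace m a)) l =
          listDer (mulRightHom m (m c b)) (listBrace m a) l +
            listDer (mulRightHom m b) (listDer (mulRightHom m c) (listBrace m a)) l := by
        have h1 := listDer_listDer (mulRightHom m c) (mulRightHom m b) (listBrace m a) l
        have h2 : (fun v => mulRightHom m (m b c) v + (mulRightHom m b ∘ mulRightHom m c) v) =
            fun v => mulRightHom m (m c b) v + (mulRightHom m c ∘ mulRightHom m b) v := by
          ext v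
          simp only [mulRightHom_apply, Function.comp_apply]
          have := hpl v b c
          rw [sub_eq_sub_iff_add_eq_add] at this
          rw [add_comm, ← this, add_comm]
        have h3 := congrArg (fun f => listDer f (listBrace m a) l) h2
        simp only [hA.listDer_add_map _ _ rfl] at h3
        linear_combination (norm := abel) h1 + h3
      rw [expand, expand, hpl, key, add_comm (m (listDer (mulRightHom m b) _ l) c)]
    | @trans l₁ l₂ l₃ h₁ h₂ ih₁ ih₂ =>
      intro hn
      rw [ih₁ hn, ih₂ (by rw [← h₁.length_eq, hn])]

omit hpl in
/-- Derivations act on braces by the Leibniz rule. -/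
theorem derivation_listBrace {D : L →+ L} (hD : ∀ x y, D (m x y) = m (D x) y + m x (D y)) {a : L}
    (ha : D a = 0) (l : List L) : D (listBrace m a l) = listDer D (listBrace m a) l := by
  induction hn : l.length generalizing l with
  | zero =>
    obtain rfl := List.length_eq_zero_iff.1 hn
    exact ha
  | succ n ih =>
    rcases l with _ | ⟨c, l⟩
    · simp at hn
    · simp only [List.length_cons, Nat.add_right_cancel_iff] at hn
      have h1 : listDer D (fun l => m (listBrace m a l) c) l =
          m (listDer D (listBrace m a) l) c := listDer_comp _ (mulRightHom m c) _ l
      have h2 : D (listDer (mulRightHom m c) (listBrace m a) l) =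
          listDer (mulRightHom m c) (listDer D (listBrace m a)) l := by
        rw [← listDer_comp]
        exact listDer_congr _ fun l' hl' => ih l' (by omega)
      have h3 := listDer_listDer (mulRightHom m c) D (listBrace m a) l
      -- The extra term `R_{Dc}` in the commutator of `D` with `R_c` is the correction term of the
      -- brace whose outermost argument is `D c`.
      have h4 : (D ∘ mulRightHom m c : L → L) =
          fun v => (mulRightHom m c ∘ D) v + mulRightHom m (D c) v := by
        ext v
        simp [mulRightHom_apply, hD]
      rw [h4, (multiAdditive_listBrace m a l.length).listDer_add_map _ _ rfl] at h3
      rw [listBrace_cons, map_sub, hD, ih l hn, h2, listDer]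
      simp only [listBrace_cons, listDer_sub, h1]
      linear_combination (norm := abel) -h3

end ListBrace

/-! ### The circle product with an exponential -/

section Convolution

variable {L : Type*} [AddCommGroup L] [Module ℚ L] (m : L →ₗ[ℚ] L →ₗ[ℚ] L)

/-- The product of polynomials in `t` with coefficients in the algebra `L`. -/
noncomputable def convMul : (ℕ →₀ L) →ₗ[ℚ] (ℕ →₀ L) →ₗ[ℚ] (ℕ →₀ L) :=
  Finsupp.lsum ℚ fun i => (Finsupp.lsum ℚ fun j =>
    ((LinearMap.compr₂ m (Finsupp.lsingle (i + j))).flip)).flip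

theorem convMul_single_single (i j : ℕ) (a b : L) :
    convMul m (Finsupp.single i a) (Finsupp.single j b) = Finsupp.single (i + j) (m a b) := by
  simp [convMul]

theorem convMul_single_one (x : L) (f : ℕ →₀ L) :
    convMul m f (Finsupp.single 1 x) = shiftEnd (m.flip x) f := by
  have h : (convMul m).flip (Finsupp.single 1 x) = shiftEnd (m.flip x) := by
    ext n a : 2
    simp [convMul_single_single, shiftEnd_single]
  exact LinearMap.congr_fun h f

theorem evalOne_convMul (f g : ℕ →₀ L) : evalOne (convMul m f g) = m (evalOne f) (evalOne g) := by
  induction f using Finsupp.induction_linear with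
  | zero => simp
  | add f₁ f₂ h₁ h₂ => simp [h₁, h₂]
  | single i a =>
    induction g using Finsupp.induction_linear with
    | zero => simp
    | add g₁ g₂ h₁ h₂ => simp only [map_add, h₁, h₂]
    | single j b => simp [convMul_single_single, evalOne_single]

theorem eulerEnd_single (n : ℕ) (a : L) :
    eulerEnd (Finsupp.single n a) = Finsupp.single n ((n : ℚ) • a) := by
  ext i
  rw [eulerEnd_apply]
  by_cases hi : n = i
  · simp [hi]
  · simp [Finsupp.single_eq_of_ne' hi]

theorem eulerEnd_convMul (f g : ℕ →₀ L) :
    eulerEnd (convMul m f g) = convMul m (eulerEnd f) g + convMul m f (eulerEnd g) := by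
  induction f using Finsupp.induction_linear with
  | zero => simp
  | add f₁ f₂ h₁ h₂ => simp only [map_add, LinearMap.add_apply, h₁, h₂]; abel
  | single i a =>
    induction g using Finsupp.induction_linear with
    | zero => simp
    | add g₁ g₂ h₁ h₂ => simp only [map_add, h₁, h₂]; abel
    | single j b =>
      simp only [convMul_single_single, eulerEnd_single, map_smul, LinearMap.smul_apply]
      rw [← Finsupp.single_add, ← add_smul]
      push_cast
      rfl

variable {m} in
-- Both sides are trilinear, so monomials suffice. Brace symmetry is thereby available for
-- polynomial paths.
theorem convMul_right_symm (hpl : ∀ a b c : L, m (m a b) c - m a (m b c) = m (m a c) b - m a (m c b))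
    (f g h : ℕ →₀ L) :
    convMul m (convMul m f g) h - convMul m f (convMul m g h) =
      convMul m (convMul m f h) g - convMul m f (convMul m h g) := by
  induction f using Finsupp.induction_linear with
  | zero => simp
  | add f₁ f₂ h₁ h₂ =>
    simp only [map_add, LinearMap.add_apply]
    linear_combination (norm := abel) h₁ + h₂
  | single i a =>
    induction g using Finsupp.induction_linear with
    | zero => simp
    | add g₁ g₂ h₁ h₂ =>
      simp only [map_add, LinearMap.add_apply]
      linear_combination (norm := abel) h₁ + h₂
    | single j b =>
      induction h using Finsupp.induction_linear with
      | zero => simp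
      | add g₁ g₂ h₁ h₂ =>
        simp only [map_add, LinearMap.add_apply]
        linear_combination (norm := abel) h₁ + h₂
      | single l c =>
        simp only [convMul_single_single]
        rw [add_right_comm i l j, add_assoc i j l, add_comm l j, ← add_assoc,
          ← Finsupp.single_sub, ← Finsupp.single_sub, hpl]

/-- Polynomials with coefficients in a given subspace. -/
def coeffsIn (G : Submodule ℚ L) : Submodule ℚ (ℕ →₀ L) where
  carrier := {f | ∀ n, f n ∈ G}
  zero_mem' := by simp
  add_mem' hf hg n := G.add_mem (hf n) (hg n)
  smul_mem' c _ hf n := G.smul_mem c (hf n)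

theorem single_mem_coeffsIn {G : Submodule ℚ L} {a : L} (ha : a ∈ G) (n : ℕ) :
    Finsupp.single n a ∈ coeffsIn G := by
  intro i
  rw [Finsupp.single_apply]
  split_ifs
  · exact ha
  · exact G.zero_mem

/-- Polynomials divisible by `t ^ p`. -/
def orderGE (p : ℕ) : Submodule ℚ (ℕ →₀ L) where
  carrier := {f | ∀ n < p, f n = 0}
  zero_mem' := by simp
  add_mem' hf hg n hn := by simp [hf n hn, hg n hn]
  smul_mem' c _ hf n hn := by simp [hf n hn]

theorem convMul_mem_of_single {G : Submodule ℚ (ℕ →₀ L)} {f g : ℕ →₀ L}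
    (h : ∀ i j, convMul m (Finsupp.single i (f i)) (Finsupp.single j (g j)) ∈ G) :
    convMul m f g ∈ G := by
  rw [← Finsupp.sum_single f, ← Finsupp.sum_single g, Finsupp.sum, Finsupp.sum, map_sum]
  refine Submodule.sum_mem _ fun j _ => ?_
  rw [map_sum, LinearMap.sum_apply]
  exact Submodule.sum_mem _ fun i _ => h i j

theorem convMul_mem_coeffsIn {G₁ G₂ G₃ : Submodule ℚ L}
    (hm : ∀ {a b}, a ∈ G₁ → b ∈ G₂ → m a b ∈ G₃) {f g : ℕ →₀ L} (hf : f ∈ coeffsIn G₁)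
    (hg : g ∈ coeffsIn G₂) : convMul m f g ∈ coeffsIn G₃ := by
  refine convMul_mem_of_single m fun i j => ?_
  rw [convMul_single_single]
  exact single_mem_coeffsIn (hm (hf i) (hg j)) _

theorem convMul_mem_orderGE {p q : ℕ} {f g : ℕ →₀ L} (hf : f ∈ orderGE p) (hg : g ∈ orderGE q) :
    convMul m f g ∈ orderGE (p + q) := by
  refine convMul_mem_of_single m fun i j => ?_
  rw [convMul_single_single]
  intro n hn
  rw [Finsupp.single_apply]
  split_ifs with h
  · by_cases hi : i < p
    · simp [hf i hi]
    · simp [hg j (by omega)]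
  · rfl

theorem evalOne_eq_sum {f : ℕ →₀ L} {n : ℕ} (hn : ∀ i, n ≤ i → f i = 0) :
    evalOne f = ∑ i ∈ Finset.range n, f i := by
  rw [evalOne, Finsupp.lsum_apply, Finsupp.sum]
  refine Finset.sum_subset (fun i hi => ?_) fun i _ hi => by simpa using hi
  by_contra h
  exact Finsupp.mem_support_iff.1 hi (hn i (by simpa using h))

end Convolution

/-! ### The differential equation of the path `t ↦ a ⊚ e^{tx}`. -/

section CircleExp

variable {L : Type*} [AddCommGroup L] [Module ℚ L] {m : L →ₗ[ℚ] L →ₗ[ℚ] L}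
  (hpl : ∀ a b c : L, m (m a b) c - m a (m b c) = m (m a c) b - m a (m c b))
  {F : ℕ → Submodule ℚ L} (hF : Antitone F) (h0 : F 0 = ⊤)
  (hm : ∀ {p q a b}, a ∈ F p → b ∈ F q → m a b ∈ F (p + q))

/-- The logarithmic derivative of an exponential path, truncated at order `N`. -/
theorem eulerEnd_expPath {x : L} {u : ℕ → L} (hu1 : u 1 = x)
    (hu : ∀ n, 1 ≤ n → ((n + 1 : ℕ) : ℚ) • u (n + 1) = m (u n) x) {N : ℕ} (hN : 1 ≤ N) :
    eulerEnd (∑ i ∈ Finset.Ico 1 N, Finsupp.single i (u i)) =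
      Finsupp.single 1 x +
        convMul m (∑ i ∈ Finset.Ico 1 N, Finsupp.single i (u i)) (Finsupp.single 1 x) -
        Finsupp.single N ((N : ℚ) • u N) := by
  induction N, hN using Nat.le_induction with
  | base => simp [hu1]
  | succ N hN ih =>
    rw [Finset.sum_Ico_succ_top hN, map_add, ih, map_add, LinearMap.add_apply, eulerEnd_single,
      convMul_single_single, hu N hN]
    abel

include hpl in
/-- The recursion for the terms of `a ⊚ (1 + b)` along a path. -/
theorem listBrace_euler_succ {D : L →+ L} (hD : ∀ x y, D (m x y) = m (D x) y + m x (D y)) {a : L}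
    (ha : D a = 0) {b x r : L} (hb : D b = x + m b x - r) (j : ℕ) :
    D (listBrace m a (List.replicate (j + 1) b)) =
      m (listBrace m a (List.replicate (j + 1) b)) x -
        listBrace m a (x :: List.replicate (j + 1) b) +
        (j + 1) • (listBrace m a (x :: List.replicate j b) -
          listBrace m a (r :: List.replicate j b)) := by
  have hlen : (List.replicate j b).length = j := List.length_replicate
  have hA := multiAdditive_listBrace m a (j + 1)
  have hP := permInvariant_listBrace hpl a (j + 1)
  have h1 : listBrace m a (x :: List.replicate j b) + listBrace m a (m b x :: List.replicate j b) =
      listBrace m a (D b :: List.replicate j b) + listBrace m a (r :: List.replicate j b) := by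
    rw [← hA.head _ _ hlen, ← hA.head _ _ hlen, hb, sub_add_cancel]
  -- With outermost argument `x` the recursion yields the terms containing `b ⋆ x`, exactly those
  -- produced by differentiating `b`.
  have h2 := listBrace_cons m a x (List.replicate (j + 1) b)
  rw [hP.listDer_replicate, mulRightHom_apply] at h2
  rw [derivation_listBrace hD ha, hP.listDer_replicate, h2, eq_sub_iff_add_eq.2 h1.symm]
  simp only [smul_sub, smul_add]
  abel

include hpl hF h0 hm in
-- Put `b(t) = ∑ u_i t^i`, a truncation of `e^{tx} - 1`, and let `C` be the truncated sum of the
-- terms `{a; b, …, b}/n!`. Modulo `F N` the coefficients of `C` satisfy `(n+1) C_{n+1} = C_n ⋆ x`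
-- and `C_0 = a`, so `C_n = R_x^n(a)/n!`; then set `t = 1`.
theorem sum_listBrace_expPath {x a : L} (hx : x ∈ F 1) {u : ℕ → L} (hu1 : u 1 = x)
    (hu : ∀ n, 1 ≤ n → ((n + 1 : ℕ) : ℚ) • u (n + 1) = m (u n) x) (hmem : ∀ n, u n ∈ F n) (N : ℕ) :
    ∑ n ∈ Finset.range N, (n.factorial : ℚ)⁻¹ •
        listBrace m a (List.replicate n (∑ i ∈ Finset.Ico 1 N, u i)) -
      ∑ n ∈ Finset.range N, (n.factorial : ℚ)⁻¹ • ((m.flip x) ^ n : Module.End ℚ L) a ∈ F N := by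
  rcases Nat.eq_zero_or_pos N with rfl | hN
  · simp
  set M := convMul m with hM
  have hplM := convMul_right_symm hpl
  set b : ℕ →₀ L := ∑ i ∈ Finset.Ico 1 N, Finsupp.single i (u i) with hb
  set X : ℕ →₀ L := Finsupp.single 1 x with hX
  set A : ℕ →₀ L := Finsupp.single 0 a with hA
  set D : (ℕ →₀ L) →+ (ℕ →₀ L) := eulerEnd.toAddMonoidHom with hDdef
  have hD : ∀ f g, D (M f g) = M (D f) g + M f (D g) := eulerEnd_convMul m
  have hDA : D A = 0 := by
    change eulerEnd A = 0
    rw [hA, eulerEnd_single]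
    simp
  set r : ℕ →₀ L := Finsupp.single N ((N : ℚ) • u N) with hr
  have hDb : D b = X + M b X - r := eulerEnd_expPath hu1 hu hN
  have bmem : b ∈ coeffsIn (F 1) := Submodule.sum_mem _ fun i hi =>
    single_mem_coeffsIn (hF (Finset.mem_Ico.1 hi).1 (hmem i)) _
  have bord : b ∈ orderGE 1 := Submodule.sum_mem _ fun i hi n hn => by
    rw [Finsupp.single_apply, if_neg]
    have := (Finset.mem_Ico.1 hi).1
    omega
  have hmM : ∀ {p q f g}, f ∈ coeffsIn (F p) → g ∈ coeffsIn (F q) → M f g ∈ coeffsIn (F (p + q)) :=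
    fun hf hg => convMul_mem_coeffsIn m hm hf hg
  have Amem : A ∈ coeffsIn (F 0) := single_mem_coeffsIn (by simp [h0]) _
  have hrep : ∀ (n : ℕ) (c : ℕ →₀ L) (q : ℕ), c ∈ coeffsIn (F q) →
      listBrace M A (c :: List.replicate n b) ∈ coeffsIn (F (q + n)) := by
    intro n c q hc
    have := listBrace_mem M (fun p => coeffsIn (F p)) hmM Amem
      (l := c :: List.replicate n b) (w := q :: List.replicate n 1)
      (List.Forall₂.cons hc (by
        rw [List.forall₂_iff_get]
        simp [bmem]))
    simpa using this
  have hterm : ∀ n, D ((n.factorial : ℚ)⁻¹ • listBrace M A (List.replicate n b)) =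
      (n.factorial : ℚ)⁻¹ • eulerEnd (listBrace M A (List.replicate n b)) :=
    fun n => map_smul eulerEnd _ _
  -- Summing the recursion over `j` telescopes, leaving one boundary term and terms containing the
  -- truncation error `r`, which lie in `F N`.
  have key : ∀ n, eulerEnd (∑ j ∈ Finset.range (n + 1), (j.factorial : ℚ)⁻¹ •
        listBrace M A (List.replicate j b)) -
      M (∑ j ∈ Finset.range (n + 1), (j.factorial : ℚ)⁻¹ •
        listBrace M A (List.replicate j b)) X +
      (n.factorial : ℚ)⁻¹ • listBrace M A (X :: List.replicate n b) ∈ coeffsIn (F N) := by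
    intro n
    induction n with
    | zero =>
      have h1 : eulerEnd A = 0 := hDA
      simp [listBrace_cons, listBrace_nil, listDer, h1]
    | succ n ih =>
      have h1 := listBrace_euler_succ hplM hD hDA hDb n
      change eulerEnd _ = _ at h1
      have h2 : ((n + 1).factorial : ℚ)⁻¹ • ((n + 1) • (listBrace M A (X :: List.replicate n b) -
          listBrace M A (r :: List.replicate n b))) = (n.factorial : ℚ)⁻¹ •
          listBrace M A (X :: List.replicate n b) - (n.factorial : ℚ)⁻¹ •
          listBrace M A (r :: List.replicate n b) := by
        rw [← Nat.cast_smul_eq_nsmul ℚ, smul_smul, ← smul_sub]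
        congr 1
        rw [Nat.factorial_succ]
        push_cast
        field_simp
      have h3 : (n.factorial : ℚ)⁻¹ • listBrace M A (r :: List.replicate n b) ∈ coeffsIn (F N) := by
        refine Submodule.smul_mem _ _ fun i => hF (Nat.le_add_right N n) ?_
        exact hrep n r N (single_mem_coeffsIn (Submodule.smul_mem _ _ (hmem N)) _) i
      rw [Finset.sum_range_succ, map_add, map_add, LinearMap.add_apply, map_smul, h1, smul_add, h2,
        smul_sub, map_smul, LinearMap.smul_apply]
      convert Submodule.sub_mem _ ih h3 using 1
      abel
  set C : ℕ →₀ L := ∑ j ∈ Finset.range N, (j.factorial : ℚ)⁻¹ •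
    listBrace M A (List.replicate j b) with hC
  have hrec : ∀ n, ((n + 1 : ℕ) : ℚ) • C (n + 1) - m (C n) x ∈ F N := by
    obtain ⟨N', rfl⟩ : ∃ N', N = N' + 1 := ⟨N - 1, by omega⟩
    intro n
    have h1 := key N'
    rw [← hC] at h1
    -- The boundary term has `N' + 1` arguments from `F 1`, so it is negligible too.
    have h2 : (N'.factorial : ℚ)⁻¹ • listBrace M A (X :: List.replicate N' b) ∈
        coeffsIn (F (N' + 1)) := by
      have := hrep N' X 1 (single_mem_coeffsIn hx _)
      rw [add_comm] at this
      exact Submodule.smul_mem _ _ this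
    have h3 := (Submodule.add_mem_iff_left _ h2).1 h1 (n + 1)
    rwa [hM, convMul_single_one, Finsupp.sub_apply, eulerEnd_apply, shiftEnd_apply_succ] at h3
  have hC0 : C 0 = a := by
    obtain ⟨N', rfl⟩ : ∃ N', N = N' + 1 := ⟨N - 1, by omega⟩
    rw [hC, Finset.sum_range_succ', Finsupp.add_apply, Finsupp.finsetSum_apply,
      Finset.sum_eq_zero]
    · simp [listBrace_nil, hA]
    · intro j _
      have := listBrace_mem M orderGE (convMul_mem_orderGE m) (p := 0) (a := A)
        (fun i hi => absurd hi (by omega)) (l := List.replicate (j + 1) b)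
        (w := List.replicate (j + 1) 1) (by rw [List.forall₂_iff_get]; simp [bord])
      simp [this 0 (by simp)]
  have hcoeff : ∀ n, C n - (n.factorial : ℚ)⁻¹ • ((m.flip x) ^ n : Module.End ℚ L) a ∈ F N := by
    intro n
    induction n with
    | zero => simp [hC0]
    | succ n ih =>
      have h1 : m (C n - (n.factorial : ℚ)⁻¹ • ((m.flip x) ^ n : Module.End ℚ L) a) x ∈ F N :=
        hF (Nat.le_add_right N 1) (hm ih hx)
      have h2 := Submodule.smul_mem _ (((n + 1 : ℕ) : ℚ)⁻¹) (Submodule.add_mem _ (hrec n) h1)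
      convert h2 using 1
      have hne : ((n + 1 : ℕ) : ℚ) ≠ 0 := by positivity
      rw [map_sub, LinearMap.sub_apply, map_smul, LinearMap.smul_apply, sub_add_sub_cancel,
        smul_sub, smul_smul, inv_mul_cancel₀ hne, one_smul, smul_smul, Nat.factorial_succ,
        Nat.cast_mul, mul_inv, pow_succ', Module.End.mul_apply]
      rfl
  obtain ⟨K, hK⟩ : ∃ K, ∀ i, K ≤ i → C i = 0 := by
    obtain ⟨K, hK⟩ := C.support.exists_nat_subset_range
    refine ⟨K, fun i hi => ?_⟩
    by_contra h
    have := Finset.mem_range.1 (hK (Finsupp.mem_support_iff.2 h))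
    omega
  have hpow : ∀ n, ((m.flip x) ^ n : Module.End ℚ L) a ∈ F n := by
    intro n
    induction n with
    | zero => simp [h0]
    | succ n ih =>
      rw [pow_succ', Module.End.mul_apply]
      exact hm ih hx
  have heval : evalOne C = ∑ n ∈ Finset.range N, (n.factorial : ℚ)⁻¹ •
      listBrace m a (List.replicate n (∑ i ∈ Finset.Ico 1 N, u i)) := by
    rw [hC, map_sum]
    refine Finset.sum_congr rfl fun n _ => ?_
    rw [map_smul]
    congr 1
    have hba : evalOne b = ∑ i ∈ Finset.Ico 1 N, u i := by
      rw [hb, map_sum]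
      simp [evalOne_single]
    refine listBrace_rel M m (fun f v => evalOne f = v) (map_zero _)
      (fun h₁ h₂ => by rw [map_add, h₁, h₂]) (fun h₁ h₂ => by rw [map_sub, h₁, h₂])
      (fun h₁ h₂ => by rw [hM, evalOne_convMul, h₁, h₂]) (evalOne_single 0 a) ?_
    rw [List.forall₂_iff_get]
    simp [hba]
  -- The polynomial `C` may have degree `N` or more; its coefficients from index `N` on lie in `F
  -- N`, as `R_x^n(a)` does for `n ≥ N`.
  rw [← heval, evalOne_eq_sum (n := N + K) fun i hi => hK i (by omega), Finset.sum_range_add,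
    add_sub_right_comm, ← Finset.sum_sub_distrib]
  refine Submodule.add_mem _ (Submodule.sum_mem _ fun n _ => hcoeff n) (Submodule.sum_mem _
    fun n _ => ?_)
  refine (Submodule.sub_mem_iff_left _ (Submodule.smul_mem _ _ ?_)).1 (hcoeff (N + n))
  exact hF (Nat.le_add_right N n) (hpow (N + n))

end CircleExp

/-! ### The uniform structure of a sequence of equivalence relations -/

section SetoidUniformity

open Topology

variable {X Y : Type*} {r : ℕ → Setoid X} {s : ℕ → Setoid Y}

theorem tendsto_nhds_uniformSpaceOfSetoids {ι : Type*} {l : Filter ι} {u : ι → X} {x : X} :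
    Tendsto u l (@nhds X (uniformSpaceOfSetoids r).toTopologicalSpace x) ↔
      ∀ n, ∀ᶠ i in l, r n x (u i) := by
  let _ := uniformSpaceOfSetoids r
  have h : 𝓝 x = ⨅ n, 𝓟 {y | r n x y} := by
    rw [nhds_eq_comap_uniformity]
    change comap (Prod.mk x) (⨅ n, 𝓟 {p : X × X | (r n) p.1 p.2}) = _
    simp [comap_iInf, Set.preimage]
  rw [h, tendsto_iInf]
  simp [tendsto_principal]

theorem continuous_uniformSpaceOfSetoids {f : X → Y}
    (hf : ∀ n x y, r n x y → s n (f x) (f y)) :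
    @Continuous X Y (uniformSpaceOfSetoids r).toTopologicalSpace
      (uniformSpaceOfSetoids s).toTopologicalSpace f := by
  let _ := uniformSpaceOfSetoids r
  let _ := uniformSpaceOfSetoids s
  rw [continuous_iff_continuousAt]
  intro x
  refine tendsto_nhds_uniformSpaceOfSetoids.2 fun n => ?_
  have h : Tendsto id (𝓝 x) (𝓝 x) := tendsto_id
  filter_upwards [tendsto_nhds_uniformSpaceOfSetoids.1 h n] with y hy
  exact hf n _ _ hy

theorem isHomeomorph_uniformSpaceOfSetoids (e : X ≃ Y)
    (he : ∀ n x y, r n x y ↔ s n (e x) (e y)) :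
    @IsHomeomorph X Y (uniformSpaceOfSetoids r).toTopologicalSpace
      (uniformSpaceOfSetoids s).toTopologicalSpace e := by
  let _ := uniformSpaceOfSetoids r
  let _ := uniformSpaceOfSetoids s
  rw [isHomeomorph_iff_exists_inverse]
  refine ⟨continuous_uniformSpaceOfSetoids fun n x y => (he n x y).1, e.symm, e.left_inv,
    e.right_inv, continuous_uniformSpaceOfSetoids fun n x y h => ?_⟩
  rw [he]
  simpa using h

theorem t2Space_uniformSpaceOfSetoids (h : ∀ x y, (∀ n, r n x y) → x = y) :
    @T2Space X (uniformSpaceOfSetoids r).toTopologicalSpace := by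
  let _ := uniformSpaceOfSetoids r
  have : T0Space X := t0Space_iff_uniformity.2 fun x y hxy => h x y fun n =>
    hxy {p : X × X | (r n) p.1 p.2} (mem_iInf_of_mem n (mem_principal_self _))
  infer_instance

theorem completeSpace_uniformSpaceOfSetoids
    (h : ∀ u : ℕ → X, (∀ n, r n (u n) (u (n + 1))) → (∀ N m n, N ≤ m → N ≤ n → r N (u m) (u n)) →
      ∃ x, ∀ n, r n x (u n)) :
    @CompleteSpace X (uniformSpaceOfSetoids r) := by
  let _ := uniformSpaceOfSetoids r
  have : (uniformity X).IsCountablyGenerated := by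
    change (⨅ n, 𝓟 {p : X × X | (r n) p.1 p.2}).IsCountablyGenerated
    infer_instance
  refine UniformSpace.complete_of_convergent_controlled_sequences
    (fun n => {p : X × X | (r n) p.1 p.2})
    (fun n => mem_iInf_of_mem n (mem_principal_self _)) fun u hu => ?_
  obtain ⟨x, hx⟩ := h u (fun n => hu n n (n + 1) le_rfl n.le_succ) hu
  refine ⟨x, tendsto_nhds_uniformSpaceOfSetoids.2 fun n => ?_⟩
  filter_upwards [eventually_ge_atTop n] with i hi
  exact (r n).trans (hx n) (hu n n i le_rfl hi)

end SetoidUniformity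

/-! ### Series in complete filtered modules -/

section Series

variable {k : Type*} [CommRing k] {M : Type*} [AddCommGroup M] [Module k M]
  {F : ℕ → Submodule k M}

theorem isSeriesSum_iff {u : ℕ → M} {s : M} :
    IsSeriesSum F u s ↔ ∀ n, ∀ᶠ N in atTop, s - ∑ i ∈ Finset.range N, u i ∈ F n := by
  rw [IsSeriesSum, tendsto_nhds_uniformSpaceOfSetoids]
  simp only [Submodule.quotientRel_def]

theorem sum_range_sub_sum_range_mem (hF : Antitone F) {u : ℕ → M} (hu : ∀ n, u n ∈ F n) {m n : ℕ}
    (h : m ≤ n) : ∑ i ∈ Finset.range n, u i - ∑ i ∈ Finset.range m, u i ∈ F m := by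
  rw [← Finset.sum_Ico_eq_sub _ h]
  exact Submodule.sum_mem _ fun i hi => hF (Finset.mem_Ico.1 hi).1 (hu i)

/-- Compare with a later partial sum already congruent to `s`: the terms in between lie in `F N`. -/
theorem IsSeriesSum.sub_mem (hF : Antitone F) {u : ℕ → M} (hu : ∀ n, u n ∈ F n) {s : M}
    (hs : IsSeriesSum F u s) (N : ℕ) : s - ∑ i ∈ Finset.range N, u i ∈ F N := by
  obtain ⟨n, h1, h2⟩ := ((isSeriesSum_iff.1 hs N).and (eventually_ge_atTop N)).exists
  have := Submodule.add_mem _ h1 (sum_range_sub_sum_range_mem hF hu h2)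
  rwa [sub_add_sub_cancel] at this

theorem exists_limit_of_surjective (hF : Antitone F)
    (hs : Function.Surjective (toFiltrationLimit F hF)) {u : ℕ → M}
    (hu : ∀ n, u (n + 1) - u n ∈ F n) : ∃ s, ∀ n, s - u n ∈ F n := by
  obtain ⟨s, hs⟩ := hs ⟨fun n => (F n).mkQ (u n), fun n => by
    simpa using (Submodule.Quotient.eq (F n)).2 (hu n)⟩
  refine ⟨s, fun n => ?_⟩
  have h := congrFun (congrArg Subtype.val hs) n
  exact (Submodule.Quotient.eq (F n)).1 h

theorem isSeriesSum_seriesSum (hF : Antitone F)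
    (hs : Function.Surjective (toFiltrationLimit F hF)) {u : ℕ → M} (hu : ∀ n, u n ∈ F n) :
    IsSeriesSum F u (seriesSum F u) := by
  have h : ∃ s, IsSeriesSum F u s := by
    obtain ⟨s, h⟩ := exists_limit_of_surjective hF hs (u := fun N => ∑ i ∈ Finset.range N, u i)
      fun n => sum_range_sub_sum_range_mem hF hu n.le_succ
    refine ⟨s, isSeriesSum_iff.2 fun n => ?_⟩
    filter_upwards [eventually_ge_atTop n] with N hN
    exact hF hN (h N)
  rw [seriesSum, dif_pos h]
  exact h.choose_spec

theorem eq_zero_of_forall_mem (hF : Antitone F)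
    (hi : Function.Injective (toFiltrationLimit F hF)) {x : M} (hx : ∀ n, x ∈ F n) : x = 0 := by
  refine hi (Subtype.ext (funext fun n => ?_))
  change (F n).mkQ x = (F n).mkQ 0
  rw [map_zero]
  exact (Submodule.Quotient.mk_eq_zero _).2 (hx n)

end Series

/-- The reversal is needed because braces of tuples split off the last entry and braces of lists the
head. -/
theorem listDer_ofFn_reverse {L : Type*} [AddCommGroup L] (f : L → L) (φ : List L → L) {n : ℕ}
    (v : Fin n → L) :
    listDer f φ (List.ofFn v).reverse =
      ∑ i, φ (List.ofFn (Function.update v i (f (v i)))).reverse := by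
  induction n generalizing φ with
  | zero => simp [listDer]
  | succ n ih =>
    have h : ∀ w : Fin (n + 1) → L, (List.ofFn w).reverse =
        w (Fin.last n) :: (List.ofFn (Fin.init w)).reverse := fun w => by
      rw [List.ofFn_succ', List.concat_eq_append, List.reverse_append]
      rfl
    rw [h, listDer, ih, Fin.sum_univ_castSucc, add_comm]
    congr 1
    · refine Finset.sum_congr rfl fun i _ => ?_
      rw [h, Fin.init_update_castSucc, Function.update_of_ne (Fin.castSucc_lt_last i).ne']
      rfl
    · rw [h, Fin.init_update_last, Function.update_self]

/-! ### Estimates in a complete pre-Lie algebra -/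

namespace CompletePreLieAlgebra

variable {k : Type*} [CommRing k] {A : ℤ → Type*} [∀ i, AddCommGroup (A i)]
  [∀ i, Module k (A i)] (𝔞 : CompletePreLieAlgebra k A)

theorem star_mem {p q : ℕ} {a b : A 0} (ha : a ∈ 𝔞.F 0 p) (hb : b ∈ 𝔞.F 0 q) :
    𝔞.star a b ∈ 𝔞.F 0 (p + q) := 𝔞.mul_mem _ p q a ha b hb

theorem one_star (a : A 0) : 𝔞.star 𝔞.one a = a := 𝔞.one_mul _ a

theorem star_right_symm (a b c : A 0) :
    𝔞.star (𝔞.star a b) c - 𝔞.star a (𝔞.star b c) =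
      𝔞.star (𝔞.star a c) b - 𝔞.star a (𝔞.star c b) := by
  have h := 𝔞.right_symm (add_zero 0) (add_zero 0) (add_zero 0) (add_zero 0) (add_zero 0)
    (add_zero 0) (add_zero 0) a b c
  simpa [star] using h

theorem mem_F_zero (a : A 0) : a ∈ 𝔞.F 0 0 := by simp [𝔞.F_zero]

theorem bracket_mem {p q : ℕ} {a b : A 0} (ha : a ∈ 𝔞.F 0 p) (hb : b ∈ 𝔞.F 0 q) :
    𝔞.bracket a b ∈ 𝔞.F 0 (p + q) := by
  have := 𝔞.star_mem hb ha
  rw [add_comm] at this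
  exact Submodule.sub_mem _ (𝔞.star_mem ha hb) this

theorem eq_of_forall_sub_mem {a b : A 0} (h : ∀ n, a - b ∈ 𝔞.F 0 n) : a = b :=
  sub_eq_zero.1 (eq_zero_of_forall_mem (𝔞.F_antitone 0) (𝔞.complete 0).1 h)

theorem nestedBracket_mem {p : ℕ} {l : List (A 0)} (hl : l ≠ []) (h : ∀ a ∈ l, a ∈ 𝔞.F 0 p) :
    nestedBracket 𝔞.bracket l ∈ 𝔞.F 0 (p * l.length) := by
  induction l with
  | nil => exact absurd rfl hl
  | cons a l ih =>
    cases l with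
    | nil => simpa [nestedBracket] using h
    | cons b l =>
      have h1 := 𝔞.bracket_mem (h a (by simp))
        (ih (by simp) fun c hc => h c (List.mem_cons_of_mem _ hc))
      rw [nestedBracket, List.length_cons, mul_add, mul_one, add_comm]
      exact h1

theorem rightPow_mem {x : A 0} {p : ℕ} (hx : x ∈ 𝔞.F 0 p) (n : ℕ) :
    𝔞.rightPow x n ∈ 𝔞.F 0 (p * n) := by
  induction n with
  | zero => exact 𝔞.mem_F_zero _
  | succ n ih => exact 𝔞.star_mem ih hx

theorem rightPow_one (x : A 0) : 𝔞.rightPow x 1 = x := 𝔞.one_star x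

theorem foldl_star_mem {p : ℕ} {u : ℕ → A 0} {l : List ℕ} (hu : ∀ i ∈ l, u i ∈ 𝔞.F 0 (p * i))
    {q : ℕ} {y : A 0} (hy : y ∈ 𝔞.F 0 (p * q)) :
    l.foldl (fun y i => 𝔞.star y (u i)) y ∈ 𝔞.F 0 (p * (q + l.sum)) := by
  induction l generalizing q y with
  | nil => simpa using hy
  | cons i l ih =>
    rw [List.foldl_cons, List.sum_cons, ← add_assoc]
    refine ih (fun j hj => hu j (List.mem_cons_of_mem _ hj)) ?_
    rw [mul_add]
    exact 𝔞.star_mem hy (hu i (by simp))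

theorem mem_of_mem_mul {p n : ℕ} {a : A 0} (ha : a ∈ 𝔞.F 0 (p * n)) (hn : n ≠ 0) : a ∈ 𝔞.F 0 p :=
  𝔞.F_antitone 0 (Nat.le_mul_of_pos_right p (Nat.pos_of_ne_zero hn)) ha

theorem F_le_one {p : ℕ} (hp : 1 ≤ p) {a : A 0} (ha : a ∈ 𝔞.F 0 p) : a ∈ 𝔞.F 0 1 :=
  𝔞.F_antitone 0 hp ha

theorem isSeriesSum_of_mem {u : ℕ → A 0} (hu : ∀ n, u n ∈ 𝔞.F 0 n) :
    IsSeriesSum (𝔞.F 0) u (seriesSum (𝔞.F 0) u) :=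
  isSeriesSum_seriesSum (𝔞.F_antitone 0) (𝔞.complete 0).2 hu

theorem seriesSum_sub_mem {u : ℕ → A 0} (hu : ∀ n, u n ∈ 𝔞.F 0 n) (N : ℕ) :
    seriesSum (𝔞.F 0) u - ∑ i ∈ Finset.range N, u i ∈ 𝔞.F 0 N :=
  (𝔞.isSeriesSum_of_mem hu).sub_mem (𝔞.F_antitone 0) hu N

/-- The remainder after `p` terms lies in `F p`, and so does the partial sum. -/
theorem seriesSum_mem {u : ℕ → A 0} (hu : ∀ n, u n ∈ 𝔞.F 0 n) {p : ℕ} (hp : ∀ n, u n ∈ 𝔞.F 0 p) :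
    seriesSum (𝔞.F 0) u ∈ 𝔞.F 0 p :=
  (Submodule.sub_mem_iff_left _ (Submodule.sum_mem _ fun i _ => hp i)).1 (𝔞.seriesSum_sub_mem hu p)

variable [Algebra ℚ k]

theorem bchTerm_mem {x y : A 0} {p : ℕ} (hx : x ∈ 𝔞.F 0 p) (hy : y ∈ 𝔞.F 0 p) (n : ℕ) :
    bchTerm k 𝔞.bracket x y n ∈ 𝔞.F 0 (p * n) := by
  refine Submodule.sum_mem _ fun j hj => Submodule.sum_mem _ fun c hc =>
    Submodule.smul_mem _ _ ?_
  have h : (List.ofFn fun i => pairWord x y (c i)).flatten.length = n := by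
    rw [length_flatten_pairWord, (Finset.mem_filter.1 hc).2.2]
  conv => arg 1; rw [← h]
  refine 𝔞.nestedBracket_mem ?_ ?_
  · rw [← List.length_pos_iff, h]
    have := Finset.mem_Icc.1 hj
    omega
  · intro a ha
    simp only [List.mem_flatten, List.mem_ofFn] at ha
    obtain ⟨l, ⟨i, rfl⟩, ha⟩ := ha
    simp only [pairWord, List.mem_append, List.mem_replicate] at ha
    rcases ha with ⟨_, rfl⟩ | ⟨_, rfl⟩ <;> assumption

theorem magnusTerm_succ (x : A 0) (n : ℕ) :
    𝔞.magnusTerm x (n + 1) = ∑ c : Composition n,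
      algebraMap ℚ k (bernoulli c.length / (c.length.factorial : ℚ)) •
        c.blocks.foldl (fun y i => 𝔞.star y (𝔞.magnusTerm x i)) x := by
  rw [magnusTerm]
  refine Finset.sum_congr rfl fun c _ => ?_
  congr 1
  exact List.foldl_attach (l := c.blocks) (f := fun y i => 𝔞.star y (𝔞.magnusTerm x i)) (b := x)

/-- The case `p = 1` gives convergence; general `p` shows that the logarithm maps `1 + F p` into `F
p`. -/
theorem magnusTerm_mem {x : A 0} {p : ℕ} (hx : x ∈ 𝔞.F 0 p) (n : ℕ) :
    𝔞.magnusTerm x n ∈ 𝔞.F 0 (p * n) := by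
  induction n using Nat.strong_induction_on with
  | _ n ih =>
    rcases n with _ | n
    · exact 𝔞.mem_F_zero _
    · rw [magnusTerm_succ]
      refine Submodule.sum_mem _ fun c _ => Submodule.smul_mem _ _ ?_
      have h := 𝔞.foldl_star_mem (p := p) (u := 𝔞.magnusTerm x) (l := c.blocks)
        (fun i hi => ih i (Nat.lt_succ_of_le (c.blocks_le hi))) (q := 1) (y := x) (by simpa using hx)
      rwa [c.blocks_sum, add_comm] at h

theorem expTerm_mem {x : A 0} (hx : x ∈ 𝔞.F 0 1) (n : ℕ) : 𝔞.expTerm x n ∈ 𝔞.F 0 n := by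
  have := 𝔞.rightPow_mem hx n
  rw [_root_.one_mul] at this
  exact Submodule.smul_mem _ _ this

theorem magnusTerm_mem' {x : A 0} (hx : x ∈ 𝔞.F 0 1) (n : ℕ) : 𝔞.magnusTerm x n ∈ 𝔞.F 0 n := by
  simpa using 𝔞.magnusTerm_mem hx n

theorem bchTerm_mem' {x y : A 0} (hx : x ∈ 𝔞.F 0 1) (hy : y ∈ 𝔞.F 0 1) (n : ℕ) :
    bchTerm k 𝔞.bracket x y n ∈ 𝔞.F 0 n := by
  simpa using 𝔞.bchTerm_mem hx hy n

theorem bch_mem {x y : A 0} {p : ℕ} (hp : 1 ≤ p) (hx : x ∈ 𝔞.F 0 p) (hy : y ∈ 𝔞.F 0 p) :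
    𝔞.bch x y ∈ 𝔞.F 0 p := by
  refine 𝔞.seriesSum_mem (𝔞.bchTerm_mem' (𝔞.F_le_one hp hx) (𝔞.F_le_one hp hy)) fun n => ?_
  rcases n with _ | n
  · simp [bchTerm]
  · exact 𝔞.mem_of_mem_mul (𝔞.bchTerm_mem hx hy (n + 1)) n.succ_ne_zero

theorem log_mem {g : A 0} {p : ℕ} (hp : 1 ≤ p) (hg : g - 𝔞.one ∈ 𝔞.F 0 p) :
    𝔞.log g ∈ 𝔞.F 0 p := by
  refine 𝔞.seriesSum_mem (𝔞.magnusTerm_mem' (𝔞.F_le_one hp hg)) fun n => ?_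
  rcases n with _ | n
  · simp [magnusTerm]
  · exact 𝔞.mem_of_mem_mul (𝔞.magnusTerm_mem hg (n + 1)) n.succ_ne_zero

theorem exp_sub_one_mem {x : A 0} {p : ℕ} (hp : 1 ≤ p) (hx : x ∈ 𝔞.F 0 p) :
    𝔞.exp x - 𝔞.one ∈ 𝔞.F 0 p := by
  have h := 𝔞.seriesSum_sub_mem (𝔞.expTerm_mem (𝔞.F_le_one hp hx)) p
  obtain ⟨p, rfl⟩ := Nat.exists_eq_add_of_le' hp
  rw [Finset.sum_range_succ'] at h
  have h0 : 𝔞.expTerm x 0 = 𝔞.one := by simp [expTerm, rightPow]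
  rw [h0, ← sub_sub, sub_right_comm] at h
  refine (Submodule.sub_mem_iff_left _ (Submodule.sum_mem _ fun n _ => ?_)).1 h
  exact Submodule.smul_mem _ _ (𝔞.mem_of_mem_mul (𝔞.rightPow_mem hx (n + 1)) n.succ_ne_zero)

section Rational

variable [Module ℚ (A 0)] [IsScalarTower ℚ k (A 0)]

theorem expTerm_eq (x : A 0) (n : ℕ) :
    𝔞.expTerm x n = (n.factorial : ℚ)⁻¹ • 𝔞.rightPow x n := by
  rw [expTerm, algebraMap_smul, one_div]

/-- The filtration of the component of degree zero, over the rational numbers. -/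
def ratF (n : ℕ) : Submodule ℚ (A 0) := (𝔞.F 0 n).restrictScalars ℚ

theorem mem_ratF {n : ℕ} {a : A 0} : a ∈ 𝔞.ratF n ↔ a ∈ 𝔞.F 0 n := Iff.rfl

theorem ratF_antitone : Antitone 𝔞.ratF := fun _ _ h _ ha => 𝔞.F_antitone 0 h ha

theorem ratF_zero : 𝔞.ratF 0 = ⊤ := by
  ext a
  simp [mem_ratF, 𝔞.F_zero]

omit [Algebra ℚ k] [IsScalarTower ℚ k (A 0)] in
theorem rat_smul_star (c : ℚ) (a b : A 0) : 𝔞.star (c • a) b = c • 𝔞.star a b :=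
  map_rat_smul ((𝔞.mul (add_zero 0)).flip b) c a

omit [Algebra ℚ k] [IsScalarTower ℚ k (A 0)] in
theorem star_rat_smul (c : ℚ) (a b : A 0) : 𝔞.star a (c • b) = c • 𝔞.star a b :=
  map_rat_smul (𝔞.mul (add_zero 0) a) c b

omit [Algebra ℚ k] [IsScalarTower ℚ k (A 0)] in
/-- The product of the component of degree zero, over the rational numbers. -/
def ratMul : A 0 →ₗ[ℚ] A 0 →ₗ[ℚ] A 0 :=
  LinearMap.mk₂ ℚ 𝔞.star (fun a b c => by simp [star]) 𝔞.rat_smul_star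
    (fun a b c => by simp [star]) 𝔞.star_rat_smul

omit [Algebra ℚ k] [IsScalarTower ℚ k (A 0)] in
theorem ratMul_apply (a b : A 0) : 𝔞.ratMul a b = 𝔞.star a b := rfl

omit [Algebra ℚ k] [IsScalarTower ℚ k (A 0)] in
/-- Right multiplication as an operator. -/
def rightMul (y : A 0) : Module.End ℚ (A 0) := 𝔞.ratMul.flip y

omit [Algebra ℚ k] [IsScalarTower ℚ k (A 0)] in
theorem rightMul_apply (y a : A 0) : 𝔞.rightMul y a = 𝔞.star a y := rfl

omit [Algebra ℚ k] [IsScalarTower ℚ k (A 0)] in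
theorem rightPow_eq (x : A 0) (n : ℕ) : 𝔞.rightPow x n = (𝔞.rightMul x ^ n) 𝔞.one := by
  induction n with
  | zero => rfl
  | succ n ih => rw [rightPow, ih, pow_succ', Module.End.mul_apply, rightMul_apply]

omit [Algebra ℚ k] [IsScalarTower ℚ k (A 0)] in
theorem brace_eq_listBrace (a : A 0) {n : ℕ} (v : Fin n → A 0) :
    𝔞.brace n a v = listBrace 𝔞.ratMul a (List.ofFn v).reverse := by
  induction n with
  | zero => simp [brace, listBrace_nil]
  | succ n ih =>
    have h : (List.ofFn v).reverse = v (Fin.last n) :: (List.ofFn (Fin.init v)).reverse := by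
      rw [List.ofFn_succ', List.concat_eq_append, List.reverse_append]
      rfl
    rw [h, listBrace_cons, brace, ih, ratMul_apply, listDer_ofFn_reverse]
    congr 1
    exact Finset.sum_congr rfl fun i _ => ih _

omit [Algebra ℚ k] [IsScalarTower ℚ k (A 0)] in
theorem brace_const (a b : A 0) (n : ℕ) :
    (𝔞.brace n a fun _ => b) = listBrace 𝔞.ratMul a (List.replicate n b) := by
  rw [brace_eq_listBrace, List.ofFn_const, List.reverse_replicate]

theorem ratMul_mem {p q : ℕ} {a b : A 0} (ha : a ∈ 𝔞.ratF p) (hb : b ∈ 𝔞.ratF q) :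
    𝔞.ratMul a b ∈ 𝔞.ratF (p + q) := 𝔞.star_mem ha hb

theorem circTerm_eq (a b : A 0) (n : ℕ) :
    𝔞.circTerm a b n = (n.factorial : ℚ)⁻¹ • listBrace 𝔞.ratMul a (List.replicate n b) := by
  rw [circTerm, algebraMap_smul, one_div, brace_const]

theorem circTerm_mem (a : A 0) {b : A 0} (hb : b ∈ 𝔞.F 0 1) (n : ℕ) :
    𝔞.circTerm a b n ∈ 𝔞.F 0 n := by
  rw [circTerm_eq]
  refine Submodule.smul_mem (𝔞.ratF n) _ ?_
  have := listBrace_mem 𝔞.ratMul 𝔞.ratF 𝔞.ratMul_mem (p := 0) (a := a) (𝔞.mem_F_zero a)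
    (l := List.replicate n b) (w := List.replicate n 1)
    (by rw [List.forall₂_iff_get]; simp [mem_ratF, hb])
  simpa using this

theorem exp_sub_mem {x : A 0} (hx : x ∈ 𝔞.F 0 1) (N : ℕ) :
    𝔞.exp x - ∑ n ∈ Finset.range N, (n.factorial : ℚ)⁻¹ • (𝔞.rightMul x ^ n) 𝔞.one ∈ 𝔞.ratF N := by
  have h := 𝔞.seriesSum_sub_mem (𝔞.expTerm_mem hx) N
  simp only [expTerm_eq, rightPow_eq] at h
  exact h

/-- The circle product with an exponential is the exponential of a right multiplication. -/
theorem circ_exp_sub_mem (a : A 0) {x : A 0} (hx : x ∈ 𝔞.F 0 1) (N : ℕ) :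
    𝔞.circ a (𝔞.exp x) - ∑ n ∈ Finset.range N, (n.factorial : ℚ)⁻¹ • (𝔞.rightMul x ^ n) a ∈
      𝔞.ratF N := by
  set u : ℕ → A 0 := fun n => (n.factorial : ℚ)⁻¹ • 𝔞.rightPow x n with hu
  have hmem : ∀ n, u n ∈ 𝔞.ratF n := fun n => by
    have h := 𝔞.expTerm_mem hx n
    rw [expTerm_eq] at h
    exact h
  have h1 := sum_listBrace_expPath (m := 𝔞.ratMul) 𝔞.star_right_symm 𝔞.ratF_antitone 𝔞.ratF_zero
    𝔞.ratMul_mem (a := a) (x := x) hx (u := u) (by simp [hu, rightPow_one]) (fun n _ => by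
      simp only [hu, map_smul, LinearMap.smul_apply]
      rw [smul_smul, ratMul_apply, rightPow, Nat.factorial_succ]
      congr 1
      push_cast
      field_simp) hmem N
  have h2 := 𝔞.seriesSum_sub_mem (𝔞.circTerm_mem a (𝔞.exp_sub_one_mem le_rfl hx)) N
  rw [← circ] at h2
  simp only [circTerm_eq] at h2
  have h3 : 𝔞.exp x - 𝔞.one - ∑ i ∈ Finset.Ico 1 N, u i ∈ 𝔞.ratF N := by
    rcases Nat.eq_zero_or_pos N with rfl | hN
    · exact 𝔞.mem_F_zero _
    · have h := 𝔞.seriesSum_sub_mem (𝔞.expTerm_mem hx) N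
      simp only [expTerm_eq] at h
      rw [Finset.range_eq_Ico, Finset.sum_eq_sum_Ico_succ_bot hN, ← sub_sub] at h
      simp only [Nat.factorial_zero, Nat.cast_one, inv_one, one_smul, rightPow, _root_.zero_add] at h
      exact h
  -- Braces respect congruence modulo `F N`, so `e^x - 1` may be replaced by its truncation.
  have h4 : ∀ n, listBrace 𝔞.ratMul a (List.replicate n (𝔞.exp x - 𝔞.one)) -
      listBrace 𝔞.ratMul a (List.replicate n (∑ i ∈ Finset.Ico 1 N, u i)) ∈ 𝔞.ratF N := by
    intro n
    refine listBrace_rel 𝔞.ratMul 𝔞.ratMul (fun x y => x - y ∈ 𝔞.ratF N) (by simp) ?_ ?_ ?_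
      (by simp) ?_
    · intro x x' y y' h h'
      rw [add_sub_add_comm]
      exact Submodule.add_mem _ h h'
    · intro x x' y y' h h'
      rw [sub_sub_sub_comm]
      exact Submodule.sub_mem _ h h'
    · intro x x' y y' h h'
      have e1 := 𝔞.ratMul_mem h (𝔞.mem_F_zero y)
      have e2 := 𝔞.ratMul_mem (𝔞.mem_F_zero x') h'
      rw [zero_add] at e2
      have e3 := Submodule.add_mem _ e1 e2
      rwa [map_sub, LinearMap.sub_apply, map_sub, sub_add_sub_cancel] at e3
    · rw [List.forall₂_iff_get]
      simpa using fun _ _ => h3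
  have h5 := Submodule.sum_mem (𝔞.ratF N) fun n (_ : n ∈ Finset.range N) =>
    Submodule.smul_mem (𝔞.ratF N) (n.factorial : ℚ)⁻¹ (h4 n)
  simp only [smul_sub] at h5
  rw [Finset.sum_sub_distrib] at h5
  have h6 := Submodule.add_mem (𝔞.ratF N) (Submodule.add_mem (𝔞.ratF N) h2 h5) h1
  rwa [sub_add_sub_cancel, sub_add_sub_cancel] at h6

end Rational

end CompletePreLieAlgebra

/-! ### Right multiplications modulo the terms of the filtration -/

namespace CompletePreLieAlgebra

variable {k : Type*} [CommRing k] {A : ℤ → Type*} [∀ i, AddCommGroup (A i)]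
  [∀ i, Module k (A i)] (𝔞 : CompletePreLieAlgebra k A) [Algebra ℚ k]

section Rational

variable [Module ℚ (A 0)] [IsScalarTower ℚ k (A 0)]

theorem rightMul_mem {q p : ℕ} {y a : A 0} (hy : y ∈ 𝔞.F 0 p) (ha : a ∈ 𝔞.ratF q) :
    𝔞.rightMul y a ∈ 𝔞.ratF (q + p) := 𝔞.star_mem ha hy

/-- Right multiplication as an operator modulo the `N`-th term of the filtration. -/
def rightMulQuot (N : ℕ) (y : A 0) : Module.End ℚ (A 0 ⧸ 𝔞.ratF N) :=
  (𝔞.ratF N).mapQ (𝔞.ratF N) (𝔞.rightMul y) fun _ ha =>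
    𝔞.rightMul_mem (𝔞.mem_F_zero y) ha

theorem rightMulQuot_mk (N : ℕ) (y a : A 0) :
    𝔞.rightMulQuot N y ((𝔞.ratF N).mkQ a) = (𝔞.ratF N).mkQ (𝔞.star a y) := rfl

theorem rightMulQuot_pow_mk (N : ℕ) (y a : A 0) (n : ℕ) :
    (𝔞.rightMulQuot N y ^ n) ((𝔞.ratF N).mkQ a) = (𝔞.ratF N).mkQ ((𝔞.rightMul y ^ n) a) := by
  induction n with
  | zero => rfl
  | succ n ih => rw [pow_succ', pow_succ', Module.End.mul_apply, ih]; rfl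

theorem mkQ_eq_mkQ {N : ℕ} {a b : A 0} :
    (𝔞.ratF N).mkQ a = (𝔞.ratF N).mkQ b ↔ a - b ∈ 𝔞.F 0 N :=
  Submodule.Quotient.eq _

theorem eq_of_forall_mkQ_eq {a b : A 0} (h : ∀ N, (𝔞.ratF N).mkQ a = (𝔞.ratF N).mkQ b) : a = b :=
  𝔞.eq_of_forall_sub_mem fun N => 𝔞.mkQ_eq_mkQ.1 (h N)

/-- The induced filtration modulo the `N`-th term of the filtration. -/
def quotF (N p : ℕ) : Submodule ℚ (A 0 ⧸ 𝔞.ratF N) := (𝔞.ratF p).map (𝔞.ratF N).mkQ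

theorem quotF_antitone (N : ℕ) : Antitone (𝔞.quotF N) :=
  fun _ _ h => Submodule.map_mono (𝔞.ratF_antitone h)

theorem quotF_zero (N : ℕ) : 𝔞.quotF N 0 = ⊤ := by
  rw [quotF, ratF_zero, Submodule.map_top, Submodule.range_mkQ]

theorem quotF_self (N : ℕ) : 𝔞.quotF N N = ⊥ := Submodule.mkQ_map_self _

theorem rightMulQuot_mem (N : ℕ) {y : A 0} (hy : y ∈ 𝔞.F 0 1) (q : ℕ) (m : A 0 ⧸ 𝔞.ratF N)
    (hm : m ∈ 𝔞.quotF N q) : 𝔞.rightMulQuot N y m ∈ 𝔞.quotF N (q + 1) := by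
  obtain ⟨a, ha, rfl⟩ := hm
  exact ⟨_, 𝔞.rightMul_mem hy ha, rfl⟩

theorem rightMulQuot_pow_eq_zero (N : ℕ) {y : A 0} (hy : y ∈ 𝔞.F 0 1) :
    𝔞.rightMulQuot N y ^ N = 0 :=
  isNilpotent_of_raising (𝔞.quotF_zero N) (𝔞.quotF_self N) (𝔞.rightMulQuot_mem N hy)

theorem isNilpotent_rightMulQuot (N : ℕ) {y : A 0} (hy : y ∈ 𝔞.F 0 1) :
    IsNilpotent (𝔞.rightMulQuot N y) := ⟨N, 𝔞.rightMulQuot_pow_eq_zero N hy⟩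

theorem exp_rightMulQuot_mk (N : ℕ) {y : A 0} (hy : y ∈ 𝔞.F 0 1) (a : A 0) :
    IsNilpotent.exp (𝔞.rightMulQuot N y) ((𝔞.ratF N).mkQ a) =
      (𝔞.ratF N).mkQ (∑ n ∈ Finset.range N, (n.factorial : ℚ)⁻¹ • (𝔞.rightMul y ^ n) a) := by
  rw [IsNilpotent.exp_eq_sum (𝔞.rightMulQuot_pow_eq_zero N hy), LinearMap.sum_apply, map_sum]
  refine Finset.sum_congr rfl fun n _ => ?_
  rw [LinearMap.smul_apply, rightMulQuot_pow_mk, map_smul]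

/-- Properties of the circle product thereby reduce to identities between exponentials of nilpotent
operators. -/
theorem mkQ_circ_exp (N : ℕ) (a : A 0) {x : A 0} (hx : x ∈ 𝔞.F 0 1) :
    (𝔞.ratF N).mkQ (𝔞.circ a (𝔞.exp x)) =
      IsNilpotent.exp (𝔞.rightMulQuot N x) ((𝔞.ratF N).mkQ a) := by
  rw [exp_rightMulQuot_mk 𝔞 N hx, mkQ_eq_mkQ]
  exact 𝔞.circ_exp_sub_mem a hx N

theorem mkQ_exp (N : ℕ) {x : A 0} (hx : x ∈ 𝔞.F 0 1) :
    (𝔞.ratF N).mkQ (𝔞.exp x) =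
      IsNilpotent.exp (𝔞.rightMulQuot N x) ((𝔞.ratF N).mkQ 𝔞.one) := by
  rw [exp_rightMulQuot_mk 𝔞 N hx, mkQ_eq_mkQ]
  exact 𝔞.exp_sub_mem hx N

theorem one_circ_exp {x : A 0} (hx : x ∈ 𝔞.F 0 1) : 𝔞.circ 𝔞.one (𝔞.exp x) = 𝔞.exp x :=
  𝔞.eq_of_forall_mkQ_eq fun N => by rw [mkQ_circ_exp 𝔞 N _ hx, mkQ_exp 𝔞 N hx]

theorem circ_exp_add (a b : A 0) {x : A 0} (hx : x ∈ 𝔞.F 0 1) :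
    𝔞.circ (a + b) (𝔞.exp x) = 𝔞.circ a (𝔞.exp x) + 𝔞.circ b (𝔞.exp x) :=
  𝔞.eq_of_forall_mkQ_eq fun N => by
    rw [map_add, mkQ_circ_exp 𝔞 N _ hx, mkQ_circ_exp 𝔞 N _ hx, mkQ_circ_exp 𝔞 N _ hx, map_add,
      map_add]

theorem circ_exp_sub (a b : A 0) {x : A 0} (hx : x ∈ 𝔞.F 0 1) :
    𝔞.circ (a - b) (𝔞.exp x) = 𝔞.circ a (𝔞.exp x) - 𝔞.circ b (𝔞.exp x) := by
  rw [eq_sub_iff_add_eq, ← circ_exp_add 𝔞 _ _ hx, sub_add_cancel]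

theorem circ_exp_neg (a : A 0) {x : A 0} (hx : x ∈ 𝔞.F 0 1) :
    𝔞.circ (𝔞.circ a (𝔞.exp x)) (𝔞.exp (-x)) = a := by
  refine 𝔞.eq_of_forall_mkQ_eq fun N => ?_
  have h : 𝔞.rightMulQuot N (-x) = -𝔞.rightMulQuot N x := by
    refine LinearMap.ext fun m => ?_
    obtain ⟨a, rfl⟩ := (𝔞.ratF N).mkQ_surjective m
    rw [LinearMap.neg_apply, rightMulQuot_mk, rightMulQuot_mk, ← map_neg]
    simp [star]
  rw [mkQ_circ_exp 𝔞 N _ (Submodule.neg_mem _ hx), mkQ_circ_exp 𝔞 N _ hx, h,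
    ← Module.End.mul_apply, IsNilpotent.exp_neg_mul_exp_self (𝔞.isNilpotent_rightMulQuot N hx),
    Module.End.one_apply]

/-- The circle product with `e ^ x` is congruent to the identity to the order of `x`. -/
theorem circ_exp_sub_self_mem {p q : ℕ} {a x : A 0} (hp : 1 ≤ p) (hx : x ∈ 𝔞.F 0 p)
    (ha : a ∈ 𝔞.F 0 q) : 𝔞.circ a (𝔞.exp x) - a ∈ 𝔞.F 0 (q + p) := by
  have h := 𝔞.circ_exp_sub_mem a (𝔞.F_le_one hp hx) (q + p)
  obtain ⟨p, rfl⟩ := Nat.exists_eq_add_of_le' hp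
  rw [← _root_.add_assoc, Finset.sum_range_succ', ← sub_sub, sub_right_comm] at h
  have hpow : ∀ n, (𝔞.rightMul x ^ n) a ∈ 𝔞.ratF (q + (p + 1) * n) := by
    intro n
    induction n with
    | zero => exact ha
    | succ n ih =>
      rw [pow_succ', Module.End.mul_apply, mul_add, mul_one, ← _root_.add_assoc]
      exact 𝔞.rightMul_mem hx ih
  have h' := (Submodule.sub_mem_iff_left _ (Submodule.sum_mem _ fun n _ => ?_)).1 h
  · have h'' : 𝔞.circ a (𝔞.exp x) - a ∈ 𝔞.ratF (q + p + 1) := by simpa using h'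
    exact h''
  · refine Submodule.smul_mem _ _ (𝔞.ratF_antitone ?_ (hpow (n + 1)))
    rw [_root_.add_assoc]
    exact Nat.add_le_add_left (Nat.le_mul_of_pos_right _ n.succ_pos) q

/-- The Lie homomorphism `z ↦ (a ↦ -a ⋆ z)` modulo the `N`-th term of the filtration. -/
def negRightMulQuot (N : ℕ) : A 0 →ₗ[ℚ] Module.End ℚ (A 0 ⧸ 𝔞.ratF N) where
  toFun z := -𝔞.rightMulQuot N z
  map_add' y z := by
    refine LinearMap.ext fun m => ?_
    obtain ⟨a, rfl⟩ := (𝔞.ratF N).mkQ_surjective m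
    simp only [LinearMap.neg_apply, LinearMap.add_apply, rightMulQuot_mk]
    rw [← map_neg, ← map_neg, ← map_neg, ← map_add]
    congr 1
    simp [star]
    abel
  map_smul' c z := by
    refine LinearMap.ext fun m => ?_
    obtain ⟨a, rfl⟩ := (𝔞.ratF N).mkQ_surjective m
    simp only [LinearMap.neg_apply, LinearMap.smul_apply, rightMulQuot_mk, RingHom.id_apply]
    rw [star_rat_smul, map_smul, smul_neg]

theorem negRightMulQuot_apply (N : ℕ) (z : A 0) :
    𝔞.negRightMulQuot N z = -𝔞.rightMulQuot N z := rfl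

/-- This is the pre-Lie identity; the sign is needed because composing right multiplications
reverses their order. -/
theorem negRightMulQuot_bracket (N : ℕ) (y z : A 0) :
    𝔞.negRightMulQuot N (𝔞.bracket y z) =
      𝔞.negRightMulQuot N y * 𝔞.negRightMulQuot N z -
        𝔞.negRightMulQuot N z * 𝔞.negRightMulQuot N y := by
  simp only [negRightMulQuot_apply]
  refine LinearMap.ext fun m => ?_
  obtain ⟨a, rfl⟩ := (𝔞.ratF N).mkQ_surjective m
  have hl (w b : A 0) : (-𝔞.rightMulQuot N w) ((𝔞.ratF N).mkQ b) =
      (𝔞.ratF N).mkQ (-𝔞.star b w) := by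
    rw [LinearMap.neg_apply, rightMulQuot_mk, map_neg]
  have hs (b c : A 0) : 𝔞.star (-b) c = -𝔞.star b c := by simp [star]
  rw [hl, LinearMap.sub_apply, Module.End.mul_apply, Module.End.mul_apply, hl, hl, hl, hl,
    ← map_sub, hs, hs, neg_neg, neg_neg]
  congr 1
  have h := 𝔞.star_right_symm a y z
  have h2 : 𝔞.star a (𝔞.bracket y z) = 𝔞.star a (𝔞.star y z) - 𝔞.star a (𝔞.star z y) := by
    simp [bracket, star]
  rw [h2]
  linear_combination (norm := abel) h

theorem negRightMulQuot_eq_zero (N : ℕ) {z : A 0} (hz : z ∈ 𝔞.F 0 N) :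
    𝔞.negRightMulQuot N z = 0 := by
  refine LinearMap.ext fun m => ?_
  obtain ⟨a, rfl⟩ := (𝔞.ratF N).mkQ_surjective m
  rw [negRightMulQuot_apply, LinearMap.neg_apply, rightMulQuot_mk, LinearMap.zero_apply,
    neg_eq_zero]
  have := 𝔞.star_mem (𝔞.mem_F_zero a) hz
  rw [_root_.zero_add] at this
  exact (Submodule.Quotient.mk_eq_zero _).2 this

theorem exp_negRightMulQuot_bch (N : ℕ) {x y : A 0} (hx : x ∈ 𝔞.F 0 1) (hy : y ∈ 𝔞.F 0 1) :
    IsNilpotent.exp (𝔞.negRightMulQuot N x) * IsNilpotent.exp (𝔞.negRightMulQuot N y) =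
      IsNilpotent.exp (𝔞.negRightMulQuot N (𝔞.bch x y)) := by
  rw [exp_mul_exp_of_raising (𝔞.quotF_antitone N) (𝔞.quotF_zero N) (𝔞.quotF_self N)
    (fun q m hm => Submodule.neg_mem _ (𝔞.rightMulQuot_mem N hx q m hm))
    (fun q m hm => Submodule.neg_mem _ (𝔞.rightMulQuot_mem N hy q m hm))]
  congr 1
  have h := 𝔞.negRightMulQuot_eq_zero N (𝔞.seriesSum_sub_mem (𝔞.bchTerm_mem' hx hy) N)
  rw [map_sub, sub_eq_zero, map_sum] at h
  rw [bch, h]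
  refine Finset.sum_congr rfl fun n _ => ?_
  rw [bchTerm_eq_rat (k := k)]
  exact (map_bchTerm (𝔞.negRightMulQuot N) (br := 𝔞.bracket) (br' := fun a b => a * b - b * a)
    (𝔞.negRightMulQuot_bracket N) x y n).symm

/-- The circle product with `e ^ x` and then with `e ^ y` is the circle product with
`e ^ BCH(x, y)`. -/
theorem circ_exp_circ_exp (a : A 0) {x y : A 0} (hx : x ∈ 𝔞.F 0 1) (hy : y ∈ 𝔞.F 0 1) :
    𝔞.circ (𝔞.circ a (𝔞.exp x)) (𝔞.exp y) = 𝔞.circ a (𝔞.exp (𝔞.bch x y)) := by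
  have hb := 𝔞.bch_mem le_rfl hx hy
  refine 𝔞.eq_of_forall_mkQ_eq fun N => ?_
  have nx := 𝔞.isNilpotent_rightMulQuot N hx
  have ny := 𝔞.isNilpotent_rightMulQuot N hy
  have nb := 𝔞.isNilpotent_rightMulQuot N hb
  rw [mkQ_circ_exp 𝔞 N _ hy, mkQ_circ_exp 𝔞 N _ hx, mkQ_circ_exp 𝔞 N _ hb,
    ← Module.End.mul_apply]
  congr 1
  have h := 𝔞.exp_negRightMulQuot_bch N hx hy
  simp only [negRightMulQuot_apply] at h
  -- The identity for the negated operators is inverted, which also restores the order of the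
  -- factors.
  calc IsNilpotent.exp (𝔞.rightMulQuot N y) * IsNilpotent.exp (𝔞.rightMulQuot N x)
      = IsNilpotent.exp (𝔞.rightMulQuot N y) * IsNilpotent.exp (𝔞.rightMulQuot N x) *
        (IsNilpotent.exp (-𝔞.rightMulQuot N (𝔞.bch x y)) *
          IsNilpotent.exp (𝔞.rightMulQuot N (𝔞.bch x y))) := by
        rw [IsNilpotent.exp_neg_mul_exp_self nb, mul_one]
    _ = IsNilpotent.exp (𝔞.rightMulQuot N y) * (IsNilpotent.exp (𝔞.rightMulQuot N x) *
        IsNilpotent.exp (-𝔞.rightMulQuot N x)) * IsNilpotent.exp (-𝔞.rightMulQuot N y) *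
          IsNilpotent.exp (𝔞.rightMulQuot N (𝔞.bch x y)) := by
        rw [← h]
        simp only [mul_assoc]
    _ = _ := by
      rw [IsNilpotent.exp_mul_exp_neg_self nx, mul_one, IsNilpotent.exp_mul_exp_neg_self ny,
        _root_.one_mul]

/-! ### The pre-Lie exponential and the pre-Lie logarithm -/

omit [Algebra ℚ k] [Module ℚ (A 0)] [IsScalarTower ℚ k (A 0)] in
theorem rightPow_sub_mem {x y : A 0} (hx : x ∈ 𝔞.F 0 1) (hy : y ∈ 𝔞.F 0 1) {p : ℕ}
    (h : x - y ∈ 𝔞.F 0 p) (n : ℕ) :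
    𝔞.rightPow x (n + 1) - 𝔞.rightPow y (n + 1) ∈ 𝔞.F 0 (p + n) := by
  induction n with
  | zero => simpa [rightPow_one] using h
  | succ n ih =>
    have h1 := 𝔞.star_mem ih hx
    have h2 := 𝔞.star_mem (𝔞.rightPow_mem hy (n + 1)) h
    rw [_root_.one_mul, add_comm] at h2
    have h3 : 𝔞.rightPow x (n + 1 + 1) - 𝔞.rightPow y (n + 1 + 1) =
        𝔞.star (𝔞.rightPow x (n + 1) - 𝔞.rightPow y (n + 1)) x +
          𝔞.star (𝔞.rightPow y (n + 1)) (x - y) := by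
      rw [rightPow.eq_2 𝔞 x (n + 1), rightPow.eq_2 𝔞 y (n + 1)]
      simp [star]
    rw [h3]
    exact Submodule.add_mem _ h1 h2

omit [Module ℚ (A 0)] [IsScalarTower ℚ k (A 0)] in
-- If `x - y ∈ F n` with `n ≥ 1`, the terms of degree at least two in `e^x - e^y` lie in `F (n+1)`,
-- and hence so does the linear term `x - y`.
theorem exp_injOn {x y : A 0} (hx : x ∈ 𝔞.F 0 1) (hy : y ∈ 𝔞.F 0 1) (h : 𝔞.exp x = 𝔞.exp y) :
    x = y := by
  refine 𝔞.eq_of_forall_sub_mem fun n => ?_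
  induction n with
  | zero => exact 𝔞.mem_F_zero _
  | succ n ih =>
    rcases n with _ | n
    · exact Submodule.sub_mem _ hx hy
    have h1 := Submodule.sub_mem _ (𝔞.seriesSum_sub_mem (𝔞.expTerm_mem hx) (n + 2))
      (𝔞.seriesSum_sub_mem (𝔞.expTerm_mem hy) (n + 2))
    rw [← exp, ← exp, h, sub_sub_sub_cancel_left, ← Finset.sum_sub_distrib,
      Finset.sum_range_succ', Finset.sum_range_succ'] at h1
    have h2 : ∑ i ∈ Finset.range n, (𝔞.expTerm y (i + 1 + 1) - 𝔞.expTerm x (i + 1 + 1)) ∈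
        𝔞.F 0 (n + 2) := by
      refine Submodule.sum_mem _ fun i _ => ?_
      rw [expTerm, expTerm, ← smul_sub]
      refine Submodule.smul_mem _ _ (𝔞.F_antitone 0 (show n + 2 ≤ n + 1 + (i + 1) by omega) ?_)
      refine 𝔞.rightPow_sub_mem hy hx ?_ (i + 1)
      rw [← neg_sub]
      exact Submodule.neg_mem _ ih
    have h3 : 𝔞.expTerm y 0 - 𝔞.expTerm x 0 = 0 := by simp [expTerm, rightPow]
    have h4 : 𝔞.expTerm y (0 + 1) - 𝔞.expTerm x (0 + 1) = y - x := by
      simp [expTerm, rightPow_one]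
    rw [h3, h4, _root_.add_zero] at h1
    rw [← neg_sub]
    exact Submodule.neg_mem _ ((Submodule.add_mem_iff_right _ h2).1 h1)

omit [Algebra ℚ k] [IsScalarTower ℚ k (A 0)] in
theorem rightMul_sum_pow_apply {ι : Type*} [DecidableEq ι] (s : Finset ι) (u : ι → A 0) (j : ℕ)
    (y : A 0) : (𝔞.rightMul (∑ i ∈ s, u i) ^ j) y =
      ∑ c ∈ Fintype.piFinset (fun _ : Fin j => s),
        (List.ofFn c).foldl (fun z i => 𝔞.star z (u i)) y := by
  induction j generalizing y with
  | zero => simp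
  | succ j ih =>
    rw [Fin.sum_piFinset_const_succ, pow_succ, Module.End.mul_apply, rightMul_apply]
    have h : 𝔞.star y (∑ i ∈ s, u i) = ∑ i ∈ s, 𝔞.star y (u i) := by simp [star]
    rw [h, map_sum]
    refine Finset.sum_congr rfl fun p _ => ?_
    rw [ih]
    refine Finset.sum_congr rfl fun c _ => ?_
    rw [List.ofFn_succ, List.foldl_cons]
    simp

/-- The fixed point equation satisfied by the Magnus expansion. -/
theorem magnus_fixedPoint {x : A 0} (hx : x ∈ 𝔞.F 0 1) (N : ℕ) :
    ∑ n ∈ Finset.range N, 𝔞.magnusTerm x n -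
      ∑ j ∈ Finset.range N, (bernoulli j / (j.factorial : ℚ)) •
        (𝔞.rightMul (∑ n ∈ Finset.range N, 𝔞.magnusTerm x n) ^ j) x ∈ 𝔞.ratF N := by
  rcases Nat.eq_zero_or_pos N with rfl | hN
  · simp
  obtain ⟨N, rfl⟩ := (⟨N - 1, by omega⟩ : ∃ N', N = N' + 1)
  let g : (Σ n, Composition n) → A 0 := fun c =>
    (bernoulli c.2.length / (c.2.length.factorial : ℚ)) •
      c.2.blocks.foldl (fun y i => 𝔞.star y (𝔞.magnusTerm x i)) x
  have h1 : ∑ n ∈ Finset.range (N + 1), 𝔞.magnusTerm x n =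
      ∑ c ∈ (Finset.range N).sigma fun n => (Finset.univ : Finset (Composition n)), g c := by
    rw [Finset.sum_range_succ', Finset.sum_sigma]
    simp only [magnusTerm_succ, algebraMap_smul, g]
    simp [magnusTerm]
  have h2 : ∑ j ∈ Finset.range (N + 1), (bernoulli j / (j.factorial : ℚ)) •
        (𝔞.rightMul (∑ n ∈ Finset.range (N + 1), 𝔞.magnusTerm x n) ^ j) x =
      -- Tuples of positive block sizes correspond to compositions, by the reindexing used for
      -- composing formal power series; the argument `0` plays no role.
      ∑ c ∈ FormalMultilinearSeries.compPartialSumTarget 0 (N + 1) (N + 1), g c := by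
    have h3 : ∑ n ∈ Finset.range (N + 1), 𝔞.magnusTerm x n =
        ∑ n ∈ Finset.Ico 1 (N + 1), 𝔞.magnusTerm x n := by
      rw [Finset.range_eq_Ico, Finset.sum_eq_sum_Ico_succ_bot (by omega)]
      simp [magnusTerm]
    rw [h3, ← FormalMultilinearSeries.compChangeOfVariables_sum 0 (N + 1) (N + 1)
      (fun c => (bernoulli c.1 / (c.1.factorial : ℚ)) •
        (List.ofFn c.2).foldl (fun y i => 𝔞.star y (𝔞.magnusTerm x i)) x)]
    · rw [FormalMultilinearSeries.compPartialSumSource, Finset.sum_sigma, Finset.range_eq_Ico]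
      refine Finset.sum_congr rfl fun j _ => ?_
      rw [rightMul_sum_pow_apply, Finset.smul_sum]
    · intro c hc
      have hlen := FormalMultilinearSeries.compChangeOfVariables_length 0 (N + 1) (N + 1) hc
      simp only [g, hlen]
      rcases c with ⟨j, f⟩
      rfl
  rw [h2, h1, ← neg_sub]
  refine Submodule.neg_mem _ ?_
  -- The surplus compositions have total size at least `N`; with the initial factor `x` their terms
  -- have degree at least `N + 1`.
  rw [← Finset.sum_sdiff_eq_sub]
  · refine Submodule.sum_mem _ fun c hc => Submodule.smul_mem _ _ ?_
    have h := 𝔞.foldl_star_mem (p := 1) (u := 𝔞.magnusTerm x) (l := c.2.blocks)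
      (fun i _ => 𝔞.magnusTerm_mem hx i) (q := 1) (y := x) (by simpa using hx)
    rw [c.2.blocks_sum, _root_.one_mul] at h
    refine 𝔞.F_antitone 0 ?_ h
    simp only [Finset.mem_sdiff, Finset.mem_sigma, Finset.mem_univ, and_true,
      Finset.mem_range] at hc
    omega
  · intro c hc
    simp only [Finset.mem_sigma, Finset.mem_univ, and_true, Finset.mem_range] at hc
    rw [FormalMultilinearSeries.mem_compPartialSumTarget_iff]
    refine ⟨Nat.zero_le _, ?_, fun i => ?_⟩
    · have := c.2.length_le
      omega
    · have := c.2.blocksFun_le i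
      omega

/-- The fixed point equation reads `z = (R_z/(exp R_z - 1))(x)`; applying the inverse operator gives
`e^z - 1 = x`, because `R_z(1) = z`. -/
theorem exp_log {x : A 0} (hx : x ∈ 𝔞.F 0 1) : 𝔞.exp (𝔞.log (𝔞.one + x)) = 𝔞.one + x := by
  have hg : 𝔞.one + x - 𝔞.one = x := add_sub_cancel_left _ _
  have hz : 𝔞.log (𝔞.one + x) ∈ 𝔞.F 0 1 := 𝔞.log_mem le_rfl (by rwa [hg])
  refine 𝔞.eq_of_forall_mkQ_eq fun N => ?_
  have hlog := 𝔞.seriesSum_sub_mem (𝔞.magnusTerm_mem' hx) N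
  rw [show seriesSum (𝔞.F 0) (𝔞.magnusTerm x) = 𝔞.log (𝔞.one + x) by rw [log, hg]] at hlog
  set z := 𝔞.log (𝔞.one + x) with hzdef
  set w := ∑ n ∈ Finset.range N, 𝔞.magnusTerm x n with hw
  -- Modulo `F N` the partial sum `w` and the full logarithm `z` define the same operator.
  have hT : 𝔞.rightMulQuot N w = 𝔞.rightMulQuot N z := by
    have := 𝔞.negRightMulQuot_eq_zero N hlog
    rw [map_sub, sub_eq_zero, negRightMulQuot_apply, negRightMulQuot_apply, neg_inj] at this
    exact this.symm
  have hN := 𝔞.rightMulQuot_pow_eq_zero N hz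
  have hmk : (𝔞.ratF N).mkQ z =
      nilEval N (𝔞.rightMulQuot N z) (bernoulliPowerSeries ℚ) ((𝔞.ratF N).mkQ x) := by
    rw [𝔞.mkQ_eq_mkQ.2 hlog, 𝔞.mkQ_eq_mkQ.2 (𝔞.magnus_fixedPoint hx N), ← hw, nilEval_eq_sum,
      LinearMap.sum_apply, map_sum]
    refine Finset.sum_congr rfl fun j _ => ?_
    rw [map_smul, LinearMap.smul_apply, ← hT, rightMulQuot_pow_mk]
    simp [bernoulliPowerSeries]
  rw [mkQ_exp 𝔞 N hz, exp_eq_one_add_nilEval_mul hN, LinearMap.add_apply, Module.End.one_apply,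
    Module.End.mul_apply, rightMulQuot_mk, one_star, hmk, ← Module.End.mul_apply, ← nilEval_mul hN,
    expSubOneDivX_mul_bernoulliPowerSeries, nilEval_one hN, Module.End.one_apply, map_add]

theorem log_exp {x : A 0} (hx : x ∈ 𝔞.F 0 1) : 𝔞.log (𝔞.exp x) = x := by
  have h1 := 𝔞.exp_sub_one_mem le_rfl hx
  have h2 : 𝔞.exp x = 𝔞.one + (𝔞.exp x - 𝔞.one) := (add_sub_cancel _ _).symm
  refine 𝔞.exp_injOn (𝔞.log_mem le_rfl h1) hx ?_
  rw [h2, 𝔞.exp_log h1, ← h2]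

end Rational

end CompletePreLieAlgebra

/-! ### The group of group-like elements and the gauge group -/

namespace CompletePreLieAlgebra

variable {k : Type*} [CommRing k] {A : ℤ → Type*} [∀ i, AddCommGroup (A i)]
  [∀ i, Module k (A i)] (𝔞 : CompletePreLieAlgebra k A) [Algebra ℚ k]

section Rational

variable [Module ℚ (A 0)] [IsScalarTower ℚ k (A 0)]

omit [Module ℚ (A 0)] [IsScalarTower ℚ k (A 0)] in
theorem exp_zero : 𝔞.exp 0 = 𝔞.one :=
  𝔞.eq_of_forall_sub_mem fun n => 𝔞.F_antitone 0 n.le_succ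
    (𝔞.exp_sub_one_mem (p := n + 1) (by omega) (Submodule.zero_mem _))

theorem circ_one (a : A 0) : 𝔞.circ a 𝔞.one = a := by
  refine 𝔞.eq_of_forall_sub_mem fun n => 𝔞.F_antitone 0 (show n ≤ 0 + (n + 1) by omega) ?_
  rw [← 𝔞.exp_zero]
  exact 𝔞.circ_exp_sub_self_mem (by omega) (Submodule.zero_mem _) (𝔞.mem_F_zero a)

theorem exp_bch {x y : A 0} (hx : x ∈ 𝔞.F 0 1) (hy : y ∈ 𝔞.F 0 1) :
    𝔞.exp (𝔞.bch x y) = 𝔞.circ (𝔞.exp x) (𝔞.exp y) := by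
  rw [← 𝔞.one_circ_exp (𝔞.bch_mem le_rfl hx hy), ← 𝔞.circ_exp_circ_exp _ hx hy,
    𝔞.one_circ_exp hx]

theorem circ_exp_mem {q : ℕ} {a x : A 0} (hx : x ∈ 𝔞.F 0 1) (ha : a ∈ 𝔞.F 0 q) :
    𝔞.circ a (𝔞.exp x) ∈ 𝔞.F 0 q := by
  rw [← sub_add_cancel (𝔞.circ a (𝔞.exp x)) a]
  exact Submodule.add_mem _
    (𝔞.F_antitone 0 (Nat.le_add_right _ _) (𝔞.circ_exp_sub_self_mem le_rfl hx ha)) ha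

/-- The pre-Lie exponential and the pre-Lie logarithm as a bijection. -/
noncomputable def expEquiv : 𝔞.GaugeElement ≃ 𝔞.GroupLike where
  toFun x := ⟨𝔞.exp x.1, 𝔞.exp_sub_one_mem le_rfl x.2⟩
  invFun g := ⟨𝔞.log g.1, 𝔞.log_mem le_rfl g.2⟩
  left_inv x := Subtype.ext (𝔞.log_exp x.2)
  right_inv g := Subtype.ext (by
    have h := 𝔞.exp_log g.2
    rwa [add_sub_cancel] at h)

theorem exp_log_val (g : 𝔞.GroupLike) : 𝔞.exp (𝔞.log g.1) = g.1 :=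
  congrArg Subtype.val (𝔞.expEquiv.apply_symm_apply g)

omit [Module ℚ (A 0)] [IsScalarTower ℚ k (A 0)] in
theorem log_val_mem (g : 𝔞.GroupLike) : 𝔞.log g.1 ∈ 𝔞.F 0 1 := 𝔞.log_mem le_rfl g.2

/-- Both factors are exponentials of their logarithms, so this is the composition law for
exponentials. -/
theorem circ_circ (a : A 0) (g h : 𝔞.GroupLike) :
    𝔞.circ (𝔞.circ a g.1) h.1 = 𝔞.circ a (𝔞.circ g.1 h.1) := by
  have := 𝔞.circ_exp_circ_exp a (𝔞.log_val_mem g) (𝔞.log_val_mem h)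
  rwa [𝔞.exp_bch (𝔞.log_val_mem g) (𝔞.log_val_mem h), 𝔞.exp_log_val, 𝔞.exp_log_val] at this

theorem circ_sub (a b : A 0) (g : 𝔞.GroupLike) :
    𝔞.circ (a - b) g.1 = 𝔞.circ a g.1 - 𝔞.circ b g.1 := by
  rw [← 𝔞.exp_log_val g, 𝔞.circ_exp_sub _ _ (𝔞.log_val_mem g)]

theorem one_circ (g : 𝔞.GroupLike) : 𝔞.circ 𝔞.one g.1 = g.1 := by
  rw [← 𝔞.exp_log_val g, 𝔞.one_circ_exp (𝔞.log_val_mem g)]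

theorem circ_mem {q : ℕ} {a : A 0} (ha : a ∈ 𝔞.F 0 q) (g : 𝔞.GroupLike) :
    𝔞.circ a g.1 ∈ 𝔞.F 0 q := by
  rw [← 𝔞.exp_log_val g]
  exact 𝔞.circ_exp_mem (𝔞.log_val_mem g) ha

theorem circ_sub_self_mem {p q : ℕ} {a : A 0} (ha : a ∈ 𝔞.F 0 q) (g : 𝔞.GroupLike)
    (hg : g.1 - 𝔞.one ∈ 𝔞.F 0 p) : 𝔞.circ a g.1 - a ∈ 𝔞.F 0 (q + p) := by
  rcases Nat.eq_zero_or_pos p with rfl | hp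
  · exact Submodule.sub_mem _ (𝔞.circ_mem ha g) ha
  · have h := 𝔞.circ_exp_sub_self_mem hp (𝔞.log_mem hp hg) ha
    rwa [𝔞.exp_log_val] at h

theorem circ_sub_one_mem (g h : 𝔞.GroupLike) : 𝔞.circ g.1 h.1 - 𝔞.one ∈ 𝔞.F 0 1 := by
  have h1 := 𝔞.circ_mem g.2 h
  rw [𝔞.circ_sub, 𝔞.one_circ] at h1
  rw [← sub_add_sub_cancel _ h.1]
  exact Submodule.add_mem _ h1 h.2

/-- The group `1 + F₁ A₀` with the circle product. -/
@[reducible] noncomputable def groupLikeGroup : Group 𝔞.GroupLike where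
  mul g h := ⟨𝔞.circ g.1 h.1, 𝔞.circ_sub_one_mem g h⟩
  one := ⟨𝔞.one, by rw [sub_self]; exact Submodule.zero_mem _⟩
  inv g := ⟨𝔞.exp (-𝔞.log g.1),
    𝔞.exp_sub_one_mem le_rfl (Submodule.neg_mem _ (𝔞.log_val_mem g))⟩
  mul_assoc f g h := Subtype.ext (𝔞.circ_circ f.1 g h)
  one_mul g := Subtype.ext (𝔞.one_circ g)
  mul_one g := Subtype.ext (𝔞.circ_one g.1)
  inv_mul_cancel g := Subtype.ext (by
    have h := 𝔞.circ_exp_neg 𝔞.one (Submodule.neg_mem _ (𝔞.log_val_mem g))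
    rwa [neg_neg, 𝔞.exp_log_val,
      𝔞.one_circ_exp (Submodule.neg_mem _ (𝔞.log_val_mem g))] at h)

/-- The gauge group. -/
@[reducible] noncomputable def gaugeGroup : Group 𝔞.GaugeElement where
  mul x y := ⟨𝔞.bch x.1 y.1, 𝔞.bch_mem le_rfl x.2 y.2⟩
  one := ⟨0, Submodule.zero_mem _⟩
  inv x := ⟨-x.1, Submodule.neg_mem _ x.2⟩
  mul_assoc x y z := Subtype.ext (by
    have hxy := 𝔞.bch_mem le_rfl x.2 y.2
    have hyz := 𝔞.bch_mem le_rfl y.2 z.2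
    -- Associativity of BCH is read off from that of the circle product through the injective
    -- exponential.
    refine 𝔞.exp_injOn (𝔞.bch_mem le_rfl hxy z.2) (𝔞.bch_mem le_rfl x.2 hyz) ?_
    change 𝔞.exp (𝔞.bch (𝔞.bch x.1 y.1) z.1) = 𝔞.exp (𝔞.bch x.1 (𝔞.bch y.1 z.1))
    rw [𝔞.exp_bch hxy z.2, 𝔞.exp_bch x.2 y.2, 𝔞.exp_bch x.2 hyz, 𝔞.exp_bch y.2 z.2]
    exact 𝔞.circ_circ _ (𝔞.expEquiv y) (𝔞.expEquiv z))
  one_mul x := Subtype.ext (by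
    have h0 : (0 : A 0) ∈ 𝔞.F 0 1 := Submodule.zero_mem _
    refine 𝔞.exp_injOn (𝔞.bch_mem le_rfl h0 x.2) x.2 ?_
    change 𝔞.exp (𝔞.bch 0 x.1) = 𝔞.exp x.1
    rw [𝔞.exp_bch h0 x.2, 𝔞.exp_zero, 𝔞.one_circ_exp x.2])
  mul_one x := Subtype.ext (by
    have h0 : (0 : A 0) ∈ 𝔞.F 0 1 := Submodule.zero_mem _
    refine 𝔞.exp_injOn (𝔞.bch_mem le_rfl x.2 h0) x.2 ?_
    change 𝔞.exp (𝔞.bch x.1 0) = 𝔞.exp x.1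
    rw [𝔞.exp_bch x.2 h0, 𝔞.exp_zero, 𝔞.circ_one])
  inv_mul_cancel x := Subtype.ext (by
    have h0 : (0 : A 0) ∈ 𝔞.F 0 1 := Submodule.zero_mem _
    have hx := Submodule.neg_mem _ x.2
    refine 𝔞.exp_injOn (𝔞.bch_mem le_rfl hx x.2) h0 ?_
    have h := 𝔞.circ_exp_neg 𝔞.one hx
    rw [neg_neg, 𝔞.one_circ_exp hx] at h
    change 𝔞.exp (𝔞.bch (-x.1) x.1) = 𝔞.exp 0
    rw [𝔞.exp_bch hx x.2, 𝔞.exp_zero, h])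

attribute [local instance] groupLikeGroup gaugeGroup

theorem groupLike_mul_val (g h : 𝔞.GroupLike) : (g * h).1 = 𝔞.circ g.1 h.1 := rfl

/-- The pre-Lie exponential as a group isomorphism. -/
noncomputable def expMulEquiv : 𝔞.GaugeElement ≃* 𝔞.GroupLike where
  toEquiv := 𝔞.expEquiv
  map_mul' x y := Subtype.ext (𝔞.exp_bch x.2 y.2)

theorem groupLike_mul_sub_mem {n : ℕ} {g h : 𝔞.GroupLike} (hgh : g.1 - h.1 ∈ 𝔞.F 0 n)
    (f : 𝔞.GroupLike) : (g * f).1 - (h * f).1 ∈ 𝔞.F 0 n := by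
  have := 𝔞.circ_mem hgh f
  rwa [𝔞.circ_sub] at this

/-- The filtration of the group `1 + F₁ A₀`. -/
def groupLikeF (n : ℕ) : Subgroup 𝔞.GroupLike where
  carrier := {g | g.1 - 𝔞.one ∈ 𝔞.F 0 n}
  mul_mem' {g h} hg hh := by
    have := Submodule.add_mem _ (𝔞.groupLike_mul_sub_mem (h := 1) hg h) hh
    rwa [_root_.one_mul, sub_add_sub_cancel] at this
  one_mem' := by
    change 𝔞.one - 𝔞.one ∈ 𝔞.F 0 n
    rw [sub_self]; exact Submodule.zero_mem _
  inv_mem' {g} hg := by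
    have := Submodule.neg_mem _ (𝔞.groupLike_mul_sub_mem (h := 1) hg g⁻¹)
    rwa [mul_inv_cancel, _root_.one_mul, neg_sub] at this

theorem mem_groupLikeF {n : ℕ} {g : 𝔞.GroupLike} :
    g ∈ 𝔞.groupLikeF n ↔ g.1 - 𝔞.one ∈ 𝔞.F 0 n := Iff.rfl

/-- The circle product is additive on the left, so `gh - hg` is the difference of `(g-1) ⊚ h -
(g-1)` and `(h-1) ⊚ g - (h-1)`, both in `F (i+j)`. Multiplying on the right by `(hg)⁻¹` gives the
claim. -/
theorem groupLike_commutator_mem {i j : ℕ} {g h : 𝔞.GroupLike} (hg : g ∈ 𝔞.groupLikeF i)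
    (hh : h ∈ 𝔞.groupLikeF j) : g * h * g⁻¹ * h⁻¹ ∈ 𝔞.groupLikeF (i + j) := by
  have h1 := 𝔞.circ_sub_self_mem hg h hh
  have h2 := 𝔞.circ_sub_self_mem hh g hg
  rw [add_comm j i] at h2
  have h3 := Submodule.sub_mem _ h1 h2
  rw [𝔞.circ_sub, 𝔞.circ_sub, 𝔞.one_circ, 𝔞.one_circ] at h3
  have h4 : (g * h).1 - (h * g).1 ∈ 𝔞.F 0 (i + j) := by
    rw [groupLike_mul_val, groupLike_mul_val]
    convert h3 using 1
    abel
  have h5 := 𝔞.groupLike_mul_sub_mem h4 (h * g)⁻¹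
  rw [mul_inv_cancel, mul_inv_rev, ← mul_assoc] at h5
  exact h5

/-- Left cosets are congruence classes modulo `F n`, so the topology of the group is that induced
from `A₀`. -/
theorem inv_mul_mem_groupLikeF {n : ℕ} {g h : 𝔞.GroupLike} :
    g⁻¹ * h ∈ 𝔞.groupLikeF n ↔ h.1 - g.1 ∈ 𝔞.F 0 n := by
  constructor
  · intro hc
    have := 𝔞.circ_sub_self_mem (𝔞.mem_F_zero g.1) (g⁻¹ * h) hc
    rwa [← groupLike_mul_val, mul_inv_cancel_left, _root_.zero_add] at this
  · intro hc
    have h1 := 𝔞.groupLike_mul_sub_mem hc g⁻¹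
    rw [mul_inv_cancel] at h1
    -- The term of index `0` is the whole group, so this commutator estimate expresses normality and
    -- turns `h g⁻¹` into `g⁻¹ h`.
    have h2 := 𝔞.groupLike_commutator_mem (i := 0) (g := g⁻¹) (𝔞.mem_F_zero _)
      (𝔞.mem_groupLikeF.2 h1)
    rw [_root_.zero_add] at h2
    have h3 := Subgroup.mul_mem _ h2 (𝔞.mem_groupLikeF.2 h1)
    simpa [mul_assoc] using h3

/-- The filtration of the gauge group. -/
noncomputable def gaugeF (n : ℕ) : Subgroup 𝔞.GaugeElement :=
  (𝔞.groupLikeF n).comap 𝔞.expMulEquiv.toMonoidHom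

theorem mem_gaugeF_iff_expMulEquiv {n : ℕ} {x : 𝔞.GaugeElement} :
    x ∈ 𝔞.gaugeF n ↔ 𝔞.expMulEquiv x ∈ 𝔞.groupLikeF n := Iff.rfl

/-- Exponential and logarithm both respect the order `n`. These estimates need `n ≥ 1`; for `n = 0`
there is no condition. -/
theorem mem_gaugeF {n : ℕ} {x : 𝔞.GaugeElement} : x ∈ 𝔞.gaugeF n ↔ x.1 ∈ 𝔞.F 0 n := by
  rcases Nat.eq_zero_or_pos n with rfl | hn
  · exact ⟨fun _ => 𝔞.mem_F_zero _, fun _ => 𝔞.mem_F_zero _⟩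
  refine ⟨fun h => ?_, fun h => 𝔞.exp_sub_one_mem hn h⟩
  have := 𝔞.log_mem hn (𝔞.mem_groupLikeF.1 (𝔞.mem_gaugeF_iff_expMulEquiv.1 h))
  rwa [show (𝔞.expMulEquiv x).1 = 𝔞.exp x.1 from rfl, 𝔞.log_exp x.2] at this

theorem map_gaugeF (n : ℕ) :
    (𝔞.gaugeF n).map 𝔞.expMulEquiv.toMonoidHom = 𝔞.groupLikeF n :=
  Subgroup.map_comap_eq_self_of_surjective 𝔞.expMulEquiv.surjective _

theorem inv_mul_mem_gaugeF {n : ℕ} {x y : 𝔞.GaugeElement} :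
    x⁻¹ * y ∈ 𝔞.gaugeF n ↔ (𝔞.expMulEquiv y).1 - (𝔞.expMulEquiv x).1 ∈ 𝔞.F 0 n := by
  rw [mem_gaugeF_iff_expMulEquiv, map_mul, map_inv, inv_mul_mem_groupLikeF]

omit [Algebra ℚ k] [Module ℚ (A 0)] [IsScalarTower ℚ k (A 0)] in
theorem groupLike_ext_of_forall_sub_mem {g h : 𝔞.GroupLike} (hgh : ∀ n, h.1 - g.1 ∈ 𝔞.F 0 n) :
    g = h := (Subtype.ext (𝔞.eq_of_forall_sub_mem hgh)).symm

omit [Algebra ℚ k] [Module ℚ (A 0)] [IsScalarTower ℚ k (A 0)] in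
theorem exists_groupLike_limit {u : ℕ → 𝔞.GroupLike}
    (hu : ∀ n, (u (n + 1)).1 - (u n).1 ∈ 𝔞.F 0 n) : ∃ g : 𝔞.GroupLike, ∀ n,
      (u n).1 - g.1 ∈ 𝔞.F 0 n := by
  obtain ⟨s, hs⟩ := exists_limit_of_surjective (𝔞.F_antitone 0) (𝔞.complete 0).2
    (u := fun n => (u n).1) hu
  refine ⟨⟨s, ?_⟩, fun n => ?_⟩
  · rw [← sub_add_sub_cancel s (u 1).1]
    exact Submodule.add_mem _ (hs 1) (u 1).2
  · rw [← neg_sub]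
    exact Submodule.neg_mem _ (hs n)

theorem isCompleteGroup_groupLikeF : IsCompleteGroup 𝔞.groupLikeF where
  one_eq_top := (Subgroup.eq_top_iff' _).2 fun g => g.2
  antitone _ _ h _ hg := 𝔞.F_antitone 0 h hg
  commutator_mem _ _ _ hx _ hy := 𝔞.groupLike_commutator_mem hx hy
  t2 := t2Space_uniformSpaceOfSetoids fun _ _ h => 𝔞.groupLike_ext_of_forall_sub_mem fun n =>
    𝔞.inv_mul_mem_groupLikeF.1 (QuotientGroup.leftRel_apply.1 (h n))
  complete := completeSpace_uniformSpaceOfSetoids fun _ h _ =>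
    (𝔞.exists_groupLike_limit fun n =>
      𝔞.inv_mul_mem_groupLikeF.1 (QuotientGroup.leftRel_apply.1 (h n))).imp fun _ hg n =>
      QuotientGroup.leftRel_apply.2 (𝔞.inv_mul_mem_groupLikeF.2 (hg n))

theorem isCompleteGroup_gaugeF : IsCompleteGroup 𝔞.gaugeF where
  one_eq_top := (Subgroup.eq_top_iff' _).2 fun x => 𝔞.mem_gaugeF.2 x.2
  antitone _ _ h _ hg := 𝔞.F_antitone 0 h hg
  commutator_mem i j x hx y hy := by
    rw [mem_gaugeF_iff_expMulEquiv, map_mul, map_mul, map_mul, map_inv, map_inv]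
    exact 𝔞.groupLike_commutator_mem hx hy
  t2 := t2Space_uniformSpaceOfSetoids fun _ _ h => 𝔞.expMulEquiv.injective <|
    𝔞.groupLike_ext_of_forall_sub_mem fun n =>
      𝔞.inv_mul_mem_gaugeF.1 (QuotientGroup.leftRel_apply.1 (h n))
  complete := completeSpace_uniformSpaceOfSetoids fun u h _ => by
    obtain ⟨g, hg⟩ := 𝔞.exists_groupLike_limit (u := fun n => 𝔞.expMulEquiv (u n)) fun n =>
      𝔞.inv_mul_mem_gaugeF.1 (QuotientGroup.leftRel_apply.1 (h n))
    refine ⟨𝔞.expMulEquiv.symm g, fun n =>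
      QuotientGroup.leftRel_apply.2 (𝔞.inv_mul_mem_gaugeF.2 ?_)⟩
    rw [MulEquiv.apply_symm_apply]
    exact hg n

theorem isHomeomorph_expMulEquiv :
    @IsHomeomorph _ _ (filteredGroupUniformSpace 𝔞.gaugeF).toTopologicalSpace
      (filteredGroupUniformSpace 𝔞.groupLikeF).toTopologicalSpace 𝔞.expMulEquiv :=
  isHomeomorph_uniformSpaceOfSetoids 𝔞.expMulEquiv.toEquiv fun n x y => by
    rw [QuotientGroup.leftRel_apply, QuotientGroup.leftRel_apply]
    exact 𝔞.inv_mul_mem_gaugeF.trans 𝔞.inv_mul_mem_groupLikeF.symm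

end Rational

end CompletePreLieAlgebra

/-! ### Convergence, the two complete groups and their isomorphism. -/

theorem mainTheorem2 {k : Type*} [CommRing k] [Algebra ℚ k] {A : ℤ → Type*}
    [∀ i, AddCommGroup (A i)] [∀ i, Module k (A i)] (𝔞 : CompletePreLieAlgebra k A) :
    -- all the series involved converge
    (∀ x ∈ 𝔞.F 0 1, IsSeriesSum (𝔞.F 0) (𝔞.expTerm x) (𝔞.exp x)) ∧
    (∀ x ∈ 𝔞.F 0 1, IsSeriesSum (𝔞.F 0) (𝔞.magnusTerm x) (𝔞.log (𝔞.one + x))) ∧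
    (∀ a : A 0, ∀ b ∈ 𝔞.F 0 1,
      IsSeriesSum (𝔞.F 0) (𝔞.circTerm a b) (𝔞.circ a (𝔞.one + b))) ∧
    (∀ x ∈ 𝔞.F 0 1, ∀ y ∈ 𝔞.F 0 1,
      IsSeriesSum (𝔞.F 0) (bchTerm k 𝔞.bracket x y) (𝔞.bch x y)) ∧
    ∃ (_ : Group 𝔞.GroupLike) (_ : Group 𝔞.GaugeElement)
      (FG : ℕ → Subgroup 𝔞.GroupLike) (FΓ : ℕ → Subgroup 𝔞.GaugeElement)
      (e : 𝔞.GaugeElement ≃* 𝔞.GroupLike),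
      -- the group of group-like elements with the circle product is a complete group
      (∀ g h : 𝔞.GroupLike, (g * h).1 = 𝔞.circ g.1 h.1) ∧
      (1 : 𝔞.GroupLike).1 = 𝔞.one ∧
      (∀ (n : ℕ) (g : 𝔞.GroupLike), g ∈ FG n ↔ g.1 - 𝔞.one ∈ 𝔞.F 0 n) ∧
      IsCompleteGroup FG ∧
      -- the gauge group is a complete group
      (∀ x y : 𝔞.GaugeElement, (x * y).1 = 𝔞.bch x.1 y.1) ∧
      (1 : 𝔞.GaugeElement).1 = 0 ∧
      (∀ (n : ℕ) (x : 𝔞.GaugeElement), x ∈ FΓ n ↔ x.1 ∈ 𝔞.F 0 n) ∧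
      IsCompleteGroup FΓ ∧
      -- exponential and logarithm are mutually inverse filtered isomorphisms and homeomorphisms
      (∀ x : 𝔞.GaugeElement, (e x).1 = 𝔞.exp x.1) ∧
      (∀ g : 𝔞.GroupLike, (e.symm g).1 = 𝔞.log g.1) ∧
      (∀ n : ℕ, (FΓ n).map e.toMonoidHom = FG n) ∧
      @IsHomeomorph _ _ (filteredGroupUniformSpace FΓ).toTopologicalSpace
        (filteredGroupUniformSpace FG).toTopologicalSpace e := by
  -- The rational structure is restricted from `k`, so the coefficients of the series act as
  -- rational scalars.
  let : Module ℚ (A 0) := Module.compHom (A 0) (algebraMap ℚ k)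
  have : IsScalarTower ℚ k (A 0) :=
    ⟨fun q c a => by rw [Algebra.smul_def, mul_smul]; rfl⟩
  refine ⟨fun x hx => 𝔞.isSeriesSum_of_mem (𝔞.expTerm_mem hx), fun x hx => ?_, fun a b hb => ?_,
    fun x hx y hy => 𝔞.isSeriesSum_of_mem (𝔞.bchTerm_mem' hx hy), 𝔞.groupLikeGroup, 𝔞.gaugeGroup,
    𝔞.groupLikeF, 𝔞.gaugeF, 𝔞.expMulEquiv, fun _ _ => rfl, rfl, fun _ _ => Iff.rfl,
    𝔞.isCompleteGroup_groupLikeF, fun _ _ => rfl, rfl, fun _ _ => 𝔞.mem_gaugeF,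
    𝔞.isCompleteGroup_gaugeF, fun _ => rfl, fun _ => rfl,
    𝔞.map_gaugeF, 𝔞.isHomeomorph_expMulEquiv⟩
  · rw [CompletePreLieAlgebra.log, add_sub_cancel_left]
    exact 𝔞.isSeriesSum_of_mem (𝔞.magnusTerm_mem' hx)
  · rw [CompletePreLieAlgebra.circ, add_sub_cancel_left]
    exact 𝔞.isSeriesSum_of_mem (𝔞.circTerm_mem a hb)
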